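/- Let $a,b,c,k$ be positive integers with $a\le b<c<2(a+b)$. For $n\ge1$ let $d(a,b;n)=\#\{(m_1,m_2)\in\mathbb N^2: m_1^a m_2^b=n\}$, and let $f_k(a,b;c;n)$ be defined by $$\sum_{n=1}^{\infty}\frac{f_k(a,b;c;n)}{n^s}=\frac{\zeta(as)\zeta(bs)}{\zeta^k(cs)},\qquad \Re s>1.$$ Define the error terms $\Delta(a,b;x)$ and $\Delta_k(a,b;c;x)$ by $$\sum_{n\le x}d(a,b;n)=\zeta\left(\tfrac ba\right)x^{1/a}+\zeta\left(\tfrac ab\right)x^{1/b}+\Delta(a,b;x),$$ $$\sum_{n\le x}f_k(a,b;c;n)=\frac{\zeta(b/a)}{\zeta^k(c/a)}x^{1/a}+\frac{\zeta(a/b)}{\zeta^k(c/b)}x^{1/b}+\Delta_k(a,b;c;x)$$ if $a\ne b$; if $a=b$, the main terms are replaced by their limits as $b\to a$ through real $b\neq a$. Let $\theta_k(a,b;c)$ be the infimum of the real numbers $\theta$ such that $\Delta_k(a,b;c;x)\ll x^{\theta+\varepsilon}$ as $x\to\infty$ for every $\varepsilon>0$. Assume the Riemann Hypothesis. Let $\alpha(a,b)$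 be a real number with $0<\alpha(a,b)<\frac1{a+b}$ such that $\Delta(a,b;x)\ll x^{\alpha(a,b)+\varepsilon}$ as $x\to\infty$ for every $\varepsilon>0$, and suppose $\alpha(a,b)<\frac1c$. Then $$\theta_k(a,b;c)\le\frac{1-a\,\alpha(a,b)}{a+c-2ac\,\alpha(a,b)}.$$ -/

import Mathlib

open Filter Topology Asymptotics
open scoped ArithmeticFunction.Moebius ArithmeticFunction.zeta

noncomputable section

namespace AsymDivisor

/-- The arithmetic function supported on the `a`-th powers whose value at `m ^ a` is `g m`
(for `1 ≤ a`, `1 ≤ m`); its Dirichlet series at `s` is the Dirichlet series of `g` at `a * s`. -/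
def powDilate (a : ℕ) (g : ArithmeticFunction ℤ) : ArithmeticFunction ℤ :=
  ⟨fun n => ∑ m ∈ n.divisors with m ^ a = n, g m, by simp⟩

/-- The coefficients `μ_k(n)` of `1 / ζ(s) ^ k`: the `k`-fold Dirichlet convolution power of the
Möbius function. -/
def muPow (k : ℕ) : ArithmeticFunction ℤ := ArithmeticFunction.moebius ^ k

/-- `d(a,b;n)`, the number of pairs `(m₁, m₂)` of positive integers with `n = m₁ ^ a * m₂ ^ b`. -/
def divisorCount (a b n : ℕ) : ℕ :=
  ((n.divisors ×ˢ n.divisors).filter fun p => p.1 ^ a * p.2 ^ b = n).card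

/-- `f_k(a,b;c;n)`, the coefficients of the Dirichlet series `ζ(as) ζ(bs) / ζ(cs) ^ k`
(see `fCoeff_LSeriesHasSum`). -/
def fCoeff (k a b c : ℕ) : ArithmeticFunction ℤ :=
  powDilate a (ArithmeticFunction.zeta : ArithmeticFunction ℤ) *
    powDilate b (ArithmeticFunction.zeta : ArithmeticFunction ℤ) * powDilate c (muPow k)

/-- `D(a,b;x) = ∑_{n ≤ x} d(a,b;n)`. -/
def divisorSum (a b : ℕ) (x : ℝ) : ℕ := ∑ n ∈ Finset.Icc 1 ⌊x⌋₊, divisorCount a b n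

/-- `A_k(a,b;c;x) = ∑_{n ≤ x} f_k(a,b;c;n)`. -/
def fSum (k a b c : ℕ) (x : ℝ) : ℤ := ∑ n ∈ Finset.Icc 1 ⌊x⌋₊, fCoeff k a b c n

/-- The main term `ζ(b/a) x^(1/a) + ζ(a/b) x^(1/b)` of `D(a,b;x)` for real `a ≠ b`. -/
def divisorMainGeneric (a b x : ℝ) : ℂ :=
  riemannZeta ((b / a : ℝ) : ℂ) * ((x ^ (1 / a) : ℝ) : ℂ) +
    riemannZeta ((a / b : ℝ) : ℂ) * ((x ^ (1 / b) : ℝ) : ℂ)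

/-- The main term of `A_k(a,b;c;x)` for real `a ≠ b`. -/
def fMainGeneric (k : ℕ) (a b c x : ℝ) : ℂ :=
  riemannZeta ((b / a : ℝ) : ℂ) / riemannZeta ((c / a : ℝ) : ℂ) ^ k * ((x ^ (1 / a) : ℝ) : ℂ) +
    riemannZeta ((a / b : ℝ) : ℂ) / riemannZeta ((c / b : ℝ) : ℂ) ^ k * ((x ^ (1 / b) : ℝ) : ℂ)

/-- The main term of `D(a,b;x)`; for `a = b` it is the limit of the generic main term as `b → a`
(see `tendsto_divisorMainGeneric`). -/
def divisorMain (a b : ℕ) (x : ℝ) : ℂ :=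
  if a = b then
    ((x ^ (1 / (a : ℝ)) : ℝ) : ℂ) *
      (((Real.log x / a + 2 * Real.eulerMascheroniConstant - 1 : ℝ)) : ℂ)
  else divisorMainGeneric a b x

/-- The main term of `A_k(a,b;c;x)`; for `a = b` it is the limit of the generic main term as
`b → a` (see `tendsto_fMainGeneric`). -/
def fMain (k a b c : ℕ) (x : ℝ) : ℂ :=
  if a = b then
    ((x ^ (1 / (a : ℝ)) : ℝ) : ℂ) / riemannZeta ((c / a : ℝ) : ℂ) ^ k *
      (((Real.log x / a + 2 * Real.eulerMascheroniConstant - 1 : ℝ) : ℂ) -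
        (k : ℂ) * ((c / a : ℝ) : ℂ) *
          (deriv riemannZeta ((c / a : ℝ) : ℂ) / riemannZeta ((c / a : ℝ) : ℂ)))
  else fMainGeneric k a b c x

/-- The error term `Δ(a,b;x)`. -/
def divisorError (a b : ℕ) (x : ℝ) : ℂ := (divisorSum a b x : ℂ) - divisorMain a b x

/-- The error term `Δ_k(a,b;c;x)`. -/
def fError (k a b c : ℕ) (x : ℝ) : ℂ := (fSum k a b c x : ℂ) - fMain k a b c x

/-- `E(x) ≪ x ^ (α + ε)` as `x → ∞` for every fixed `ε > 0`. -/
def HasErrorExponent (E : ℝ → ℂ) (α : ℝ) : Prop :=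
  ∀ ε : ℝ, 0 < ε → E =O[atTop] fun x : ℝ => x ^ (α + ε)

/-- `θ_k(a,b;c)`, the infimum of the `α` with `Δ_k(a,b;c;x) ≪ x ^ (α + ε)` for every `ε > 0`,
taken in the extended reals, where every infimum exists. -/
def theta (k a b c : ℕ) : EReal :=
  sInf ((fun α : ℝ => (α : EReal)) '' {α : ℝ | HasErrorExponent (fError k a b c) α})

/-! Consistency of the definitions: the generating Dirichlet series, and the limits that give the
main terms for `a = b`. -/

theorem powDilate_pow {a : ℕ} (ha : 1 ≤ a) (g : ArithmeticFunction ℤ) (m : ℕ) :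
    powDilate a g (m ^ a) = g m := by
  rcases Nat.eq_zero_or_pos m with rfl | hm
  · simp [show a ≠ 0 by omega]
  · change ∑ j ∈ (m ^ a).divisors with j ^ a = m ^ a, g j = g m
    have : ((m ^ a).divisors.filter fun j => j ^ a = m ^ a) = {m} := by
      ext j
      simp only [Finset.mem_filter, Nat.mem_divisors, Finset.mem_singleton]
      constructor
      · rintro ⟨-, h⟩
        exact Nat.pow_left_injective (by omega : a ≠ 0) h
      · rintro rfl
        exact ⟨⟨dvd_pow_self _ (by omega), by positivity⟩, rfl⟩
    rw [this, Finset.sum_singleton]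

theorem powDilate_eq_zero {a : ℕ} (g : ArithmeticFunction ℤ) {n : ℕ}
    (h : n ∉ Set.range fun m : ℕ => m ^ a) : powDilate a g n = 0 := by
  change ∑ j ∈ n.divisors with j ^ a = n, g j = 0
  refine Finset.sum_eq_zero fun j hj => ?_
  exact absurd ⟨j, (Finset.mem_filter.1 hj).2⟩ h

theorem powDilate_LSeriesHasSum {a : ℕ} (ha : 1 ≤ a) (g : ArithmeticFunction ℤ) {s v : ℂ}
    (h : LSeriesHasSum (fun n => (g n : ℂ)) (a * s) v) :
    LSeriesHasSum (fun n => (powDilate a g n : ℂ)) s v := by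
  have inj : Function.Injective fun m : ℕ => m ^ a :=
    Nat.pow_left_injective (by omega : a ≠ 0)
  unfold LSeriesHasSum at h ⊢
  rw [← inj.hasSum_iff]
  · convert h using 1
    funext m
    rcases Nat.eq_zero_or_pos m with rfl | hm
    · simp [show a ≠ 0 by omega]
    · have hm' : m ≠ 0 := by omega
      have hma : m ^ a ≠ 0 := by positivity
      simp only [Function.comp, LSeries.term_of_ne_zero hm', LSeries.term_of_ne_zero hma,
        powDilate_pow ha]
      congr 1
      push_cast
      rw [mul_comm (a : ℂ) s, mul_comm s (a : ℂ), Complex.natCast_cpow_natCast_mul]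
  · intro n hn
    rcases Nat.eq_zero_or_pos n with rfl | h0
    · simp
    · rw [LSeries.term_of_ne_zero (by omega), powDilate_eq_zero g hn]
      simp

theorem powDilate_zeta_LSeriesHasSum {a : ℕ} (ha : 1 ≤ a) {s : ℂ} (hs : 1 < s.re) :
    LSeriesHasSum
      (fun n => (powDilate a (ArithmeticFunction.zeta : ArithmeticFunction ℤ) n : ℂ)) s
      (riemannZeta (a * s)) := by
  have h1 : (1 : ℝ) ≤ a := by exact_mod_cast ha
  refine powDilate_LSeriesHasSum ha _ ?_
  have := ArithmeticFunction.LSeriesHasSum_zeta (s := a * s) (by simp; nlinarith)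
  simpa using this

theorem muPow_LSeriesHasSum (k : ℕ) {s : ℂ} (hs : 1 < s.re) :
    LSeriesHasSum (fun n => (muPow k n : ℂ)) s (1 / riemannZeta s ^ k) := by
  have hmu : LSeriesHasSum
      (fun n => (((ArithmeticFunction.moebius : ArithmeticFunction ℂ) n : ℂ))) s
      (1 / riemannZeta s) := by
    have h1 := (ArithmeticFunction.LSeriesSummable_moebius_iff.2 hs).LSeriesHasSum
    have h2 := ArithmeticFunction.LSeries_zeta_mul_Lseries_moebius hs
    rw [ArithmeticFunction.LSeries_zeta_eq_riemannZeta hs] at h2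
    rw [eq_one_div_of_mul_eq_one_right h2] at h1
    simpa using h1
  induction k with
  | zero =>
    have h : LSeriesHasSum (LSeries.delta) s 1 := by
      have h0 : ∀ n, n ≠ 1 → LSeries.term LSeries.delta s n = 0 := by
        intro n hn
        by_cases h : n = 0
        · simp [h]
        · simp [LSeries.term_of_ne_zero h, LSeries.delta, hn]
      have := hasSum_single 1 h0
      simpa [LSeriesHasSum, LSeries.term, LSeries.delta] using this
    convert h using 1
    · funext n
      by_cases h : n = 1 <;> simp [muPow, LSeries.delta, h]
    · simp
  | succ k ih =>
    have ih' : LSeriesHasSum (fun n => ((muPow k : ArithmeticFunction ℂ) n)) s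
      (1 / riemannZeta s ^ k) := by simpa using ih
    have h := ArithmeticFunction.LSeriesHasSum_mul ih' hmu
    rw [← ArithmeticFunction.intCoe_mul] at h
    convert h using 1
    · simp [muPow, pow_succ]
    · rw [pow_succ]
      field_simp

/-- The defining identity of `f_k(a,b;c;n)`: the series converges absolutely for `Re s > 1` and
its sum is `ζ(as) ζ(bs) / ζ(cs) ^ k`. -/
theorem fCoeff_LSeriesHasSum (k : ℕ) {a b c : ℕ} (ha : 1 ≤ a) (hb : 1 ≤ b) (hc : 1 ≤ c) {s : ℂ}
    (hs : 1 < s.re) :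
    LSeriesHasSum (fun n => (fCoeff k a b c n : ℂ)) s
      (riemannZeta (a * s) * riemannZeta (b * s) / riemannZeta (c * s) ^ k) := by
  have h1 : (1 : ℝ) ≤ c := by exact_mod_cast hc
  have hA := powDilate_zeta_LSeriesHasSum ha hs
  have hB := powDilate_zeta_LSeriesHasSum hb hs
  have hC := powDilate_LSeriesHasSum hc (muPow k)
    (muPow_LSeriesHasSum k (s := c * s) (by simp; nlinarith))
  simp only [← ArithmeticFunction.intCoe_apply] at hA hB hC ⊢
  have h := ArithmeticFunction.LSeriesHasSum_mul (ArithmeticFunction.LSeriesHasSum_mul hA hB) hC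
  rw [← ArithmeticFunction.intCoe_mul, ← ArithmeticFunction.intCoe_mul] at h
  rw [div_eq_mul_one_div]
  exact h

theorem tendsto_fMainGeneric (k : ℕ) {a c x : ℝ} (ha : 0 < a) (hac : a < c) (hx : 0 < x) :
    Tendsto (fun β : ℝ => fMainGeneric k a β c x) (𝓝[≠] a)
      (𝓝 (((x ^ (1 / a) : ℝ) : ℂ) / riemannZeta ((c / a : ℝ) : ℂ) ^ k *
        (((Real.log x / a + 2 * Real.eulerMascheroniConstant - 1 : ℝ) : ℂ) -
          (k : ℂ) * ((c / a : ℝ) : ℂ) *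
            (deriv riemannZeta ((c / a : ℝ) : ℂ) / riemannZeta ((c / a : ℝ) : ℂ))))) := by
  have ha0 : a ≠ 0 := ha.ne'
  have hca : 1 < c / a := by rw [lt_div_iff₀ ha]; linarith
  have hz : riemannZeta ((c / a : ℝ) : ℂ) ≠ 0 :=
    riemannZeta_ne_zero_of_one_lt_re (by simpa using hca)
  set z := riemannZeta ((c / a : ℝ) : ℂ) with hzdef
  set z' := deriv riemannZeta ((c / a : ℝ) : ℂ) with hz'def
  set F : ℝ → ℂ := fun β => ((x ^ (1 / β) : ℝ) : ℂ) / riemannZeta ((c / β : ℝ) : ℂ) ^ k with hF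
  have hinv : ∀ t : ℝ, HasDerivAt (fun β : ℝ => t / β) (-t / a ^ 2) a := by
    intro t
    have := (hasDerivAt_inv ha0).const_mul t
    rw [show -t / a ^ 2 = t * -(a ^ 2)⁻¹ by ring]
    exact this
  have hpow : HasDerivAt (fun β : ℝ => ((x ^ (1 / β) : ℝ) : ℂ))
      ((Real.log x * (-1 / a ^ 2) * x ^ (1 / a) : ℝ) : ℂ) a :=
    ((hinv 1).const_rpow hx).ofReal_comp
  have hzd : HasDerivAt (fun β : ℝ => riemannZeta ((c / β : ℝ) : ℂ))
      (z' * ((-c / a ^ 2 : ℝ) : ℂ)) a := by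
    have h1 : HasDerivAt riemannZeta z' ((c / a : ℝ) : ℂ) :=
      (differentiableAt_riemannZeta (by exact_mod_cast hca.ne')).hasDerivAt
    exact h1.comp a (hinv c).ofReal_comp
  have hFd := hpow.fun_div (hzd.fun_pow k) (pow_ne_zero k hz)
  have hFs := hFd.tendsto_slope
  have hFc : Tendsto F (𝓝[≠] a) (𝓝 (F a)) := hFd.continuousAt.tendsto.mono_left nhdsWithin_le_nhds
  have hne : ∀ᶠ β : ℝ in 𝓝[≠] a, β ≠ a ∧ 0 < β := by
    filter_upwards [self_mem_nhdsWithin, nhdsWithin_le_nhds (lt_mem_nhds ha)] with β h1 h2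
    exact ⟨h1, h2⟩
  have hZ : ∀ g : ℝ → ℝ, Tendsto g (𝓝[≠] a) (𝓝 1) → (∀ᶠ β in 𝓝[≠] a, g β ≠ 1) →
      Tendsto (fun β => riemannZeta ((g β : ℝ) : ℂ) - 1 / (((g β : ℝ) : ℂ) - 1)) (𝓝[≠] a)
        (𝓝 (Real.eulerMascheroniConstant : ℂ)) := by
    intro g hg hg1
    refine tendsto_riemannZeta_sub_one_div.comp (tendsto_nhdsWithin_iff.2 ⟨?_, ?_⟩)
    · exact (Complex.continuous_ofReal.tendsto 1).comp hg
    · filter_upwards [hg1] with β h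
      simpa using h
  have hid : Tendsto (fun β : ℝ => β) (𝓝[≠] a) (𝓝 a) := nhdsWithin_le_nhds
  have hZ1 := hZ (fun β => β / a) (by simpa [ha0] using hid.div_const a) (by
    filter_upwards [hne] with β h h'
    exact h.1 (by field_simp at h'; exact h'))
  have hZ2 := hZ (fun β => a / β) (by
    have h := (tendsto_const_nhds (x := a)).div hid ha0
    rw [div_self ha0] at h
    exact h) (by
    filter_upwards [hne] with β h h'
    have := h.2.ne'
    exact h.1 (by field_simp at h'; exact h'.symm))
  have key := (((hZ1.mul_const (F a)).add (hZ2.mul hFc)).sub (hFs.const_mul (a : ℂ))).sub hFc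
  have hval : (Real.eulerMascheroniConstant : ℂ) * F a + Real.eulerMascheroniConstant * F a -
      (a : ℂ) * ((((Real.log x * (-1 / a ^ 2) * x ^ (1 / a) : ℝ) : ℂ) * z ^ k -
        ((x ^ (1 / a) : ℝ) : ℂ) * ((k : ℂ) * z ^ (k - 1) * (z' * ((-c / a ^ 2 : ℝ) : ℂ)))) /
          (z ^ k) ^ 2) - F a =
      ((x ^ (1 / a) : ℝ) : ℂ) / z ^ k *
        (((Real.log x / a + 2 * Real.eulerMascheroniConstant - 1 : ℝ) : ℂ) -
          (k : ℂ) * ((c / a : ℝ) : ℂ) * (z' / z)) := by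
    have haC : (a : ℂ) ≠ 0 := by exact_mod_cast ha0
    simp only [hF, ← hzdef]
    push_cast
    generalize ((x ^ (1 / a) : ℝ) : ℂ) = X
    rcases k with _ | k
    · simp
      field_simp
      ring
    · simp only [Nat.add_sub_cancel]
      field_simp
      ring
  rw [← hval]
  refine key.congr' ?_
  filter_upwards [hne] with β h
  have h1 : (a : ℂ) ≠ 0 := by exact_mod_cast ha0
  have h2 : (β : ℂ) ≠ 0 := by exact_mod_cast h.2.ne'
  have h3 : (β : ℂ) - a ≠ 0 := by
    rw [sub_ne_zero]; exact_mod_cast h.1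
  have h4 : (a : ℂ) - β ≠ 0 := by
    rw [sub_ne_zero]; exact_mod_cast h.1.symm
  have e1 : 1 / (((β / a : ℝ) : ℂ) - 1) = a / (β - a) := by
    push_cast
    rw [div_sub_one h1, one_div_div]
  have e2 : 1 / (((a / β : ℝ) : ℂ) - 1) = - a / (β - a) - 1 := by
    push_cast
    rw [div_sub_one h2, one_div_div, ← neg_sub (β : ℂ) a]
    field_simp
    ring
  have e3 : fMainGeneric k a β c x =
      riemannZeta ((β / a : ℝ) : ℂ) * F a + riemannZeta ((a / β : ℝ) : ℂ) * F β := by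
    simp only [fMainGeneric, hF]
    ring
  change _ * F a + _ * F β - (a : ℂ) * slope F a β - F β = _
  rw [e3, e1, e2, slope_def_module, Complex.real_smul]
  push_cast
  field_simp
  ring

theorem tendsto_divisorMainGeneric {a x : ℝ} (ha : 0 < a) (hx : 0 < x) :
    Tendsto (fun β : ℝ => divisorMainGeneric a β x) (𝓝[≠] a)
      (𝓝 (((x ^ (1 / a) : ℝ) : ℂ) *
        ((Real.log x / a + 2 * Real.eulerMascheroniConstant - 1 : ℝ) : ℂ))) := by
  have h := tendsto_fMainGeneric 0 ha (lt_add_one a) hx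
  simpa [fMainGeneric, divisorMainGeneric] using h

end AsymDivisor

end

noncomputable section

namespace AsymDivisor

/-! ### The divisor bound -/

/-! Since `ζ(as)ζ(bs)/ζ(cs)^k` is the product of the series of `d(a,b;n)` and of `μ_k` dilated by
`c`, and the main terms match because `∑ μ_k(m) m^(-c/a) = ζ(c/a)^(-k)` (likewise for `b`), one has
`Δ_k(x) = ∑_m μ_k(m) Δ(x/m^c)` over all `m` (`hasSum_muPow_mul_divisorError`). The sum is cut at `y
= x^ρ`.

For `m ≤ y` the assumed bound on `Δ` gives `x^α y^(1-cα)` up to `ε`, because `cα < 1`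
(`exists_norm_sum_Ioc_zero_muPow_mul_tentMean_le`).

For `m > y` one passes to Mellin transforms on the line `Re s = σ = 1/(2a) + ε`. The transform of
`Δ` there is `ζ(as)ζ(bs)/s` (`hasMellin_divisorSum_sub_mainTerm`), and summing over `m` multiplies
it by the tail `∑_{m>y} μ_k(m) m^(-cs)`. Under RH both zeta factors are `≪ |t|^ε`
(`exists_norm_riemannZeta_le_rpow`) and the tail is `≪ y^(1/2-cσ+ε) |t|^ε`
(`exists_norm_sum_muTwist_le`, then partial summation). The total is `x^(1/(2a)) y^(1/2-c/(2a))` up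
to `ε` (`exists_norm_sum_Ioc_muPow_mul_tentMean_le`). Equating the two exponents gives `ρ =
(1-2aα)/(a+c-2acα)` and the stated exponent (`fError_isBigO`).

Two obstacles shape the argument. The integrand decays only like `|t|^(ε-1)`, so every summatory
function is first averaged against a tent on `[x, x+2]`. Its coefficients are `≪ n^ε`, so averaging
costs `x^ε`, while the Mellin transform of the tent supplies any decay `|t|^(-η)`, `η ≤ 2`, at the
price `x^η` (`norm_tentMellin_le`). Secondly, when `b ≥ 2a` the line `σ` lies to the right of `1/b`,
where the `x^(1/b)` term of `Δ` has no convergent transform. That term is then split off and its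
large `m` are summed separately (`exists_norm_sum_Ioc_muPow_mul_tentMean_rpow_le`). -/

theorem exists_card_divisors_le_rpow {ε : ℝ} (hε : 0 < ε) :
    ∃ C : ℝ, 0 < C ∧ ∀ n : ℕ, n ≠ 0 → (n.divisors.card : ℝ) ≤ C * (n : ℝ) ^ ε := by
  have hl2 : 0 < Real.log 2 := Real.log_pos one_lt_two
  set K : ℝ := 1 + 1 / (ε * Real.log 2) with hK
  have hK1 : 1 ≤ K := by rw [hK]; have : 0 ≤ 1 / (ε * Real.log 2) := by positivity
                         linarith
  set P : ℕ := ⌈(2 : ℝ) ^ (1 / ε)⌉₊ with hP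
  refine ⟨K ^ P, by positivity, fun n hn => ?_⟩
  -- The quotient of `d(n)` by `n^ε` is a product of local factors `(v+1)/p^(vε)`. Such a factor is
  -- at most `1` once `p^ε ≥ 2`. For the remaining primes, fewer than `P`, it is at most `K`, by
  -- `2^(vε) ≥ 1 + εv log 2`.
  have key : ∀ p ∈ n.primeFactors, ((n.factorization p + 1 : ℕ) : ℝ) ≤
      (if p < P then K else 1) * ((p : ℝ) ^ n.factorization p) ^ ε := by
    intro p hp
    have hp2 : 2 ≤ p := (Nat.prime_of_mem_primeFactors hp).two_le
    have hp2' : (2 : ℝ) ≤ p := by exact_mod_cast hp2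
    set v := n.factorization p
    split_ifs with h
    · have h1 : ((2 : ℝ) ^ v) ^ ε ≤ ((p : ℝ) ^ v) ^ ε := by gcongr
      have h2 : 1 + ε * v * Real.log 2 ≤ ((2 : ℝ) ^ v) ^ ε := by
        rw [← Real.rpow_natCast, ← Real.rpow_mul (by norm_num), Real.rpow_def_of_pos (by norm_num)]
        have := Real.add_one_le_exp (Real.log 2 * (v * ε))
        linarith
      have h3 : (v : ℝ) + 1 ≤ K * (1 + ε * v * Real.log 2) := by
        rw [hK]
        have : (1 + 1 / (ε * Real.log 2)) * (1 + ε * v * Real.log 2) =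
          1 + v + (ε * v * Real.log 2 + 1 / (ε * Real.log 2)) := by field_simp; ring
        rw [this]
        have : 0 ≤ ε * v * Real.log 2 + 1 / (ε * Real.log 2) := by positivity
        linarith
      push_cast
      calc (v : ℝ) + 1 ≤ K * (1 + ε * v * Real.log 2) := h3
        _ ≤ K * ((p : ℝ) ^ v) ^ ε := by gcongr; exact h2.trans h1
    · have h1 : (2 : ℝ) ≤ (p : ℝ) ^ ε := by
        have : (2 : ℝ) ^ (1 / ε) ≤ p := (Nat.le_ceil _).trans (by exact_mod_cast not_lt.1 h)
        calc (2 : ℝ) = ((2 : ℝ) ^ (1 / ε)) ^ ε := by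
              rw [← Real.rpow_mul (by norm_num)]; field_simp; simp
          _ ≤ _ := by gcongr
      rw [one_mul, ← Real.rpow_natCast, ← Real.rpow_mul (by positivity), mul_comm,
        Real.rpow_mul (by positivity), Real.rpow_natCast]
      calc ((v + 1 : ℕ) : ℝ) ≤ ((2 ^ v : ℕ) : ℝ) := by exact_mod_cast Nat.lt_two_pow_self
        _ = (2 : ℝ) ^ v := by push_cast; rfl
        _ ≤ _ := by gcongr
  have hn' : (n : ℝ) ^ ε = ∏ p ∈ n.primeFactors, ((p : ℝ) ^ n.factorization p) ^ ε := by
    rw [Real.finsetProd_rpow _ _ (fun i _ => by positivity)]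
    congr 1
    exact_mod_cast Nat.prod_primeFactors_pow_factorization hn
  rw [Nat.card_divisors hn, hn']
  push_cast at key ⊢
  refine (Finset.prod_le_prod (fun i _ => by positivity) key).trans ?_
  rw [Finset.prod_mul_distrib]
  gcongr
  · rw [Finset.prod_ite, Finset.prod_const, Finset.prod_const_one, mul_one]
    refine pow_le_pow_right₀ hK1 ?_
    calc _ ≤ (Finset.range P).card :=
          Finset.card_le_card fun p hp => Finset.mem_range.2 (Finset.mem_filter.1 hp).2
      _ = P := Finset.card_range P

/-- `f n ≪ n ^ ε` for every `ε > 0`. -/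
def IsSubpolynomial (f : ArithmeticFunction ℤ) : Prop :=
  ∀ ε : ℝ, 0 < ε → ∃ C : ℝ, 0 < C ∧ ∀ n : ℕ, n ≠ 0 → |(f n : ℝ)| ≤ C * (n : ℝ) ^ ε

namespace IsSubpolynomial

theorem of_abs_le_one {f : ArithmeticFunction ℤ} (h : ∀ n, |f n| ≤ 1) : IsSubpolynomial f := by
  refine fun ε hε => ⟨1, one_pos, fun n hn => ?_⟩
  have h1 : (1 : ℝ) ≤ n := by exact_mod_cast Nat.one_le_iff_ne_zero.2 hn
  have h2 : |(f n : ℝ)| ≤ 1 := by exact_mod_cast h n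
  have := Real.one_le_rpow h1 hε.le
  linarith

theorem mul {f g : ArithmeticFunction ℤ} (hf : IsSubpolynomial f) (hg : IsSubpolynomial g) :
    IsSubpolynomial (f * g) := by
  intro ε hε
  obtain ⟨A, hA, hfA⟩ := hf (ε / 2) (by positivity)
  obtain ⟨B, hB, hgB⟩ := hg (ε / 2) (by positivity)
  obtain ⟨D, hD, hdD⟩ := exists_card_divisors_le_rpow (half_pos hε)
  refine ⟨A * B * D, by positivity, fun n hn => ?_⟩
  rw [ArithmeticFunction.mul_apply]
  push_cast
  refine (Finset.abs_sum_le_sum_abs _ _).trans ?_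
  have : ∀ p ∈ n.divisorsAntidiagonal, |(f p.1 : ℝ) * (g p.2 : ℝ)| ≤ A * B * (n : ℝ) ^ (ε / 2) := by
    rintro ⟨u, v⟩ hp
    obtain ⟨rfl, -⟩ := Nat.mem_divisorsAntidiagonal.1 hp
    obtain ⟨hu, hv⟩ := mul_ne_zero_iff.1 hn
    rw [abs_mul]
    push_cast
    rw [Real.mul_rpow (by positivity) (by positivity)]
    calc _ ≤ (A * (u : ℝ) ^ (ε / 2)) * (B * (v : ℝ) ^ (ε / 2)) :=
          mul_le_mul (hfA u hu) (hgB v hv) (abs_nonneg _) (by positivity)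
      _ = _ := by ring
  refine (Finset.sum_le_card_nsmul _ _ _ this).trans ?_
  rw [nsmul_eq_mul, ← Nat.map_div_right_divisors, Finset.card_map]
  calc (n.divisors.card : ℝ) * (A * B * (n : ℝ) ^ (ε / 2))
      ≤ (D * (n : ℝ) ^ (ε / 2)) * (A * B * (n : ℝ) ^ (ε / 2)) := by gcongr; exact hdD n hn
    _ = A * B * D * ((n : ℝ) ^ (ε / 2) * (n : ℝ) ^ (ε / 2)) := by ring
    _ = _ := by rw [← Real.rpow_add (by positivity)]; simp

theorem pow {f : ArithmeticFunction ℤ} (hf : IsSubpolynomial f) (k : ℕ) :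
    IsSubpolynomial (f ^ k) := by
  induction k with
  | zero =>
    refine of_abs_le_one fun n => ?_
    rw [pow_zero, ArithmeticFunction.one_apply]
    split_ifs <;> simp
  | succ k ih => rw [pow_succ]; exact ih.mul hf

theorem powDilate {a : ℕ} (ha : 1 ≤ a) {g : ArithmeticFunction ℤ} (hg : IsSubpolynomial g) :
    IsSubpolynomial (powDilate a g) := by
  intro ε hε
  obtain ⟨C, hC, h⟩ := hg ε hε
  refine ⟨C, hC, fun n hn => ?_⟩
  by_cases hr : n ∈ Set.range fun m : ℕ => m ^ a
  · obtain ⟨m, rfl⟩ := hr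
    simp only at hn ⊢
    have hm : m ≠ 0 := by rintro rfl; simp [show a ≠ 0 by omega] at hn
    rw [powDilate_pow ha]
    refine (h m hm).trans ?_
    gcongr
    exact_mod_cast Nat.le_self_pow (by omega) m
  · rw [powDilate_eq_zero g hr]
    simp only [Int.cast_zero, abs_zero]
    positivity

end IsSubpolynomial

theorem muPow_isSubpolynomial (k : ℕ) : IsSubpolynomial (muPow k) :=
  (IsSubpolynomial.of_abs_le_one fun _ => ArithmeticFunction.abs_moebius_le_one).pow k

theorem zeta_isSubpolynomial : IsSubpolynomial (ArithmeticFunction.zeta : ArithmeticFunction ℤ) :=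
  IsSubpolynomial.of_abs_le_one fun n => by
    rw [ArithmeticFunction.natCoe_apply, ArithmeticFunction.zeta_apply]
    split_ifs <;> simp

theorem fCoeff_isSubpolynomial (k : ℕ) {a b c : ℕ} (ha : 1 ≤ a) (hb : 1 ≤ b) (hc : 1 ≤ c) :
    IsSubpolynomial (fCoeff k a b c) :=
  ((zeta_isSubpolynomial.powDilate ha).mul (zeta_isSubpolynomial.powDilate hb)).mul
    ((muPow_isSubpolynomial k).powDilate hc)

theorem muPow_LSeriesSummable (k : ℕ) {s : ℂ} (hs : 1 < s.re) :
    LSeriesSummable (fun n => (muPow k n : ℂ)) s := (muPow_LSeriesHasSum k hs).LSeriesSummable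

theorem muPow_summable_rpow (k : ℕ) {σ : ℝ} (hσ : 1 < σ) :
    Summable fun m : ℕ => |(muPow k m : ℝ)| * (m : ℝ) ^ (-σ) := by
  have h := (muPow_LSeriesSummable k (s := σ) (by simpa using hσ)).norm
  refine h.congr fun m => ?_
  rcases eq_or_ne m 0 with rfl | hm
  · simp
  · rw [LSeries.norm_term_eq, if_neg hm, Real.rpow_neg (by positivity), Complex.ofReal_re,
      div_eq_mul_inv]
    simp

/-! ### Summatory functions -/

theorem powDilate_zeta_mul_apply {a b : ℕ} (ha : 1 ≤ a) (hb : 1 ≤ b) (n : ℕ) :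
    (powDilate a (ArithmeticFunction.zeta : ArithmeticFunction ℤ) *
      powDilate b (ArithmeticFunction.zeta : ArithmeticFunction ℤ)) n = divisorCount a b n := by
  rcases eq_or_ne n 0 with rfl | hn
  · simp [divisorCount]
  rw [ArithmeticFunction.mul_apply]
  have hval : ∀ {e : ℕ}, 1 ≤ e → ∀ u : ℕ, u ≠ 0 →
      powDilate e (ArithmeticFunction.zeta : ArithmeticFunction ℤ) u =
        ((u.divisors.filter fun j => j ^ e = u).card : ℤ) := by
    intro e he u hu
    change ∑ j ∈ u.divisors with j ^ e = u, (ArithmeticFunction.zeta : ArithmeticFunction ℤ) j = _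
    rw [Finset.card_eq_sum_ones]
    push_cast
    refine Finset.sum_congr rfl fun j hj => ?_
    have : j ≠ 0 := (Nat.pos_of_mem_divisors (Finset.mem_filter.1 hj).1).ne'
    rw [ArithmeticFunction.natCoe_apply, ArithmeticFunction.zeta_apply_ne this]
    rfl
  -- The pairs counted by `divisorCount` are sorted by the factorization `(m₁^a, m₂^b)` of `n`; each
  -- fibre is a product of two sets with at most one element.
  have : ∀ p ∈ n.divisorsAntidiagonal,
      powDilate a (ArithmeticFunction.zeta : ArithmeticFunction ℤ) p.1 *
        powDilate b (ArithmeticFunction.zeta : ArithmeticFunction ℤ) p.2 =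
      (((n.divisors ×ˢ n.divisors).filter fun q => q.1 ^ a * q.2 ^ b = n).filter
        fun q => (q.1 ^ a, q.2 ^ b) = p).card := by
    rintro ⟨u, v⟩ hp
    obtain ⟨rfl, -⟩ := Nat.mem_divisorsAntidiagonal.1 hp
    obtain ⟨hu, hv⟩ := mul_ne_zero_iff.1 hn
    rw [hval ha u hu, hval hb v hv, ← Nat.cast_mul, ← Finset.card_product]
    congr 2
    ext ⟨i, j⟩
    simp only [Finset.mem_product, Finset.mem_filter, Nat.mem_divisors, Prod.mk.injEq]
    constructor
    · rintro ⟨⟨⟨h1, -⟩, h2⟩, ⟨h3, -⟩, h4⟩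
      exact ⟨⟨⟨⟨h1.mul_right _, hn⟩, ⟨h3.mul_left _, hn⟩⟩, by rw [h2, h4]⟩, h2, h4⟩
    · rintro ⟨-, h2, h4⟩
      refine ⟨⟨⟨?_, hu⟩, h2⟩, ⟨?_, hv⟩, h4⟩
      · rw [← h2]; exact dvd_pow_self _ (by omega)
      · rw [← h4]; exact dvd_pow_self _ (by omega)
  rw [Finset.sum_congr rfl this, ← Nat.cast_sum, divisorCount]
  congr 1
  refine (Finset.card_eq_sum_card_fiberwise fun q hq => ?_).symm
  have hq' := (Finset.mem_filter.1 hq).2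
  exact Nat.mem_divisorsAntidiagonal.2 ⟨hq', hn⟩

theorem fCoeff_eq_mul {k a b c : ℕ} :
    fCoeff k a b c = powDilate c (muPow k) *
      (powDilate a (ArithmeticFunction.zeta : ArithmeticFunction ℤ) *
      powDilate b (ArithmeticFunction.zeta : ArithmeticFunction ℤ)) := mul_comm _ _

theorem divisorSum_eq_zero {a b : ℕ} {x : ℝ} (hx : x < 1) : divisorSum a b x = 0 := by
  rw [divisorSum, Nat.floor_eq_zero.2 hx]; rfl

/-- The Dirichlet convolution is summed with the sparse factor outside. Terms beyond `⌊x⌋₊` vanish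
because `D(a,b;v) = 0` for `v < 1`, which leaves the cutoff `N` free. -/
theorem fSum_eq_sum {k a b c : ℕ} (ha : 1 ≤ a) (hb : 1 ≤ b) (hc : 1 ≤ c) {x : ℝ} {N : ℕ}
    (hN : ⌊x⌋₊ ≤ N) :
    fSum k a b c x = ∑ m ∈ Finset.Ioc 0 N, muPow k m * (divisorSum a b (x / (m : ℝ) ^ c) : ℤ) := by
  have hstep : fSum k a b c x = ∑ m ∈ Finset.Ioc 0 (N ^ c),
      powDilate c (muPow k) m * (divisorSum a b (x / m) : ℤ) := by
    have h1 : Finset.Icc 1 ⌊x⌋₊ = Finset.Ioc 0 ⌊x⌋₊ := rfl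
    rw [fSum, h1, fCoeff_eq_mul, ArithmeticFunction.sum_Ioc_mul_eq_sum_sum]
    have hsub : Finset.Ioc 0 ⌊x⌋₊ ⊆ Finset.Ioc 0 (N ^ c) :=
      Finset.Ioc_subset_Ioc_right (hN.trans (Nat.le_self_pow (by omega) N))
    rw [← Finset.sum_subset hsub]
    · refine Finset.sum_congr rfl fun m _ => ?_
      congr 1
      rw [divisorSum, Nat.floor_div_natCast]
      push_cast
      exact Finset.sum_congr rfl fun n _ => powDilate_zeta_mul_apply ha hb n
    · intro m hm hm'
      have hm0 : 0 < m := (Finset.mem_Ioc.1 hm).1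
      have : x < m := by
        by_contra hcon
        exact hm' (Finset.mem_Ioc.2 ⟨hm0, Nat.le_floor (not_lt.1 hcon)⟩)
      rw [divisorSum_eq_zero ((div_lt_one (by exact_mod_cast hm0)).2 this)]
      simp
  rw [hstep]
  symm
  have hinj : Function.Injective fun m : ℕ => m ^ c := Nat.pow_left_injective (by omega : c ≠ 0)
  rw [← Finset.sum_subset (s₁ := (Finset.Ioc 0 N).image fun m => m ^ c) (s₂ := Finset.Ioc 0 (N ^ c))]
  · rw [Finset.sum_image hinj.injOn]
    refine Finset.sum_congr rfl fun m _ => ?_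
    rw [powDilate_pow hc]
    push_cast
    rfl
  · intro j hj
    obtain ⟨m, hm, rfl⟩ := Finset.mem_image.1 hj
    rw [Finset.mem_Ioc] at hm ⊢
    exact ⟨by have := hm.1; positivity, Nat.pow_le_pow_left hm.2 c⟩
  · intro j hj hj'
    rw [powDilate_eq_zero, zero_mul]
    rintro ⟨m, rfl⟩
    apply hj'
    rw [Finset.mem_Ioc] at hj
    refine Finset.mem_image.2 ⟨m, Finset.mem_Ioc.2 ⟨?_, ?_⟩, rfl⟩
    · rcases Nat.eq_zero_or_pos m with rfl | h
      · simp [show c ≠ 0 by omega] at hj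
      · exact h
    · exact (Nat.pow_le_pow_iff_left (by omega)).1 hj.2

/-- Summatory functions of sequences of size `n ^ ε` vary slowly. -/
theorem norm_sum_Icc_sub_le {f : ℕ → ℂ} {C ε : ℝ} (hε : 0 ≤ ε) (hC : 0 ≤ C)
    (hf : ∀ n : ℕ, n ≠ 0 → ‖f n‖ ≤ C * (n : ℝ) ^ ε) {x u : ℝ} (hx : 0 ≤ x) (hxu : x ≤ u)
    (hux : u ≤ x + 2) :
    ‖∑ n ∈ Finset.Icc 1 ⌊u⌋₊, f n - ∑ n ∈ Finset.Icc 1 ⌊x⌋₊, f n‖ ≤ 2 * C * (x + 2) ^ ε := by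
  have hfl : ⌊x⌋₊ ≤ ⌊u⌋₊ := Nat.floor_le_floor hxu
  have h1 : ∑ n ∈ Finset.Icc 1 ⌊u⌋₊, f n - ∑ n ∈ Finset.Icc 1 ⌊x⌋₊, f n =
      ∑ n ∈ Finset.Ioc ⌊x⌋₊ ⌊u⌋₊, f n := by
    change ∑ n ∈ Finset.Ioc 0 ⌊u⌋₊, f n - ∑ n ∈ Finset.Ioc 0 ⌊x⌋₊, f n = _
    rw [sub_eq_iff_eq_add', Finset.sum_Ioc_consecutive _ (Nat.zero_le _) hfl]
  rw [h1]
  have h2 : ∀ n ∈ Finset.Ioc ⌊x⌋₊ ⌊u⌋₊, ‖f n‖ ≤ C * (x + 2) ^ ε := by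
    intro n hn
    rw [Finset.mem_Ioc] at hn
    refine (hf n (by omega)).trans ?_
    have : (n : ℝ) ≤ u := (Nat.le_floor_iff (hx.trans hxu)).1 hn.2
    gcongr
    linarith
  have h3 : ⌊u⌋₊ ≤ ⌊x⌋₊ + 2 := by
    rw [← Nat.floor_add_ofNat hx]
    exact Nat.floor_le_floor (by simpa using hux)
  refine (norm_sum_le_of_le _ h2).trans ?_
  rw [Finset.sum_const, Nat.card_Ioc, nsmul_eq_mul, mul_assoc 2]
  have h4 : ((⌊u⌋₊ - ⌊x⌋₊ : ℕ) : ℝ) ≤ 2 := by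
    have : ⌊u⌋₊ - ⌊x⌋₊ ≤ 2 := by omega
    exact_mod_cast this
  gcongr

open MeasureTheory

/-! ### Analytic continuation of truncated Mellin integrals -/

/-- Truncation to `(1, ∞)` removes every constraint at the origin, so the Mellin transform
converges, holomorphically, on a whole half-plane. -/
theorem indicator_Ioi_one_isBigO_zero (h : ℝ → ℂ) (b : ℝ) :
    (Set.Ioi 1).indicator h =O[𝓝[>] 0] fun u : ℝ => u ^ b := by
  have : (Set.Ioi 1).indicator h =ᶠ[𝓝[>] (0 : ℝ)] 0 := by
    filter_upwards [nhdsWithin_le_nhds (gt_mem_nhds one_pos)] with u hu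
    exact Set.indicator_of_notMem (not_lt.2 hu.le) h
  exact this.trans_isBigO (isBigO_zero _ _)

theorem locallyIntegrableOn_indicator_Ioi {h : ℝ → ℂ} (hloc : LocallyIntegrableOn h (Set.Ioi 0)) :
    LocallyIntegrableOn ((Set.Ioi 1).indicator h) (Set.Ioi 0) := by
  intro x hx
  obtain ⟨t, ht, hint⟩ := hloc x hx
  exact ⟨t, ht, hint.indicator measurableSet_Ioi⟩

theorem isBigO_indicator_Ioi_one {h : ℝ → ℂ} {β : ℝ} (hO : h =O[atTop] fun u : ℝ => u ^ β) :
    (Set.Ioi 1).indicator h =O[atTop] fun u : ℝ => u ^ (-(-β)) := by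
  rw [neg_neg]
  refine (IsBigO.congr' hO ?_ EventuallyEq.rfl)
  filter_upwards [eventually_gt_atTop 1] with u hu
  exact (Set.indicator_of_mem hu h).symm

/-- A Dirichlet variable `s` corresponds to the Mellin variable `-s`; this sign convention holds
throughout. -/
theorem mellin_indicator_Ioi_one (h : ℝ → ℂ) (s : ℂ) :
    mellin ((Set.Ioi 1).indicator h) (-s) =
      ∫ u in Set.Ioi (1 : ℝ), h u * (u : ℂ) ^ (-(s + 1)) := by
  have h1 : ∀ u : ℝ, (u : ℂ) ^ (-s - 1) • (Set.Ioi 1).indicator h u =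
      (Set.Ioi 1).indicator (fun u : ℝ => h u * (u : ℂ) ^ (-(s + 1))) u := by
    intro u
    by_cases hu : u ∈ Set.Ioi (1 : ℝ)
    · rw [Set.indicator_of_mem hu, Set.indicator_of_mem hu, smul_eq_mul, mul_comm]
      ring_nf
    · rw [Set.indicator_of_notMem hu, Set.indicator_of_notMem hu, smul_zero]
  rw [mellin]
  simp_rw [h1]
  rw [setIntegral_indicator measurableSet_Ioi, Set.inter_eq_right.2 (Set.Ioi_subset_Ioi zero_le_one)]

theorem mellinConvergent_indicator_Ioi_one {h : ℝ → ℂ} {β : ℝ}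
    (hloc : LocallyIntegrableOn h (Set.Ioi 0)) (hO : h =O[atTop] fun u : ℝ => u ^ β) {s : ℂ}
    (hs : β < s.re) : MellinConvergent ((Set.Ioi 1).indicator h) (-s) :=
  mellinConvergent_of_isBigO_rpow (locallyIntegrableOn_indicator_Ioi hloc)
    (isBigO_indicator_Ioi_one hO) (by simpa using hs)
    (indicator_Ioi_one_isBigO_zero h (-(-s.re - 1))) (by simp)

theorem integrableOn_Ioi_one_mul_cpow {h : ℝ → ℂ} {β : ℝ}
    (hloc : LocallyIntegrableOn h (Set.Ioi 0)) (hO : h =O[atTop] fun u : ℝ => u ^ β) {s : ℂ}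
    (hs : β < s.re) :
    IntegrableOn (fun u : ℝ => h u * (u : ℂ) ^ (-(s + 1))) (Set.Ioi 1) := by
  have := mellinConvergent_indicator_Ioi_one hloc hO hs
  refine (this.mono_set (Set.Ioi_subset_Ioi zero_le_one)).congr_fun (fun u hu => ?_)
    measurableSet_Ioi
  simp only [Set.indicator_of_mem hu, smul_eq_mul]
  rw [mul_comm]
  ring_nf

/-- An identity between a truncated Mellin integral and a function holomorphic off the real axis
extends from a right half-plane to the whole half-plane of absolute convergence. -/
theorem integral_Ioi_one_eq_of_forall_re_gt {h : ℝ → ℂ} {β σ₀ : ℝ} {F : ℂ → ℂ}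
    (hloc : LocallyIntegrableOn h (Set.Ioi 0)) (hO : h =O[atTop] fun u : ℝ => u ^ β)
    (hF : ∀ s : ℂ, s.im ≠ 0 → DifferentiableAt ℂ F s)
    (hEq : ∀ s : ℂ, σ₀ < s.re → ∫ u in Set.Ioi (1 : ℝ), h u * (u : ℂ) ^ (-(s + 1)) = F s)
    {s : ℂ} (hs : β < s.re) (him : s.im ≠ 0) :
    ∫ u in Set.Ioi (1 : ℝ), h u * (u : ℂ) ^ (-(s + 1)) = F s := by
  set M : ℂ → ℂ := fun s => mellin ((Set.Ioi 1).indicator h) (-s) with hM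
  have hMd : ∀ s : ℂ, β < s.re → DifferentiableAt ℂ M s := by
    intro s hs
    have := mellin_differentiableAt_of_isBigO_rpow (s := -s)
      (locallyIntegrableOn_indicator_Ioi hloc) (isBigO_indicator_Ioi_one hO) (by simpa using hs)
      (indicator_Ioi_one_isBigO_zero h (-(-s.re - 1))) (by simp)
    exact this.comp s differentiableAt_id.neg
  rw [← mellin_indicator_Ioi_one]
  change M s = F s
  set e : ℝ := s.im with he
  -- The quarter-plane on the same side of the real axis as `s`: convex, hence connected, and free
  -- of the possible real poles of `F`.
  set U : Set ℂ := {z | β < z.re} ∩ {z | 0 < e * z.im} with hU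
  have hUo : IsOpen U := (isOpen_lt continuous_const Complex.continuous_re).inter
    (isOpen_lt continuous_const (continuous_const.mul Complex.continuous_im))
  have hUc : Convex ℝ U := by
    refine (convex_halfSpace_re_gt β).inter ?_
    exact convex_halfSpace_gt (f := fun z : ℂ => e * z.im)
      ⟨fun x y => by simp [mul_add], fun c x => by simp; ring⟩ 0
  have hMa : AnalyticOnNhd ℂ M U := DifferentiableOn.analyticOnNhd
    (fun z hz => (hMd z hz.1).differentiableWithinAt) hUo
  have hFa : AnalyticOnNhd ℂ F U := DifferentiableOn.analyticOnNhd
    (fun z hz => (hF z (fun h0 => by simpa [h0] using hz.2)).differentiableWithinAt) hUo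
  have hpos : 0 < e * e := mul_self_pos.2 him
  set z₀ : ℂ := ⟨max β σ₀ + 1, e⟩ with hz0
  have hz₀ : z₀ ∈ U := ⟨by simp [hz0]; linarith [le_max_left β σ₀], hpos⟩
  refine hMa.eqOn_of_preconnected_of_eventuallyEq hFa hUc.isPreconnected hz₀ ?_ ⟨hs, hpos⟩
  have : {z : ℂ | σ₀ < z.re} ∈ 𝓝 z₀ :=
    (isOpen_lt continuous_const Complex.continuous_re).mem_nhds
      (by simp [hz0]; linarith [le_max_right β σ₀])
  filter_upwards [this] with z hz
  rw [hM]
  simp only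
  rw [mellin_indicator_Ioi_one, hEq z hz]

theorem locallyIntegrableOn_sum_Icc (f : ℕ → ℂ) :
    LocallyIntegrableOn (fun u : ℝ => ∑ n ∈ Finset.Icc 1 ⌊u⌋₊, f n) (Set.Ioi 0) := by
  have := locallyIntegrableOn_mul_sum_Icc (𝕜 := ℂ) f (a := 0) (m := 1) le_rfl (g := fun _ => 1)
    (continuous_const.locallyIntegrable.locallyIntegrableOn _)
  simpa using this.mono_set Set.Ioi_subset_Ici_self

theorem integral_Ioi_one_rpow_mul_cpow {γ : ℝ} {s : ℂ} (hs : γ < s.re) :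
    ∫ u in Set.Ioi (1 : ℝ), ((u ^ γ : ℝ) : ℂ) * (u : ℂ) ^ (-(s + 1)) = 1 / (s - γ) := by
  have h1 : ∀ u ∈ Set.Ioi (1 : ℝ), ((u ^ γ : ℝ) : ℂ) * (u : ℂ) ^ (-(s + 1)) =
      (u : ℂ) ^ ((γ : ℂ) - s - 1) := by
    intro u hu
    have hu0 : (0 : ℝ) < u := one_pos.trans hu
    rw [Complex.ofReal_cpow hu0.le, ← Complex.cpow_add _ _ (by exact_mod_cast hu0.ne')]
    ring_nf
  rw [setIntegral_congr_fun measurableSet_Ioi h1, integral_Ioi_cpow_of_lt (by simp; linarith)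
    one_pos]
  rw [Complex.ofReal_one, Complex.one_cpow, sub_add_cancel, ← neg_sub s, div_neg, neg_div, neg_neg]

/-! ### Growth of the zeta function -/

/-- For `Re s > 1` the integrals of `⌊u⌋` and `u` can be taken separately. Their difference is
bounded, so the identity continues to `Re s > 0`. -/
theorem integral_floor_sub_eq {s : ℂ} (hs : 0 < s.re) (him : s.im ≠ 0) :
    ∫ u in Set.Ioi (1 : ℝ), (((⌊u⌋₊ : ℝ) - u : ℝ) : ℂ) * (u : ℂ) ^ (-(s + 1)) =
      riemannZeta s / s - 1 / (s - 1) := by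
  have hl1 : LocallyIntegrableOn (fun u : ℝ => ((⌊u⌋₊ : ℝ) : ℂ)) (Set.Ioi 0) := by
    have := locallyIntegrableOn_sum_Icc (fun _ => 1)
    refine this.congr ?_
    filter_upwards with u
    simp
  have hl2 : LocallyIntegrableOn (fun u : ℝ => ((u ^ (1 : ℝ) : ℝ) : ℂ)) (Set.Ioi 0) := by
    simp only [Real.rpow_one]
    exact Complex.continuous_ofReal.locallyIntegrable.locallyIntegrableOn _
  have hl : LocallyIntegrableOn (fun u : ℝ => (((⌊u⌋₊ : ℝ) - u : ℝ) : ℂ)) (Set.Ioi 0) := by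
    simpa using! hl1.sub hl2
  have hO1 : (fun u : ℝ => ((⌊u⌋₊ : ℝ) : ℂ)) =O[atTop] fun u : ℝ => u ^ (1 : ℝ) := by
    refine IsBigO.of_bound 1 ?_
    filter_upwards [eventually_ge_atTop 0] with u hu
    simpa [abs_of_nonneg hu] using Nat.floor_le hu
  have hO2 : (fun u : ℝ => ((u ^ (1 : ℝ) : ℝ) : ℂ)) =O[atTop] fun u : ℝ => u ^ (1 : ℝ) :=
    IsBigO.of_bound 1 (by simp)
  have hO : (fun u : ℝ => (((⌊u⌋₊ : ℝ) - u : ℝ) : ℂ)) =O[atTop] fun u : ℝ => u ^ (0 : ℝ) := by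
    refine IsBigO.of_bound 1 ?_
    filter_upwards [eventually_ge_atTop 0] with u hu
    rw [Complex.norm_real, Real.norm_eq_abs, Real.rpow_zero, norm_one, mul_one, abs_le]
    have := Nat.floor_le hu
    have := Nat.lt_floor_add_one u
    constructor <;> linarith
  refine integral_Ioi_one_eq_of_forall_re_gt (σ₀ := 1) hl hO
    (F := fun s => riemannZeta s / s - 1 / (s - 1)) ?_ ?_ hs him
  · intro z hz
    have h0 : z ≠ 0 := by rintro rfl; simp at hz
    have h1 : z ≠ 1 := by rintro rfl; simp at hz
    exact ((differentiableAt_riemannZeta h1).div differentiableAt_id h0).sub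
      ((differentiableAt_const _).div (differentiableAt_id.sub_const 1) (sub_ne_zero.2 h1))
  · intro z hz
    have hz0 : z ≠ 0 := by rintro rfl; simp at hz; linarith
    have e1 := integral_Ioi_one_rpow_mul_cpow (γ := 1) hz
    have e2 := LSeries_eq_mul_integral (fun _ => 1) zero_le_one hz
      (LSeriesSummable_one_iff.2 hz) (by
        refine IsBigO.of_bound 1 ?_
        filter_upwards with n
        simp)
    rw [show (fun _ => 1 : ℕ → ℂ) = 1 from rfl, LSeries_one_eq_riemannZeta hz] at e2
    have e3 : ∫ u in Set.Ioi (1 : ℝ), ((⌊u⌋₊ : ℝ) : ℂ) * (u : ℂ) ^ (-(z + 1)) =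
        riemannZeta z / z := by
      rw [e2, mul_div_cancel_left₀ _ hz0]
      simp
    have i1 := integrableOn_Ioi_one_mul_cpow hl1 hO1 hz
    have i2 := integrableOn_Ioi_one_mul_cpow hl2 hO2 hz
    have := integral_sub i1 i2
    rw [e3, e1] at this
    rw [Complex.ofReal_one] at this
    rw [← this]
    refine setIntegral_congr_fun measurableSet_Ioi fun u _ => ?_
    simp [sub_mul]

/-- The constant is `2 + 2`: one from `∫_1^∞ u^(-3/2) du`, one from `1/|s-1|`. Any polynomial bound
would do, since only its logarithm is used. -/
theorem norm_riemannZeta_le {s : ℂ} (hs : 1 / 2 ≤ s.re) (him : 1 / 2 ≤ |s.im|) :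
    ‖riemannZeta s‖ ≤ 4 * ‖s‖ := by
  have him0 : s.im ≠ 0 := by intro h; rw [h] at him; norm_num at him
  have hs0 : s ≠ 0 := by rintro rfl; simp at him0
  have key := integral_floor_sub_eq (by linarith : 0 < s.re) him0
  have hI : ‖∫ u in Set.Ioi (1 : ℝ), (((⌊u⌋₊ : ℝ) - u : ℝ) : ℂ) * (u : ℂ) ^ (-(s + 1))‖ ≤ 2 := by
    have hg : IntegrableOn (fun u : ℝ => u ^ (-(3 / 2) : ℝ)) (Set.Ioi 1) :=
      integrableOn_Ioi_rpow_of_lt (by norm_num) one_pos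
    refine (norm_integral_le_of_norm_le hg ?_).trans ?_
    · filter_upwards [self_mem_ae_restrict measurableSet_Ioi] with u hu
      have hu1 : (1 : ℝ) < u := hu
      have hu0 : (0 : ℝ) < u := one_pos.trans hu1
      rw [norm_mul, Complex.norm_real, Complex.norm_cpow_eq_rpow_re_of_pos hu0]
      have h1 : ‖(⌊u⌋₊ : ℝ) - u‖ ≤ 1 := by
        rw [Real.norm_eq_abs, abs_le]
        have := Nat.floor_le hu0.le
        have := Nat.lt_floor_add_one u
        constructor <;> linarith
      have h2 : u ^ (-(s + 1)).re ≤ u ^ (-(3 / 2) : ℝ) :=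
        Real.rpow_le_rpow_of_exponent_le hu1.le (by simp; linarith)
      calc _ ≤ 1 * u ^ (-(3 / 2) : ℝ) := by gcongr
        _ = _ := one_mul _
    · rw [integral_Ioi_rpow_of_lt (by norm_num) one_pos]
      norm_num
  have h2 : ‖1 / (s - 1)‖ ≤ 2 := by
    have : 1 / 2 ≤ ‖s - 1‖ := him.trans (by simpa using Complex.abs_im_le_norm (s - 1))
    rw [norm_div, norm_one, div_le_iff₀ (by linarith)]
    linarith
  have h3 : ‖riemannZeta s / s‖ ≤ 4 := by
    have : riemannZeta s / s = (riemannZeta s / s - 1 / (s - 1)) + 1 / (s - 1) := by ring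
    rw [this, ← key]
    exact (norm_add_le _ _).trans (by linarith)
  rw [norm_div, div_le_iff₀ (norm_pos_iff.2 hs0)] at h3
  exact h3

open Metric

/-! ### The zeta function under the Riemann Hypothesis -/

/-- A holomorphic function on a disc whose real part is at most `L` and which is bounded by `C` near
the centre is bounded by `K + ε L` on any smaller disc, where `K` is independent of `L`. -/
theorem exists_norm_le_add_mul_of_re_le {r₁ r₂ R C ε : ℝ} (hr₁ : 0 < r₁) (hr₁R : r₁ < R)
    (hr₂ : 0 < r₂) (hr₂R : r₂ < R) (hC : 0 ≤ C) (hε : 0 < ε) :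
    ∃ K : ℝ, ∀ (f : ℂ → ℂ) (L : ℝ), 0 ≤ L → DifferentiableOn ℂ f (ball 0 R) →
      (∀ z ∈ ball (0 : ℂ) R, (f z).re ≤ L) → (∀ z ∈ closedBall (0 : ℂ) r₁, ‖f z‖ ≤ C) →
      ∀ z : ℂ, ‖z‖ ≤ r₂ → ‖f z‖ ≤ K + ε * L := by
  set R' : ℝ := (r₂ + R) / 2 with hR'
  have hR'0 : 0 < R' := by rw [hR']; linarith
  have hR'R : R' < R := by rw [hR']; linarith
  have hr₂R' : r₂ < R' := by rw [hR']; linarith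
  have hRR' : 0 < R - R' := by linarith
  -- On the intermediate circle of radius `R'`, Borel–Carathéodory gives `‖f‖ ≤ A (L + 1)`.
  set A : ℝ := (2 * R' + C * (R + R')) / (R - R') with hA
  have hA0 : 0 ≤ A := by
    have : 0 ≤ C * (R + R') := mul_nonneg hC (by linarith)
    rw [hA]; positivity
  set q : ℝ := r₂ / R' with hq
  have hq0 : 0 ≤ q := by rw [hq]; positivity
  have hq1 : q < 1 := by rw [hq, div_lt_one hR'0]; exact hr₂R'
  -- The Taylor series is cut at `n₀`. Cauchy's estimate on the circle of radius `r₁` bounds the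
  -- head independently of `L`. On the circle of radius `R'` it bounds the tail by a geometric
  -- series whose sum is at most `ε (L + 1)`.
  obtain ⟨n₀, hn₀⟩ : ∃ n : ℕ, A * (1 - q)⁻¹ * q ^ n ≤ ε := by
    have := (tendsto_pow_atTop_nhds_zero_of_lt_one hq0 hq1).const_mul (A * (1 - q)⁻¹)
    rw [mul_zero] at this
    exact ((this.eventually_lt_const hε).exists).imp fun _ => le_of_lt
  refine ⟨∑ n ∈ Finset.range n₀, C * (r₂ / r₁) ^ n + ε, fun f L hL hf hre hbd z hz => ?_⟩
  set a : ℕ → ℂ := fun n => (n.factorial : ℂ)⁻¹ • (z - 0) ^ n • iteratedDeriv n f 0 with ha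
  have hsum : HasSum a (f z) :=
    Complex.hasSum_taylorSeries_on_ball hf (by simpa using hz.trans_lt hr₂R)
  have hcoef : ∀ (r B : ℝ), 0 < r → r < R → 0 ≤ B → (∀ w ∈ sphere (0 : ℂ) r, ‖f w‖ ≤ B) →
      ∀ n, ‖a n‖ ≤ B * (r₂ / r) ^ n := by
    intro r B hr hrR hB hw n
    have h1 := Complex.norm_iteratedDeriv_le_of_forall_mem_sphere_norm_le n hr
      ((hf.mono (closedBall_subset_ball hrR)).diffContOnCl_ball subset_rfl) hw
    have hfac : (0 : ℝ) < n.factorial := by exact_mod_cast n.factorial_pos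
    rw [ha]
    simp only [norm_smul, norm_inv, Complex.norm_natCast, sub_zero, norm_pow]
    calc (n.factorial : ℝ)⁻¹ * (‖z‖ ^ n * ‖iteratedDeriv n f 0‖)
        ≤ (n.factorial : ℝ)⁻¹ * (r₂ ^ n * (n.factorial * B / r ^ n)) := by gcongr
      _ = _ := by rw [div_pow]; field_simp
  have ha1 := hcoef r₁ C hr₁ hr₁R hC fun w hw => hbd w (sphere_subset_closedBall hw)
  have hf0 : ‖f 0‖ ≤ C := hbd 0 (by simp [hr₁.le])
  have ha2 := hcoef R' (A * (L + 1)) hR'0 hR'R (by positivity) (by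
    intro w hw
    have hwn : ‖w‖ = R' := by simpa using hw
    -- `L + 1` is positive even when `L = 0`.
    have h := Complex.borelCaratheodory (M := L + 1) (R := R) (f := f) (by linarith) hf
      (fun u hu => by simpa using (hre u hu).trans (by linarith)) (by linarith)
      (show w ∈ ball (0 : ℂ) R by simpa [hwn] using hR'R)
    rw [hwn] at h
    refine h.trans ?_
    rw [hA, ← add_div, div_mul_eq_mul_div]
    gcongr
    have h1 : ‖f 0‖ * (R + R') ≤ C * (R + R') := by gcongr; linarith
    have h2 : 0 ≤ C * (R + R') * L := mul_nonneg (mul_nonneg hC (by linarith)) hL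
    nlinarith)
  rw [← hsum.tsum_eq, ← hsum.summable.sum_add_tsum_nat_add n₀]
  refine (norm_add_le _ _).trans ?_
  rw [add_assoc]
  refine add_le_add (norm_sum_le_of_le _ fun n _ => ha1 n) ?_
  have hgeo : HasSum (fun n : ℕ => A * (L + 1) * q ^ n₀ * q ^ n)
      (A * (L + 1) * q ^ n₀ * (1 - q)⁻¹) := (hasSum_geometric_of_lt_one hq0 hq1).mul_left _
  refine (tsum_of_norm_bounded hgeo fun n => ?_).trans ?_
  · refine (ha2 (n + n₀)).trans (le_of_eq ?_)
    rw [pow_add]; ring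
  · calc A * (L + 1) * q ^ n₀ * (1 - q)⁻¹ = (A * (1 - q)⁻¹ * q ^ n₀) * (L + 1) := by ring
      _ ≤ ε * (L + 1) := by gcongr
      _ = ε + ε * L := by ring

theorem norm_LSeries_le {f : ℕ → ℂ} {σ : ℝ} {s : ℂ} (hs : σ ≤ s.re) (h : LSeriesSummable f σ) :
    ‖LSeries f s‖ ≤ ∑' n, ‖LSeries.term f σ n‖ := by
  refine tsum_of_norm_bounded h.norm.hasSum fun n => ?_
  exact LSeries.norm_term_le_of_re_le_re f (by simpa using hs) n

theorem exists_norm_riemannZeta_le_of_one_lt {σ : ℝ} (hσ : 1 < σ) :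
    ∃ B : ℝ, 1 ≤ B ∧ ∀ s : ℂ, σ ≤ s.re → ‖riemannZeta s‖ ≤ B ∧ ‖riemannZeta s‖⁻¹ ≤ B := by
  set B₁ := ∑' n, ‖LSeries.term (1 : ℕ → ℂ) σ n‖
  set B₂ := ∑' n, ‖LSeries.term (fun n => (muPow 1 n : ℂ)) σ n‖
  refine ⟨max 1 (max B₁ B₂), le_max_left _ _, fun s hs => ⟨?_, ?_⟩⟩
  · rw [← LSeries_one_eq_riemannZeta (hσ.trans_le hs)]
    exact (norm_LSeries_le hs (LSeriesSummable_one_iff.2 (by simpa using hσ))).trans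
      ((le_max_left _ _).trans (le_max_right _ _))
  · have h := (muPow_LSeriesHasSum 1 (hσ.trans_le hs)).LSeries_eq
    rw [pow_one, one_div] at h
    rw [← norm_inv, ← h]
    exact (norm_LSeries_le hs (muPow_LSeriesSummable 1 (by simpa using hσ))).trans
      ((le_max_right _ _).trans (le_max_right _ _))

/-- The Dirichlet series of the von Mangoldt function converges absolutely. The bound controls how
far a branch of `log ζ` moves near the centre of a disc. -/
theorem exists_norm_logDeriv_riemannZeta_le {σ : ℝ} (hσ : 1 < σ) :
    ∃ B : ℝ, 0 ≤ B ∧ ∀ s : ℂ, σ ≤ s.re → ‖deriv riemannZeta s / riemannZeta s‖ ≤ B := by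
  refine ⟨∑' n, ‖LSeries.term (fun n => (ArithmeticFunction.vonMangoldt n : ℂ)) σ n‖,
    tsum_nonneg fun _ => norm_nonneg _, fun s hs => ?_⟩
  rw [← norm_neg, ← neg_div,
    ← ArithmeticFunction.LSeries_vonMangoldt_eq_deriv_riemannZeta_div (hσ.trans_le hs)]
  exact norm_LSeries_le hs
    (ArithmeticFunction.LSeriesSummable_vonMangoldt (by simpa using hσ))

theorem riemannZeta_ne_zero_of_half_lt (hRH : RiemannHypothesis) {s : ℂ} (hs : 1 / 2 < s.re) :
    riemannZeta s ≠ 0 := by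
  rcases eq_or_ne s 1 with rfl | h1
  · exact riemannZeta_one_ne_zero
  intro h0
  have := hRH s h0 (by
    rintro ⟨n, rfl⟩
    have : (-2 * ((n : ℂ) + 1)).re = -2 * ((n : ℝ) + 1) := by simp
    rw [this] at hs
    have : (0 : ℝ) ≤ n := n.cast_nonneg
    linarith) h1
  linarith

/-- A logarithm of the zeta function on a disc free of zeros and poles. -/
theorem exists_log_riemannZeta {c : ℂ} {r : ℝ} (hr : 0 < r)
    (h1 : ∀ w ∈ ball c r, w ≠ 1) (h0 : ∀ w ∈ ball c r, riemannZeta w ≠ 0) :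
    ∃ F : ℂ → ℂ, F c = Complex.log (riemannZeta c) ∧
      (∀ w ∈ ball c r, HasDerivAt F (deriv riemannZeta w / riemannZeta w) w) ∧
      ∀ w ∈ ball c r, Complex.exp (F w) = riemannZeta w := by
  have hζ : ∀ w ∈ ball c r, HasDerivAt riemannZeta (deriv riemannZeta w) w := fun w hw =>
    (differentiableAt_riemannZeta (h1 w hw)).hasDerivAt
  have hd : DifferentiableOn ℂ riemannZeta (ball c r) := fun w hw =>
    (hζ w hw).differentiableAt.differentiableWithinAt
  have hq : DifferentiableOn ℂ (fun w => deriv riemannZeta w / riemannZeta w) (ball c r) :=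
    (hd.deriv isOpen_ball).div hd h0
  obtain ⟨F, hFc, hF⟩ := hq.isExactOn_ball.with_val_at c (Complex.log (riemannZeta c))
  have hcm : c ∈ ball c r := mem_ball_self hr
  refine ⟨F, hFc, hF, fun w hw => ?_⟩
  -- `F` is a primitive of `ζ'/ζ`, so `ζ e^(-F)` is constant, and the value of `F` at the centre
  -- makes the constant `1`.
  have hG : ∀ w ∈ ball c r, HasDerivAt (fun w => riemannZeta w * Complex.exp (-F w)) 0 w := by
    intro w hw
    have := (hζ w hw).mul ((hF w hw).neg.cexp)
    convert! this using 1
    have := h0 w hw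
    field_simp
    ring
  have hconst := isOpen_ball.is_const_of_deriv_eq_zero (convex_ball c r).isPreconnected
    (fun w hw => (hG w hw).differentiableAt.differentiableWithinAt)
    (fun w hw => (hG w hw).deriv) hw hcm
  simp only [hFc] at hconst
  rw [Complex.exp_neg, Complex.exp_neg, Complex.exp_log (h0 c hcm), mul_inv_cancel₀ (h0 c hcm),
    mul_inv_eq_one₀ (Complex.exp_ne_zero _)] at hconst
  exact hconst.symm

/-- Under the Riemann Hypothesis, `ζ(s) ^ (± 1) ≪ |Im s| ^ ε` to the right of the critical line. -/
theorem exists_norm_riemannZeta_le_rpow (hRH : RiemannHypothesis) {δ ε : ℝ} (hδ : 0 < δ)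
    (hδ1 : δ < 5 / 2) (hε : 0 < ε) :
    ∃ C : ℝ, 0 < C ∧ ∀ s : ℂ, 1 / 2 + δ ≤ s.re → s.re ≤ 3 → 3 ≤ |s.im| →
      ‖riemannZeta s‖ ≤ C * |s.im| ^ ε ∧ ‖riemannZeta s‖⁻¹ ≤ C * |s.im| ^ ε := by
  obtain ⟨B, hB1, hB⟩ := exists_norm_riemannZeta_le_of_one_lt (σ := 2) (by norm_num)
  obtain ⟨B', hB'0, hB'⟩ := exists_norm_logDeriv_riemannZeta_le (σ := 2) (by norm_num)
  have hlB : 0 ≤ Real.log B := Real.log_nonneg hB1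
  -- The disc of radius `5/2` about `3 + it` touches the critical line, and radius `5/2 - δ` reaches
  -- `Re s = 1/2 + δ`. On radius `1` one has `Re s ≥ 2`, so `|log ζ|` is bounded there by its value
  -- at the centre plus the bound `B'` for `ζ'/ζ`.
  obtain ⟨K, hK⟩ := exists_norm_le_add_mul_of_re_le (r₁ := 1) (r₂ := 5 / 2 - δ) (R := 5 / 2)
    (C := Real.log B + Real.pi + B') one_pos (by norm_num) (by linarith) (by linarith)
    (by positivity) hε
  refine ⟨Real.exp K * 12 ^ ε, by positivity, fun s hs hs3 him => ?_⟩
  set t := s.im with ht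
  have ht0 : 0 < |t| := by linarith
  set c : ℂ := ⟨3, t⟩ with hc
  have hre : ∀ w ∈ ball c (5 / 2), 1 / 2 < w.re ∧ 1 / 2 ≤ |w.im| ∧ ‖w‖ ≤ 3 * |t| := by
    intro w hw
    rw [mem_ball, dist_eq_norm] at hw
    have e1 := (Complex.abs_re_le_norm (w - c)).trans_lt hw
    have e2 := (Complex.abs_im_le_norm (w - c)).trans_lt hw
    simp only [Complex.sub_re, Complex.sub_im, hc] at e1 e2
    have e3 := abs_sub_abs_le_abs_sub t w.im
    rw [abs_sub_comm] at e3
    have e4 : ‖c‖ ≤ 3 + |t| := by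
      have := Complex.norm_le_abs_re_add_abs_im c
      simpa [hc] using this
    have e5 : ‖w‖ ≤ ‖w - c‖ + ‖c‖ := by simpa using norm_add_le (w - c) c
    rw [abs_lt] at e1
    refine ⟨by linarith, by linarith, by linarith⟩
  have hne1 : ∀ w ∈ ball c (5 / 2), w ≠ 1 := by
    rintro w hw rfl
    have := (hre 1 hw).2.1
    norm_num at this
  have hne0 : ∀ w ∈ ball c (5 / 2), riemannZeta w ≠ 0 := fun w hw =>
    riemannZeta_ne_zero_of_half_lt hRH (hre w hw).1
  obtain ⟨F, hFc, hFd, hFe⟩ := exists_log_riemannZeta (by norm_num) hne1 hne0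
  have hadd : ∀ z ∈ ball (0 : ℂ) (5 / 2), c + z ∈ ball c (5 / 2) := by
    intro z hz
    simpa [mem_ball, dist_eq_norm] using hz
  -- `12|t|` comes from `‖ζ(w)‖ ≤ 4‖w‖` and `‖w‖ ≤ 3|t|` on the disc.
  have hL : 0 ≤ Real.log (12 * |t|) := Real.log_nonneg (by linarith)
  have hnorm : ∀ w ∈ ball c (5 / 2), ‖riemannZeta w‖ = Real.exp (F w).re := fun w hw => by
    rw [← hFe w hw, Complex.norm_exp]
  have key := hK (fun z => F (c + z)) (Real.log (12 * |t|)) hL ?_ ?_ ?_ (s - c) ?_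
  · simp only [add_sub_cancel] at key
    have hsm : s ∈ ball c (5 / 2) := by
      have : s - c = ((s.re - 3 : ℝ) : ℂ) := by
        apply Complex.ext <;> simp [hc, ht]
      rw [mem_ball, dist_eq_norm, this, Complex.norm_real, Real.norm_eq_abs, abs_lt]
      constructor <;> linarith
    have hfin : Real.exp (K + ε * Real.log (12 * |t|)) = Real.exp K * 12 ^ ε * |t| ^ ε := by
      rw [Real.exp_add, mul_assoc, ← Real.mul_rpow (by norm_num) ht0.le,
        Real.rpow_def_of_pos (by positivity), mul_comm ε]
    have h1 := (Complex.abs_re_le_norm (F s)).trans key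
    rw [abs_le] at h1
    rw [hnorm s hsm, ← Real.exp_neg, ← hfin]
    -- A bound for `|Re log ζ|` controls `ζ` and `1/ζ` simultaneously.
    exact ⟨Real.exp_le_exp.2 h1.2, Real.exp_le_exp.2 (by linarith)⟩
  · intro z hz
    have := (hFd (c + z) (hadd z hz)).comp z ((hasDerivAt_id z).const_add c)
    exact this.differentiableAt.differentiableWithinAt
  · intro z hz
    have hw := hre _ (hadd z hz)
    have h1 := norm_riemannZeta_le hw.1.le hw.2.1
    rw [hnorm _ (hadd z hz)] at h1
    rw [Real.le_log_iff_exp_le (by positivity)]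
    linarith [hw.2.2]
  · intro z hz
    have hcm : c ∈ ball c (5 / 2) := mem_ball_self (by norm_num)
    have hsub : ∀ w ∈ closedBall c 1, w ∈ ball c (5 / 2) := fun w hw =>
      closedBall_subset_ball (by norm_num) hw
    have hw : c + z ∈ closedBall c 1 := by simpa [mem_closedBall, dist_eq_norm] using hz
    have h1 := (convex_closedBall c 1).norm_image_sub_le_of_norm_hasDerivWithin_le
      (fun w hw => (hFd w (hsub w hw)).hasDerivWithinAt) (C := B') (fun w hw => hB' w (by
        rw [mem_closedBall, dist_eq_norm] at hw
        have := (Complex.abs_re_le_norm (w - c)).trans hw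
        simp only [Complex.sub_re, hc] at this
        rw [abs_le] at this
        linarith)) (mem_closedBall_self zero_le_one) hw
    have h2 : ‖F c‖ ≤ Real.log B + Real.pi := by
      rw [hFc]
      refine (Complex.norm_le_abs_re_add_abs_im _).trans (add_le_add ?_ ?_)
      · have hpos : 0 < ‖riemannZeta c‖ := norm_pos_iff.2 (hne0 c hcm)
        obtain ⟨hb1, hb2⟩ := hB c (by simp [hc]; norm_num)
        rw [Complex.log_re, abs_le]
        refine ⟨?_, Real.log_le_log hpos hb1⟩
        rw [neg_le, ← Real.log_inv]
        exact Real.log_le_log (inv_pos.2 hpos) hb2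
      · rw [Complex.log_im]
        exact Complex.abs_arg_le_pi _
    have h3 : ‖c + z - c‖ ≤ 1 := by simpa using hz
    calc ‖F (c + z)‖ = ‖(F (c + z) - F c) + F c‖ := by rw [sub_add_cancel]
      _ ≤ ‖F (c + z) - F c‖ + ‖F c‖ := norm_add_le _ _
      _ ≤ B' * 1 + (Real.log B + Real.pi) := by
        gcongr
        exact h1.trans (by gcongr)
      _ = _ := by ring
  · have : s - c = ((s.re - 3 : ℝ) : ℂ) := by
      apply Complex.ext <;> simp [hc, ht]
    rw [this, Complex.norm_real, Real.norm_eq_abs, abs_le]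
    constructor <;> linarith

/-- The Lindelöf bound on a vertical line, under the Riemann Hypothesis. -/
theorem exists_norm_riemannZeta_vertical_le (hRH : RiemannHypothesis) {σ ε : ℝ} (hσ : 1 / 2 < σ)
    (hσ1 : σ ≠ 1) (hε : 0 < ε) :
    ∃ C : ℝ, 0 < C ∧ ∀ t : ℝ, ‖riemannZeta (σ + t * Complex.I)‖ ≤ C * (1 + |t|) ^ ε := by
  have hone : ∀ t : ℝ, 1 ≤ (1 + |t|) ^ ε := fun t =>
    Real.one_le_rpow (by linarith [abs_nonneg t]) hε.le
  by_cases h3 : σ ≤ 3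
  · obtain ⟨C₁, hC₁, h₁⟩ := exists_norm_riemannZeta_le_rpow hRH (δ := min (σ - 1 / 2) 2)
      (lt_min (by linarith) two_pos) ((min_le_right _ _).trans_lt (by norm_num)) hε
    have hcont : Continuous fun t : ℝ => riemannZeta (σ + t * Complex.I) := by
      refine continuous_iff_continuousAt.2 fun t => ?_
      have h1 : (σ + t * Complex.I : ℂ) ≠ 1 := by
        intro h
        have := congrArg Complex.re h
        simp at this
        exact hσ1 this
      exact ContinuousAt.comp (f := fun t : ℝ => (σ + t * Complex.I : ℂ))
        (differentiableAt_riemannZeta h1).continuousAt (by fun_prop)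
    obtain ⟨C₂, hC₂⟩ := (isCompact_Icc (a := (-3 : ℝ)) (b := 3)).exists_bound_of_continuousOn
      hcont.continuousOn
    refine ⟨C₁ + |C₂|, by positivity, fun t => ?_⟩
    rcases le_or_gt 3 |t| with ht | ht
    · have := (h₁ (σ + t * Complex.I) (by
        simp only [Complex.add_re, Complex.ofReal_re, Complex.mul_re, Complex.I_re, mul_zero,
          Complex.ofReal_im, Complex.I_im, mul_one, sub_self, add_zero]
        linarith [min_le_left (σ - 1 / 2) 2]) (by simpa using h3) (by simpa using ht)).1
      refine this.trans ?_
      have him : (σ + t * Complex.I : ℂ).im = t := by simp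
      rw [him]
      have : |t| ^ ε ≤ (1 + |t|) ^ ε := by gcongr; linarith
      have h0 := abs_nonneg C₂
      calc C₁ * |t| ^ ε ≤ (C₁ + |C₂|) * |t| ^ ε := by gcongr; linarith
        _ ≤ _ := by gcongr
    · have := hC₂ t (by rw [Set.mem_Icc, ← abs_le]; exact ht.le)
      calc _ ≤ C₂ := this
        _ ≤ (C₁ + |C₂|) * 1 := by linarith [le_abs_self C₂]
        _ ≤ _ := by gcongr; exact hone t
  · obtain ⟨B, hB1, hB⟩ := exists_norm_riemannZeta_le_of_one_lt (σ := 3) (by norm_num)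
    refine ⟨B, by linarith, fun t => (hB _ (by simpa using (not_le.1 h3).le)).1.trans ?_⟩
    exact le_mul_of_one_le_right (by linarith) (hone t)

/-- The reciprocal of the zeta function, with the removable singularity at `1` filled in. -/
def zetaInv (s : ℂ) : ℂ := (s - 1) / riemannZeta₁ s

theorem zetaInv_eq {s : ℂ} (hs : s ≠ 1) : zetaInv s = (riemannZeta s)⁻¹ := by
  rw [zetaInv, riemannZeta_eq_inv_sub_mul hs, mul_inv, inv_inv, div_eq_mul_inv]

theorem differentiableAt_zetaInv (hRH : RiemannHypothesis) {s : ℂ} (hs : 1 / 2 < s.re) :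
    DifferentiableAt ℂ zetaInv s := by
  refine (differentiableAt_id.sub_const 1).div (differentiable_riemannZeta₁ s) ?_
  rcases eq_or_ne s 1 with rfl | h1
  · simp
  · intro h0
    refine riemannZeta_ne_zero_of_half_lt hRH hs ?_
    rw [riemannZeta_eq_inv_sub_mul h1, h0, mul_zero]

theorem exists_norm_zetaInv_le (hRH : RiemannHypothesis) {δ ε : ℝ} (hδ : 0 < δ)
    (hδ1 : δ < 5 / 2) (hε : 0 < ε) :
    ∃ C : ℝ, 0 < C ∧ ∀ s : ℂ, 1 / 2 + δ ≤ s.re → s.re ≤ 3 →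
      ‖zetaInv s‖ ≤ C * (1 + |s.im|) ^ ε := by
  obtain ⟨C₁, hC₁, h₁⟩ := exists_norm_riemannZeta_le_rpow hRH hδ hδ1 hε
  have hcomp : IsCompact (Set.Icc (1 / 2 + δ) 3 ×ℂ Set.Icc (-3 : ℝ) 3) :=
    isCompact_Icc.reProdIm isCompact_Icc
  obtain ⟨C₂, hC₂⟩ := hcomp.exists_bound_of_continuousOn (f := zetaInv) fun s hs =>
    (differentiableAt_zetaInv hRH (by
      have := hs.1.1
      linarith)).continuousAt.continuousWithinAt
  refine ⟨C₁ + |C₂|, by positivity, fun s hs hs3 => ?_⟩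
  rcases le_or_gt 3 |s.im| with ht | ht
  · have h1 : s ≠ 1 := by rintro rfl; norm_num at ht
    rw [zetaInv_eq h1, norm_inv]
    refine ((h₁ s hs hs3 ht).2).trans ?_
    have : |s.im| ^ ε ≤ (1 + |s.im|) ^ ε := by gcongr; linarith
    have h0 := abs_nonneg C₂
    calc C₁ * |s.im| ^ ε ≤ (C₁ + |C₂|) * |s.im| ^ ε := by gcongr; linarith
      _ ≤ _ := by gcongr
  · have := hC₂ s ⟨⟨hs, hs3⟩, by rw [Set.mem_preimage, Set.mem_Icc, ← abs_le]; exact ht.le⟩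
    have hone : 1 ≤ (1 + |s.im|) ^ ε := Real.one_le_rpow (by linarith [abs_nonneg s.im]) hε.le
    calc _ ≤ C₂ := this
      _ ≤ (C₁ + |C₂|) * 1 := by linarith [le_abs_self C₂]
      _ ≤ _ := by gcongr

/-! ### A smooth weight and its Mellin transform -/

/-- The function `u ↦ max 0 (X - u)`. -/
def ramp (X u : ℝ) : ℝ := max 0 (X - u)

/-- The tent function supported on `[x, x + 2]`. -/
def tent (x u : ℝ) : ℝ := max 0 (1 - |u - (x + 1)|)

/-- As a second difference of ramps the tent has an explicit Mellin transform with denominator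
`s(s+1)`, which makes it decay quadratically on vertical lines. -/
theorem tent_eq_ramp (x u : ℝ) : tent x u = ramp (x + 2) u - 2 * ramp (x + 1) u + ramp x u := by
  unfold tent ramp
  rcases abs_cases (u - (x + 1)) with ⟨h, h'⟩ | ⟨h, h'⟩ <;> rw [h] <;>
    rcases max_cases 0 (x + 2 - u) with ⟨h1, h1'⟩ | ⟨h1, h1'⟩ <;> rw [h1] <;>
    rcases max_cases 0 (x + 1 - u) with ⟨h2, h2'⟩ | ⟨h2, h2'⟩ <;> rw [h2] <;>
    rcases max_cases 0 (x - u) with ⟨h3, h3'⟩ | ⟨h3, h3'⟩ <;> rw [h3] <;>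
    first
    | (rw [max_eq_left (by linarith)]; linarith)
    | (rw [max_eq_right (by linarith)]; linarith)

theorem tent_nonneg (x u : ℝ) : 0 ≤ tent x u := le_max_left _ _

theorem tent_le_one (x u : ℝ) : tent x u ≤ 1 :=
  max_le zero_le_one (by linarith [abs_nonneg (u - (x + 1))])

theorem tent_eq_zero {x u : ℝ} (h : u ∉ Set.Icc x (x + 2)) : tent x u = 0 := by
  refine max_eq_left ?_
  by_contra hcon
  rw [not_le, sub_pos, abs_lt] at hcon
  exact h ⟨by linarith, by linarith⟩

theorem continuous_tent (x : ℝ) : Continuous (tent x) := by unfold tent; fun_prop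

theorem hasMellin_congr {f g : ℝ → ℂ} {s v : ℂ} (hfg : ∀ u, 0 < u → f u = g u)
    (hf : HasMellin f s v) : HasMellin g s v := by
  have h : ∀ u ∈ Set.Ioi (0 : ℝ), (u : ℂ) ^ (s - 1) • f u = (u : ℂ) ^ (s - 1) • g u :=
    fun u hu => by rw [hfg u hu]
  exact ⟨hf.1.congr_fun h measurableSet_Ioi,
    by rw [← hf.2]; exact (setIntegral_congr_fun measurableSet_Ioi h).symm⟩

theorem hasMellin_ramp_one {s : ℂ} (hs : 0 < s.re) :
    HasMellin (fun u => ((ramp 1 u : ℝ) : ℂ)) s (1 / (s * (s + 1))) := by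
  have h1 := hasMellin_one_Ioc hs
  have h2 := hasMellin_cpow_Ioc 1 (s := s) (by simp; linarith)
  have h3 := hasMellin_sub h1.1 h2.1
  rw [h1.2, h2.2] at h3
  have hs0 : s ≠ 0 := by rintro rfl; simp at hs
  have hs1 : s + 1 ≠ 0 := by
    intro h
    have := congrArg Complex.re h
    simp at this
    linarith
  have hv : 1 / s - 1 / (s + 1) = 1 / (s * (s + 1)) := by field_simp; ring
  rw [hv] at h3
  refine hasMellin_congr (fun u hu => ?_) h3
  by_cases h : u ≤ 1
  · have hm : u ∈ Set.Ioc (0 : ℝ) 1 := ⟨hu, h⟩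
    rw [Set.indicator_of_mem hm, Set.indicator_of_mem hm, ramp, max_eq_right (by linarith)]
    simp
  · have hm : u ∉ Set.Ioc (0 : ℝ) 1 := fun hh => h hh.2
    rw [Set.indicator_of_notMem hm, Set.indicator_of_notMem hm, ramp, max_eq_left (by linarith)]
    simp

theorem hasMellin_ramp {s : ℂ} (hs : 0 < s.re) {X : ℝ} (hX : 0 < X) :
    HasMellin (fun u => ((ramp X u : ℝ) : ℂ)) s ((X : ℂ) ^ (s + 1) / (s * (s + 1))) := by
  have h1 := hasMellin_ramp_one hs
  have h2 := (MellinConvergent.comp_mul_left (f := fun u => ((ramp 1 u : ℝ) : ℂ)) (s := s)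
    (inv_pos.2 hX)).2 h1.1
  have h3 := mellin_comp_mul_left (fun u => ((ramp 1 u : ℝ) : ℂ)) s (inv_pos.2 hX)
  have h4 := hasMellin_const_smul h2 (X : ℂ)
  rw [h3, h1.2] at h4
  have hX0 : (X : ℂ) ≠ 0 := by exact_mod_cast hX.ne'
  have hv : (X : ℂ) • (((X⁻¹ : ℝ) : ℂ) ^ (-s) • (1 / (s * (s + 1)))) =
      (X : ℂ) ^ (s + 1) / (s * (s + 1)) := by
    rw [Complex.cpow_add _ _ hX0, Complex.cpow_one, Complex.ofReal_inv, Complex.inv_cpow,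
      Complex.cpow_neg, inv_inv, smul_eq_mul, smul_eq_mul]
    · ring
    · rw [Complex.arg_ofReal_of_nonneg hX.le]
      exact Real.pi_pos.ne
  rw [hv] at h4
  refine hasMellin_congr (fun u hu => ?_) h4
  simp only [ramp, smul_eq_mul]
  rw [← Complex.ofReal_mul, mul_max_of_nonneg _ _ hX.le, mul_zero, mul_sub, mul_one,
    mul_inv_cancel_left₀ hX.ne']

/-- The Mellin transform of the tent function. -/
def tentMellin (x : ℝ) (s : ℂ) : ℂ :=
  (((x + 2 : ℝ) : ℂ) ^ (s + 1) - 2 * ((x + 1 : ℝ) : ℂ) ^ (s + 1) + (x : ℂ) ^ (s + 1)) /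
    (s * (s + 1))

theorem hasMellin_tent {s : ℂ} (hs : 0 < s.re) {x : ℝ} (hx : 0 < x) :
    HasMellin (fun u => ((tent x u : ℝ) : ℂ)) s (tentMellin x s) := by
  have h1 := hasMellin_ramp hs (by linarith : 0 < x + 2)
  have h2 := hasMellin_ramp hs (by linarith : 0 < x + 1)
  have h3 := hasMellin_ramp hs hx
  have h2' := hasMellin_const_smul h2.1 (2 : ℂ)
  have h12 := hasMellin_sub h1.1 h2'.1
  have h := hasMellin_add h12.1 h3.1
  rw [h12.2, h2'.2, h1.2, h2.2, h3.2] at h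
  have hv : ((x + 2 : ℝ) : ℂ) ^ (s + 1) / (s * (s + 1)) -
      (2 : ℂ) • (((x + 1 : ℝ) : ℂ) ^ (s + 1) / (s * (s + 1))) + (x : ℂ) ^ (s + 1) / (s * (s + 1)) =
      tentMellin x s := by
    rw [tentMellin, smul_eq_mul]; ring
  rw [hv] at h
  refine hasMellin_congr (fun u _ => ?_) h
  rw [tent_eq_ramp]
  push_cast
  simp

theorem differentiableAt_tentMellin {s : ℂ} (hs : 0 < s.re) {x : ℝ} (hx : 0 < x) :
    DifferentiableAt ℂ (tentMellin x) s := by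
  have hs0 : s ≠ 0 := by rintro rfl; simp at hs
  have hs1 : s + 1 ≠ 0 := by
    intro h
    have := congrArg Complex.re h
    simp at this
    linarith
  have h : ∀ X : ℝ, 0 < X → DifferentiableAt ℂ (fun s : ℂ => (X : ℂ) ^ (s + 1)) s := fun X hX =>
    (differentiableAt_id.add_const 1).const_cpow (Or.inl (by exact_mod_cast hX.ne'))
  exact (((h _ (by linarith)).sub ((h _ (by linarith)).const_mul 2)).add (h x hx)).div
    (differentiableAt_id.mul (differentiableAt_id.add_const 1)) (mul_ne_zero hs0 hs1)

/-- Interpolation between `η = 0`, from the size and support of the tent, and `η = 2`, from the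
closed formula. The constant is `3888 = 4 · 243 · 4`: four weighted powers in the numerator, each at
most `3^3 · 3^2` times `x^(σ+2)`, and two halves in the denominator. -/
theorem norm_tentMellin_le {x : ℝ} (hx : 1 ≤ x) {s : ℂ} (hs0 : 0 < s.re) (hs3 : s.re ≤ 3) {η : ℝ}
    (hη : 0 ≤ η) (hη2 : η ≤ 2) :
    ‖tentMellin x (s + 1)‖ ≤ 3888 * x ^ (s.re + η) * (1 + |s.im|) ^ (-η) := by
  have hx0 : 0 < x := by linarith
  set σ := s.re with hσ
  set t := s.im with ht
  have ht0 := abs_nonneg t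
  have h27 : (3 : ℝ) ^ σ ≤ 27 := by
    calc (3 : ℝ) ^ σ ≤ 3 ^ (3 : ℝ) := Real.rpow_le_rpow_of_exponent_le (by norm_num) hs3
      _ = 27 := by norm_num
  have hxσ : (3 * x) ^ σ ≤ 27 * x ^ σ := by
    rw [Real.mul_rpow (by norm_num) hx0.le]; gcongr
  have b1 : ‖tentMellin x (s + 1)‖ ≤ 3888 * x ^ σ := by
    rw [← (hasMellin_tent (s := s + 1) (by simp; linarith) hx0).2, mellin]
    have hsub : Set.Icc x (x + 2) ⊆ Set.Ioi 0 := fun u hu => hx0.trans_le hu.1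
    rw [setIntegral_eq_of_subset_of_forall_sdiff_eq_zero measurableSet_Ioi hsub (fun u hu => by
      rw [tent_eq_zero hu.2]; simp)]
    refine (norm_setIntegral_le_of_norm_le_const (C := (3 * x) ^ σ) (by simp) fun u hu => ?_).trans ?_
    · have hu0 : 0 < u := hsub hu
      rw [norm_smul, Complex.norm_real, Real.norm_eq_abs, abs_of_nonneg (tent_nonneg _ _),
        Complex.norm_cpow_eq_rpow_re_of_pos hu0]
      have : (s + 1 - 1).re = σ := by simp [hσ]
      rw [this]
      calc u ^ σ * tent x u ≤ (3 * x) ^ σ * 1 := by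
            gcongr
            · exact tent_nonneg _ _
            · linarith [hu.2]
            · exact tent_le_one _ _
        _ = _ := mul_one _
    · rw [Real.volume_real_Icc_of_le (by linarith)]
      have : 0 ≤ x ^ σ := by positivity
      nlinarith
  have b2 : ‖tentMellin x (s + 1)‖ ≤ 3888 * x ^ σ * (x / (1 + |t|)) ^ 2 := by
    have hnum : ∀ X : ℝ, 0 < X → X ≤ 3 * x → ‖(X : ℂ) ^ (s + 1 + 1)‖ ≤ 243 * x ^ σ * x ^ 2 := by
      intro X hX0 hX
      rw [Complex.norm_cpow_eq_rpow_re_of_pos hX0]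
      have : (s + 1 + 1).re = σ + 2 := by simp [hσ]; ring
      rw [this]
      calc X ^ (σ + 2) ≤ (3 * x) ^ (σ + 2) := by gcongr
        _ = (3 * x) ^ σ * (9 * x ^ 2) := by
          rw [Real.rpow_add (by positivity), Real.rpow_two]; ring
        _ ≤ 27 * x ^ σ * (9 * x ^ 2) := by gcongr
        _ = _ := by ring
    have hden : ∀ w : ℂ, 1 ≤ w.re → w.im = t → (1 + |t|) / 2 ≤ ‖w‖ := by
      intro w h1 h2
      have e1 := (le_abs_self _).trans (Complex.abs_re_le_norm w)
      have e2 := Complex.abs_im_le_norm w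
      rw [h2] at e2
      linarith
    have hd1 := hden (s + 1) (by simp; linarith) (by simp [ht])
    have hd2 := hden (s + 1 + 1) (by simp; linarith) (by simp [ht])
    rw [tentMellin, norm_div, norm_mul]
    have hn : ‖((x + 2 : ℝ) : ℂ) ^ (s + 1 + 1) - 2 * ((x + 1 : ℝ) : ℂ) ^ (s + 1 + 1) +
        (x : ℂ) ^ (s + 1 + 1)‖ ≤ 4 * (243 * x ^ σ * x ^ 2) := by
      have e1 := hnum (x + 2) (by linarith) (by linarith)
      have e2 := hnum (x + 1) (by linarith) (by linarith)
      have e3 := hnum x hx0 (by linarith)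
      refine (norm_add_le _ _).trans ?_
      have := norm_sub_le (((x + 2 : ℝ) : ℂ) ^ (s + 1 + 1)) (2 * ((x + 1 : ℝ) : ℂ) ^ (s + 1 + 1))
      rw [norm_mul, Complex.norm_ofNat] at this
      linarith
    calc _ ≤ 4 * (243 * x ^ σ * x ^ 2) / ((1 + |t|) / 2 * ((1 + |t|) / 2)) := by gcongr
      _ = _ := by field_simp; ring
  have hA : 0 < x / (1 + |t|) := by positivity
  have hfin : 3888 * x ^ (σ + η) * (1 + |t|) ^ (-η) = 3888 * x ^ σ * (x / (1 + |t|)) ^ η := by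
    rw [Real.div_rpow hx0.le (by positivity), Real.rpow_add hx0, Real.rpow_neg (by positivity)]
    ring
  rw [hfin]
  -- `(x/(1+|t|))^η` dominates the smaller of its values at `η = 0` and `η = 2`, according to
  -- whether the base exceeds `1`.
  rcases le_or_gt (x / (1 + |t|)) 1 with h | h
  · refine b2.trans ?_
    gcongr
    rw [← Real.rpow_two]
    exact Real.rpow_le_rpow_of_exponent_ge hA h hη2
  · refine b1.trans ?_
    exact le_mul_of_one_le_right (by positivity) (Real.one_le_rpow h.le hη)

/-! ### Mellin–Parseval pairing with the tent function -/

theorem continuous_tentMellin_vertical {x σ : ℝ} (hx : 1 ≤ x) (hσ : 0 < σ) :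
    Continuous fun t : ℝ => tentMellin x (σ + t * Complex.I + 1) := by
  refine continuous_iff_continuousAt.2 fun t => ?_
  have h := (differentiableAt_tentMellin (s := σ + t * Complex.I + 1) (by simp; linarith)
    (by linarith : 0 < x)).continuousAt
  exact ContinuousAt.comp (f := fun t : ℝ => (σ + t * Complex.I + 1 : ℂ)) h (by fun_prop)

theorem integrable_one_add_abs_rpow {r : ℝ} (hr : 1 < r) :
    Integrable fun t : ℝ => (1 + |t|) ^ (-r) := by
  have : Integrable fun t : ℝ => (1 + ‖t‖) ^ (-r) := integrable_one_add_norm (by simpa using hr)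
  simpa using this

theorem integrable_tentMellin {x σ : ℝ} (hx : 1 ≤ x) (hσ : 0 < σ) (hσ3 : σ ≤ 3) :
    Integrable fun t : ℝ => tentMellin x (σ + t * Complex.I + 1) := by
  refine ((integrable_one_add_abs_rpow one_lt_two).const_mul (3888 * x ^ (σ + 2))).mono'
    (continuous_tentMellin_vertical hx hσ).aestronglyMeasurable ?_
  filter_upwards with t
  have := norm_tentMellin_le hx (s := σ + t * Complex.I) (η := 2) (by simpa using hσ)
    (by simpa using hσ3) zero_le_two le_rfl
  simpa using this

theorem tent_eq_integral {x σ : ℝ} (hx : 1 ≤ x) (hσ : 0 < σ) (hσ3 : σ ≤ 3) {u : ℝ} (hu : 0 < u) :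
    ((tent x u : ℝ) : ℂ) = (1 / (2 * Real.pi) : ℝ) *
      ∫ t : ℝ, (u : ℂ) ^ (-(σ + t * Complex.I + 1)) * tentMellin x (σ + t * Complex.I + 1) := by
  have hx0 : 0 < x := by linarith
  have hM : ∀ t : ℝ, mellin (fun u => ((tent x u : ℝ) : ℂ)) (((σ + 1 : ℝ) : ℂ) + t * Complex.I) =
      tentMellin x (σ + t * Complex.I + 1) := fun t => by
    rw [(hasMellin_tent (s := ((σ + 1 : ℝ) : ℂ) + t * Complex.I) (by simp; linarith) hx0).2]
    congr 1
    push_cast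
    ring
  have h := mellinInv_mellin_eq (σ + 1) (fun u => ((tent x u : ℝ) : ℂ)) hu
    (hasMellin_tent (by simp; linarith) hx0).1
    ((integrable_tentMellin hx hσ hσ3).congr (by filter_upwards with t; exact (hM t).symm))
    (Complex.continuous_ofReal.comp (continuous_tent x)).continuousAt
  rw [← h, mellinInv, Complex.real_smul]
  congr 1
  refine integral_congr_ae ?_
  filter_upwards with t
  rw [hM, smul_eq_mul]
  congr 2
  push_cast
  ring

/-- Parseval's formula for the pairing of a function with the tent function. -/
theorem integral_mul_tent {G : ℝ → ℂ} {σ x : ℝ} (hx : 1 ≤ x) (hσ : 0 < σ) (hσ3 : σ ≤ 3)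
    (hG : MellinConvergent G (-σ)) :
    ∫ u in Set.Ioi (0 : ℝ), G u * (tent x u : ℂ) = (1 / (2 * Real.pi) : ℝ) *
      ∫ t : ℝ, tentMellin x (σ + t * Complex.I + 1) * mellin G (-(σ + t * Complex.I)) := by
  set T : ℝ → ℂ := fun t => tentMellin x (σ + t * Complex.I + 1) with hT
  have hTi : Integrable T := integrable_tentMellin hx hσ hσ3
  have h1 : ∫ u in Set.Ioi (0 : ℝ), G u * (tent x u : ℂ) = (1 / (2 * Real.pi) : ℝ) *
      ∫ u in Set.Ioi (0 : ℝ), ∫ t : ℝ,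
        ((u : ℂ) ^ (-(σ : ℂ) - 1) • G u * T t) * (u : ℂ) ^ (-(t * Complex.I)) := by
    rw [← integral_const_mul]
    refine setIntegral_congr_fun measurableSet_Ioi fun u hu => ?_
    have hu0 : (u : ℂ) ≠ 0 := by exact_mod_cast (ne_of_gt hu)
    rw [tent_eq_integral hx hσ hσ3 hu, mul_left_comm, ← integral_const_mul]
    congr 1
    refine integral_congr_ae ?_
    filter_upwards with t
    have : -((σ : ℂ) + t * Complex.I + 1) = (-(σ : ℂ) - 1) + -(t * Complex.I) := by ring
    rw [this, Complex.cpow_add _ _ hu0, smul_eq_mul]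
    ring
  -- Fubini applies since, apart from a factor of modulus `1`, the integrand is a product of
  -- functions integrable in `u` and in `t`.
  rw [h1, integral_integral_swap]
  · congr 1
    refine integral_congr_ae ?_
    filter_upwards with t
    rw [mellin, ← integral_const_mul]
    refine setIntegral_congr_fun measurableSet_Ioi fun u hu => ?_
    have hu0 : (u : ℂ) ≠ 0 := by exact_mod_cast (ne_of_gt hu)
    have : -((σ : ℂ) + t * Complex.I) - 1 = (-(σ : ℂ) - 1) + -(t * Complex.I) := by ring
    rw [this, Complex.cpow_add _ _ hu0, smul_eq_mul, smul_eq_mul]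
    ring
  · have hprod : Integrable (fun p : ℝ × ℝ => ((p.1 : ℂ) ^ (-(σ : ℂ) - 1) • G p.1) * T p.2)
        ((volume.restrict (Set.Ioi 0)).prod volume) := Integrable.mul_prod hG hTi
    refine hprod.mul_bdd (c := 1) ?_ ?_
    · refine Measurable.aestronglyMeasurable ?_
      fun_prop
    · have hae : ∀ᵐ p : ℝ × ℝ ∂((volume.restrict (Set.Ioi 0)).prod volume), 0 < p.1 :=
        Measure.quasiMeasurePreserving_fst.ae (self_mem_ae_restrict measurableSet_Ioi)
      filter_upwards [hae] with p hp
      rw [Complex.norm_cpow_eq_rpow_re_of_pos hp]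
      simp

/-- Taking `η = 2ε` in the decay of the tent turns `|t|^(ε-1)` into the integrable `|t|^(-1-ε)`, at
a cost of `x^(2ε)`. The point `t = 0` is exempt because the transforms of the error terms are
identified only off the real axis. -/
theorem exists_norm_integral_tentMellin_mul_le {ε : ℝ} (hε : 0 < ε) (hε1 : ε ≤ 1) :
    ∃ K : ℝ, 0 < K ∧ ∀ (x σ B : ℝ) (H : ℝ → ℂ), 1 ≤ x → 0 < σ → σ ≤ 3 → 0 ≤ B →
      (∀ t : ℝ, t ≠ 0 → ‖H t‖ ≤ B * (1 + |t|) ^ (ε - 1)) →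
      ‖∫ t : ℝ, tentMellin x (σ + t * Complex.I + 1) * H t‖ ≤ K * B * x ^ (σ + 2 * ε) := by
  have hint := integrable_one_add_abs_rpow (r := 1 + ε) (by linarith)
  set I := ∫ t : ℝ, (1 + |t|) ^ (-(1 + ε)) with hI
  have hI0 : 0 ≤ I := integral_nonneg fun t => by positivity
  refine ⟨3888 * I + 1, by positivity, fun x σ B H hx hσ hσ3 hB hH => ?_⟩
  have hx0 : 0 < x := by linarith
  have hb : ∀ᵐ t : ℝ, ‖tentMellin x (σ + t * Complex.I + 1) * H t‖ ≤
      3888 * x ^ (σ + 2 * ε) * B * (1 + |t|) ^ (-(1 + ε)) := by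
    filter_upwards [compl_mem_ae_iff.2 (measure_singleton (0 : ℝ))] with t ht
    have h1 := norm_tentMellin_le hx (s := σ + t * Complex.I) (η := 2 * ε) (by simpa using hσ)
      (by simpa using hσ3) (by linarith) (by linarith)
    simp only [Complex.add_re, Complex.ofReal_re, Complex.mul_re, Complex.I_re, mul_zero,
      Complex.ofReal_im, Complex.I_im, mul_one, sub_self, add_zero, Complex.add_im, Complex.mul_im,
      zero_add] at h1
    have h2 := hH t ht
    rw [norm_mul]
    have hexp : (1 + |t|) ^ (-(1 + ε)) = (1 + |t|) ^ (-(2 * ε)) * (1 + |t|) ^ (ε - 1) := by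
      rw [← Real.rpow_add (by positivity)]
      congr 1
      ring
    calc _ ≤ (3888 * x ^ (σ + 2 * ε) * (1 + |t|) ^ (-(2 * ε))) * (B * (1 + |t|) ^ (ε - 1)) := by
          gcongr
      _ = _ := by rw [hexp]; ring
  refine (norm_integral_le_of_norm_le (hint.const_mul _) hb).trans ?_
  rw [integral_const_mul]
  have : 0 ≤ B * x ^ (σ + 2 * ε) := by positivity
  calc 3888 * x ^ (σ + 2 * ε) * B * I = 3888 * I * (B * x ^ (σ + 2 * ε)) := by ring
    _ ≤ (3888 * I + 1) * (B * x ^ (σ + 2 * ε)) := by gcongr; linarith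
    _ = _ := by ring

theorem norm_one_div_two_pi_mul_le (z : ℂ) : ‖((1 / (2 * Real.pi) : ℝ) : ℂ) * z‖ ≤ ‖z‖ := by
  rw [norm_mul, Complex.norm_real, Real.norm_eq_abs, abs_of_pos (by positivity)]
  refine mul_le_of_le_one_left (norm_nonneg _) ?_
  rw [div_le_one (by positivity)]
  linarith [Real.pi_gt_three]

/-- The integral of the tent function is `1`. -/
theorem integral_tent {x : ℝ} (hx : 1 ≤ x) : ∫ u in Set.Ioi (0 : ℝ), (tent x u : ℂ) = 1 := by
  have h := (hasMellin_tent (s := 1) (by simp) (by linarith : 0 < x)).2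
  rw [mellin] at h
  simp only [sub_self, Complex.cpow_zero, one_smul] at h
  rw [h, tentMellin]
  have : ∀ X : ℂ, X ^ (1 + 1 : ℂ) = X ^ 2 := fun X => by
    rw [← Complex.cpow_ofNat]; norm_num
  rw [this, this, this]
  push_cast
  ring

theorem integrableOn_mul_tent {G : ℝ → ℂ} {x : ℝ} (hx : 1 ≤ x)
    (hG : LocallyIntegrableOn G (Set.Ioi 0)) :
    IntegrableOn (fun u => G u * (tent x u : ℂ)) (Set.Ioi 0) := by
  have h1 : IntegrableOn G (Set.Icc x (x + 2)) :=
    hG.integrableOn_compact_subset (fun u hu => (by linarith [hu.1] : (0 : ℝ) < u)) isCompact_Icc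
  have h2 : IntegrableOn (fun u => G u * (tent x u : ℂ)) (Set.Icc x (x + 2)) :=
    h1.mul_continuousOn (Complex.continuous_ofReal.comp (continuous_tent x)).continuousOn
      isCompact_Icc
  refine h2.of_forall_sdiff_eq_zero measurableSet_Ioi fun u hu => ?_
  rw [tent_eq_zero hu.2]
  simp

/-- A pairing with the tent function is at most the supremum over its support. -/
theorem norm_integral_mul_tent_le {G : ℝ → ℂ} {x B : ℝ} (hx : 1 ≤ x)
    (hB : ∀ u ∈ Set.Icc x (x + 2), ‖G u‖ ≤ B) :
    ‖∫ u in Set.Ioi (0 : ℝ), G u * (tent x u : ℂ)‖ ≤ 2 * B := by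
  have hsub : Set.Icc x (x + 2) ⊆ Set.Ioi 0 := fun u hu => by
    have := hu.1
    simp only [Set.mem_Ioi]
    linarith
  rw [setIntegral_eq_of_subset_of_forall_sdiff_eq_zero measurableSet_Ioi hsub (fun u hu => by
    rw [tent_eq_zero hu.2]; simp)]
  refine (norm_setIntegral_le_of_norm_le_const (C := B) (by simp) fun u hu => ?_).trans ?_
  · rw [norm_mul, Complex.norm_real, Real.norm_eq_abs, abs_of_nonneg (tent_nonneg _ _)]
    exact (mul_le_of_le_one_right (norm_nonneg _) (tent_le_one _ _)).trans (hB u hu)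
  · rw [Real.volume_real_Icc_of_le (by linarith)]
    linarith

/-- A function varying by at most `B` on the support of the tent function is within `2 B` of its
pairing with it. -/
theorem norm_sub_integral_mul_tent_le {G : ℝ → ℂ} {x B : ℝ} (hx : 1 ≤ x)
    (hG : LocallyIntegrableOn G (Set.Ioi 0)) (hB : ∀ u ∈ Set.Icc x (x + 2), ‖G u - G x‖ ≤ B) :
    ‖G x - ∫ u in Set.Ioi (0 : ℝ), G u * (tent x u : ℂ)‖ ≤ 2 * B := by
  have h1 := integrableOn_mul_tent hx hG
  have h2 : IntegrableOn (fun u => G x * (tent x u : ℂ)) (Set.Ioi 0) :=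
    integrableOn_mul_tent (G := fun _ => G x) hx (locallyIntegrableOn_const _)
  have h3 : G x - ∫ u in Set.Ioi (0 : ℝ), G u * (tent x u : ℂ) =
      -∫ u in Set.Ioi (0 : ℝ), (G u - G x) * (tent x u : ℂ) := by
    simp_rw [sub_mul]
    rw [integral_sub h1 h2, integral_const_mul, integral_tent hx]
    ring
  rw [h3, norm_neg]
  exact norm_integral_mul_tent_le (G := fun u => G u - G x) hx hB

/-! ### Shifting a vertical line of integration -/

/-- Cauchy's theorem on rectangles of height `2T`; the horizontal sides vanish as `T → ∞`. -/
theorem integral_vertical_eq {F : ℂ → ℂ} {σ₁ σ₂ C : ℝ} (hσ : σ₁ ≤ σ₂)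
    (hd : ∀ s : ℂ, σ₁ ≤ s.re → s.re ≤ σ₂ → DifferentiableAt ℂ F s)
    (hb : ∀ s : ℂ, σ₁ ≤ s.re → s.re ≤ σ₂ → ‖F s‖ ≤ C * (1 + |s.im|) ^ (-2 : ℝ)) :
    ∫ t : ℝ, F (σ₁ + t * Complex.I) = ∫ t : ℝ, F (σ₂ + t * Complex.I) := by
  have hint : ∀ σ : ℝ, σ₁ ≤ σ → σ ≤ σ₂ → Integrable fun t : ℝ => F (σ + t * Complex.I) := by
    intro σ h1 h2
    refine ((integrable_one_add_abs_rpow one_lt_two).const_mul C).mono' ?_ ?_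
    · refine Continuous.aestronglyMeasurable (continuous_iff_continuousAt.2 fun t => ?_)
      exact ContinuousAt.comp (f := fun t : ℝ => (σ + t * Complex.I : ℂ))
        (hd _ (by simpa using h1) (by simpa using h2)).continuousAt (by fun_prop)
    · filter_upwards with t
      simpa using hb (σ + t * Complex.I) (by simpa using h1) (by simpa using h2)
  have hlim : ∀ σ : ℝ, σ₁ ≤ σ → σ ≤ σ₂ → Tendsto (fun T : ℝ => ∫ t in (-T)..T,
      F (σ + t * Complex.I)) atTop (𝓝 (∫ t : ℝ, F (σ + t * Complex.I))) := fun σ h1 h2 =>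
    intervalIntegral_tendsto_integral (hint σ h1 h2) tendsto_neg_atTop_atBot tendsto_id
  have hdec : Tendsto (fun T : ℝ => C * (1 + |T|) ^ (-2 : ℝ) * |σ₂ - σ₁|) atTop (𝓝 0) := by
    have h1 : Tendsto (fun T : ℝ => 1 + |T|) atTop atTop :=
      tendsto_atTop_add_const_left _ _ tendsto_abs_atTop_atTop
    have h2 := (tendsto_rpow_neg_atTop (y := 2) two_pos).comp h1
    simpa using (h2.const_mul C).mul_const |σ₂ - σ₁|
  have hhor : ∀ e : ℝ, |e| = 1 → Tendsto (fun T : ℝ => ∫ y in σ₁..σ₂,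
      F (y + (e * T : ℝ) * Complex.I)) atTop (𝓝 0) := by
    intro e he
    refine squeeze_zero_norm (fun T => ?_) hdec
    refine intervalIntegral.norm_integral_le_of_norm_le_const fun y hy => ?_
    rw [Set.uIoc_of_le hσ] at hy
    have := hb (y + (e * T : ℝ) * Complex.I) (by simpa using hy.1.le) (by simpa using hy.2)
    simpa [abs_mul, he] using this
  have hrect : ∀ T : ℝ, (∫ y in σ₁..σ₂, F (y + ((-1) * T : ℝ) * Complex.I)) -
      (∫ y in σ₁..σ₂, F (y + (1 * T : ℝ) * Complex.I)) +
      Complex.I • (∫ t in (-T)..T, F (σ₂ + t * Complex.I)) -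
      Complex.I • (∫ t in (-T)..T, F (σ₁ + t * Complex.I)) = 0 := by
    intro T
    have := Complex.integral_boundary_rect_eq_zero_of_differentiableOn F ⟨σ₁, -T⟩ ⟨σ₂, T⟩
      (fun s hs => by
        have h1 : s.re ∈ Set.uIcc σ₁ σ₂ := hs.1
        rw [Set.uIcc_of_le hσ] at h1
        exact (hd s h1.1 h1.2).differentiableWithinAt)
    simpa using this
  have hfin := (((hhor (-1) (by simp)).sub (hhor 1 (by simp))).add
    ((hlim σ₂ hσ le_rfl).const_smul Complex.I)).sub ((hlim σ₁ le_rfl hσ).const_smul Complex.I)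
  have h0 := tendsto_nhds_unique hfin (tendsto_const_nhds.congr fun T => (hrect T).symm)
  rw [sub_self, zero_add, sub_eq_zero] at h0
  exact (smul_right_injective ℂ Complex.I_ne_zero h0).symm

/-! ### Sums of twisted Möbius coefficients -/

/-- The coefficients `μ_k(m) m ^ (-iτ)`. -/
def muTwist (k : ℕ) (τ : ℝ) (m : ℕ) : ℂ := (muPow k m : ℂ) * (m : ℂ) ^ (-(τ * Complex.I))

theorem norm_muTwist (k : ℕ) (τ : ℝ) (m : ℕ) : ‖muTwist k τ m‖ = |(muPow k m : ℝ)| := by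
  rcases Nat.eq_zero_or_pos m with rfl | hm
  · simp [muTwist]
  · rw [muTwist, norm_mul, Complex.norm_natCast_cpow_of_pos hm]
    simp

theorem exists_norm_muTwist_le (k : ℕ) {ε : ℝ} (hε : 0 < ε) :
    ∃ C : ℝ, 0 < C ∧ ∀ (τ : ℝ) (m : ℕ), m ≠ 0 → ‖muTwist k τ m‖ ≤ C * (m : ℝ) ^ ε := by
  obtain ⟨C, hC, h⟩ := muPow_isSubpolynomial k ε hε
  exact ⟨C, hC, fun τ m hm => by rw [norm_muTwist]; exact h m hm⟩

theorem muTwist_LSeriesHasSum (k : ℕ) (τ : ℝ) {s : ℂ} (hs : 1 < s.re) :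
    LSeriesHasSum (muTwist k τ) s (zetaInv (s + τ * Complex.I) ^ k) := by
  have hs1 : 1 < (s + τ * Complex.I).re := by simpa using hs
  have h := muPow_LSeriesHasSum k hs1
  have hne : s + τ * Complex.I ≠ 1 := by
    intro h1
    rw [h1] at hs1
    simp at hs1
  rw [one_div, ← inv_pow, ← zetaInv_eq hne] at h
  have hterm : LSeries.term (muTwist k τ) s =
      LSeries.term (fun n => (muPow k n : ℂ)) (s + τ * Complex.I) := funext fun m => ?_
  · rw [LSeriesHasSum, hterm]
    exact h
  rcases Nat.eq_zero_or_pos m with rfl | hm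
  · simp
  · have hm0 : (m : ℂ) ≠ 0 := by exact_mod_cast hm.ne'
    rw [LSeries.term_of_ne_zero hm.ne', LSeries.term_of_ne_zero hm.ne', muTwist,
      Complex.cpow_add _ _ hm0, Complex.cpow_neg]
    have : (m : ℂ) ^ (τ * Complex.I) ≠ 0 := by simp [Complex.cpow_eq_zero_iff, hm0]
    field_simp

theorem norm_sum_Icc_le_of_le {f : ℕ → ℂ} {C : ℝ} (hC : 0 ≤ C)
    (hf : ∀ n : ℕ, n ≠ 0 → ‖f n‖ ≤ C * (n : ℝ) ^ (1 : ℝ)) (n : ℕ) :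
    ‖∑ m ∈ Finset.Icc 1 n, f m‖ ≤ C * (n : ℝ) ^ (2 : ℝ) := by
  have : ∀ m ∈ Finset.Icc 1 n, ‖f m‖ ≤ C * n := by
    intro m hm
    rw [Finset.mem_Icc] at hm
    have h1 := hf m (by omega)
    rw [Real.rpow_one] at h1
    refine h1.trans ?_
    gcongr
    exact hm.2
  refine (norm_sum_le_of_le _ this).trans (le_of_eq ?_)
  rw [Finset.sum_const, Nat.card_Icc, Nat.add_sub_cancel, nsmul_eq_mul, Real.rpow_two]
  ring

/-- The exponent is crude. It only serves to begin with absolutely convergent integrals on `Re s >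
2`, before shifting or continuing. -/
theorem sum_Icc_isBigO {f : ℕ → ℂ} {C : ℝ} (hC : 0 ≤ C)
    (hf : ∀ n : ℕ, n ≠ 0 → ‖f n‖ ≤ C * (n : ℝ) ^ (1 : ℝ)) :
    (fun u : ℝ => ∑ n ∈ Finset.Icc 1 ⌊u⌋₊, f n) =O[atTop] fun u : ℝ => u ^ (2 : ℝ) := by
  refine IsBigO.of_bound C ?_
  filter_upwards [eventually_ge_atTop 0] with u hu
  refine (norm_sum_Icc_le_of_le hC hf _).trans ?_
  rw [Real.norm_eq_abs, abs_of_nonneg (by positivity)]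
  gcongr
  exact Nat.floor_le hu

/-- The Mellin transform of a summatory function. -/
theorem integral_Ioi_one_sum_Icc {f : ℕ → ℂ} {C : ℝ} (hC : 0 ≤ C)
    (hf : ∀ n : ℕ, n ≠ 0 → ‖f n‖ ≤ C * (n : ℝ) ^ (1 : ℝ)) {s v : ℂ} (hs : 2 < s.re)
    (hv : LSeriesHasSum f s v) :
    ∫ u in Set.Ioi (1 : ℝ), (∑ n ∈ Finset.Icc 1 ⌊u⌋₊, f n) * (u : ℂ) ^ (-(s + 1)) = v / s := by
  have hs0 : s ≠ 0 := by rintro rfl; simp at hs; linarith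
  have h := LSeries_eq_mul_integral f (r := 2) zero_le_two hs hv.LSeriesSummable (by
    refine IsBigO.of_bound C (Eventually.of_forall fun n => ?_)
    rw [Real.norm_eq_abs, abs_of_nonneg (by positivity)]
    exact norm_sum_Icc_le_of_le hC hf n)
  rw [hv.LSeries_eq] at h
  rw [h, mul_div_cancel_left₀ _ hs0]

theorem one_add_abs_le_three_mul_norm {s : ℂ} (hs : 1 / 2 ≤ s.re) : 1 + |s.im| ≤ 3 * ‖s‖ := by
  have h1 := (le_abs_self _).trans (Complex.abs_re_le_norm s)
  have h2 := Complex.abs_im_le_norm s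
  linarith

/-- A smoothed Perron formula for `ζ(s + iτ)^(-k)`: RH leaves no pole to the right of `1/2`, so the
line moves to `Re s = 1/2 + ε`. Explicit dependence on `τ` is needed because the tails are later
integrated along a vertical line. -/
theorem exists_norm_sum_muTwist_le (hRH : RiemannHypothesis) (k : ℕ) {δ : ℝ} (hδ : 0 < δ)
    (hδ1 : δ ≤ 1) :
    ∃ C : ℝ, 0 < C ∧ ∀ (x τ : ℝ), 1 ≤ x →
      ‖∑ n ∈ Finset.Icc 1 ⌊x⌋₊, muTwist k τ n‖ ≤ C * x ^ (1 / 2 + δ) * (1 + |τ|) ^ δ := by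
  -- The contour and the smoothing together give `x^(1/2 + 3ε)`, which stays below `x^(1/2 + δ)`.
  set ε : ℝ := δ / 4 with hε
  have hε0 : 0 < ε := by rw [hε]; positivity
  have hε1 : ε ≤ 1 / 4 := by rw [hε]; linarith
  -- The exponent `ε/(k+1)` keeps the `k`-th power of `1/ζ` below exponent `ε`.
  obtain ⟨Z, hZ0, hZ⟩ := exists_norm_zetaInv_le hRH (δ := ε) (ε := ε / (k + 1)) hε0 (by linarith)
    (by positivity)
  obtain ⟨K, hK0, hK⟩ := exists_norm_integral_tentMellin_mul_le hε0 (by linarith)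
  obtain ⟨C₁, hC₁, h₁⟩ := exists_norm_muTwist_le k one_pos
  obtain ⟨C₂, hC₂, h₂⟩ := exists_norm_muTwist_le k hε0
  refine ⟨K * (3 * Z ^ k) + 12 * C₂, by positivity, fun x τ hx => ?_⟩
  have hx0 : 0 < x := by linarith
  set S : ℝ → ℂ := fun u => ∑ n ∈ Finset.Icc 1 ⌊u⌋₊, muTwist k τ n with hS
  have hSloc : LocallyIntegrableOn S (Set.Ioi 0) := locallyIntegrableOn_sum_Icc _
  have hSO := sum_Icc_isBigO hC₁.le (h₁ τ)
  have hτ1 : 1 ≤ 1 + |τ| := by linarith [abs_nonneg τ]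
  set B : ℝ := 3 * Z ^ k * (1 + |τ|) ^ ε with hB
  have hB0 : 0 ≤ B := by positivity
  set H : ℂ → ℂ := fun s => zetaInv (s + τ * Complex.I) ^ k / s with hH
  have hHb : ∀ s : ℂ, 1 / 2 + ε ≤ s.re → s.re ≤ 3 → ‖H s‖ ≤ B * (1 + |s.im|) ^ (ε - 1) := by
    intro s h1 h3
    have e1 := hZ (s + τ * Complex.I) (by simpa using h1) (by simpa using h3)
    have e2 := one_add_abs_le_three_mul_norm (s := s) (by linarith)
    have ht := abs_nonneg s.im
    have hs0 : 0 < ‖s‖ := by linarith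
    have e3 : ‖zetaInv (s + τ * Complex.I)‖ ^ k ≤ Z ^ k * ((1 + |s.im|) ^ ε * (1 + |τ|) ^ ε) := by
      have him : (s + τ * Complex.I).im = s.im + τ := by simp
      rw [him] at e1
      have hge : 1 + |s.im + τ| ≤ (1 + |s.im|) * (1 + |τ|) := by
        have := abs_add_le s.im τ
        nlinarith [mul_nonneg ht (abs_nonneg τ)]
      calc ‖zetaInv (s + τ * Complex.I)‖ ^ k
          ≤ (Z * (1 + |s.im + τ|) ^ (ε / (k + 1))) ^ k := by gcongr
        _ = Z ^ k * (1 + |s.im + τ|) ^ (ε / (k + 1) * k) := by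
          rw [mul_pow, ← Real.rpow_natCast ((1 + |s.im + τ|) ^ (ε / (k + 1))) k,
            ← Real.rpow_mul (by positivity)]
        _ ≤ Z ^ k * (1 + |s.im + τ|) ^ ε := by
          gcongr
          · linarith [abs_nonneg (s.im + τ)]
          · rw [div_mul_eq_mul_div, div_le_iff₀ (by positivity)]
            nlinarith
        _ ≤ Z ^ k * ((1 + |s.im|) * (1 + |τ|)) ^ ε := by gcongr
        _ = _ := by rw [Real.mul_rpow (by positivity) (by positivity)]
    rw [hH]
    simp only [norm_div, norm_pow]
    rw [div_le_iff₀ hs0]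
    calc _ ≤ Z ^ k * ((1 + |s.im|) ^ ε * (1 + |τ|) ^ ε) := e3
      _ = Z ^ k * (1 + |τ|) ^ ε * (1 + |s.im|) ^ (ε - 1) * (1 + |s.im|) := by
        rw [Real.rpow_sub_one (by positivity)]; field_simp
      _ ≤ Z ^ k * (1 + |τ|) ^ ε * (1 + |s.im|) ^ (ε - 1) * (3 * ‖s‖) := by gcongr
      _ = _ := by rw [hB]; ring
  have hpair : ∫ u in Set.Ioi (0 : ℝ), S u * (tent x u : ℂ) = (1 / (2 * Real.pi) : ℝ) *
      ∫ t : ℝ, tentMellin x ((3 : ℝ) + t * Complex.I + 1) * H ((3 : ℝ) + t * Complex.I) := by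
    have h := integral_mul_tent (G := (Set.Ioi 1).indicator S) (σ := 3) hx (by norm_num) le_rfl
      (by simpa using mellinConvergent_indicator_Ioi_one hSloc hSO (s := 3) (by norm_num))
    have hl : ∫ u in Set.Ioi (0 : ℝ), (Set.Ioi 1).indicator S u * (tent x u : ℂ) =
        ∫ u in Set.Ioi (0 : ℝ), S u * (tent x u : ℂ) := by
      refine setIntegral_congr_fun measurableSet_Ioi fun u _ => ?_
      by_cases hu : u ∈ Set.Ioi (1 : ℝ)
      · simp only [Set.indicator_of_mem hu]
      · have hu1 : u ≤ 1 := not_lt.1 hu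
        have : tent x u = 0 := max_eq_left (by
          rw [abs_of_neg (by linarith)]
          linarith)
        simp [this]
    rw [hl] at h
    rw [h]
    congr 1
    refine integral_congr_ae (Eventually.of_forall fun t => ?_)
    simp only
    congr 1
    rw [mellin_indicator_Ioi_one]
    exact integral_Ioi_one_sum_Icc hC₁.le (h₁ τ) (by simp; norm_num)
      (muTwist_LSeriesHasSum k τ (by simp))
  -- For the shift only decay in `t` matters, so the tent is used with `η = 2` and `x^(Re s + 2)` is
  -- bounded by `x^5`. The sharp dependence on `x` is recovered on the new line.
  have hshift := integral_vertical_eq (F := fun s => tentMellin x (s + 1) * H s)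
    (σ₁ := 1 / 2 + ε) (σ₂ := 3) (C := 3888 * x ^ (5 : ℝ) * B) (by linarith)
    (fun s h1 h3 => by
      have hs0 : s ≠ 0 := by rintro rfl; simp at h1; linarith
      have d1 : DifferentiableAt ℂ (fun s => tentMellin x (s + 1)) s :=
        (differentiableAt_tentMellin (by simp; linarith) hx0).comp s
          (differentiableAt_id.add_const 1)
      have d2 : DifferentiableAt ℂ (fun s => zetaInv (s + τ * Complex.I)) s :=
        (differentiableAt_zetaInv hRH (by simp; linarith)).comp s
          (differentiableAt_id.add_const _)
      exact d1.mul ((d2.pow k).div differentiableAt_id hs0))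
    (fun s h1 h3 => by
      have e1 := norm_tentMellin_le hx (s := s) (by linarith) h3 zero_le_two le_rfl
      have e2 := hHb s h1 h3
      have ht : 1 ≤ 1 + |s.im| := by linarith [abs_nonneg s.im]
      rw [norm_mul]
      calc _ ≤ (3888 * x ^ (s.re + 2) * (1 + |s.im|) ^ (-2 : ℝ)) *
            (B * (1 + |s.im|) ^ (ε - 1)) := by gcongr
        _ ≤ (3888 * x ^ (5 : ℝ) * (1 + |s.im|) ^ (-2 : ℝ)) * (B * 1) := by
          gcongr
          · linarith
          · exact Real.rpow_le_one_of_one_le_of_nonpos ht (by linarith)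
        _ = _ := by ring)
  rw [← hshift] at hpair
  have hmain := hK x (1 / 2 + ε) B (fun t => H ((1 / 2 + ε : ℝ) + t * Complex.I)) hx (by linarith)
    (by linarith) hB0 (fun t _ => by
      simpa using hHb ((1 / 2 + ε : ℝ) + t * Complex.I) (by simp) (by simp; linarith))
  have hint : ‖∫ u in Set.Ioi (0 : ℝ), S u * (tent x u : ℂ)‖ ≤ K * B * x ^ (1 / 2 + ε + 2 * ε) := by
    rw [hpair]
    exact (norm_one_div_two_pi_mul_le _).trans hmain
  have hsmooth := norm_sub_integral_mul_tent_le (x := x) (B := 2 * C₂ * (x + 2) ^ ε) hx hSloc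
    fun u hu => norm_sum_Icc_sub_le hε0.le hC₂.le (h₂ τ) hx0.le hu.1 hu.2
  have hxe : (x + 2) ^ ε ≤ 3 * x ^ (1 / 2 + δ) := by
    calc (x + 2) ^ ε ≤ (3 * x) ^ ε := by gcongr; linarith
      _ = 3 ^ ε * x ^ ε := Real.mul_rpow (by norm_num) hx0.le
      _ ≤ 3 ^ (1 : ℝ) * x ^ (1 / 2 + δ) := by
        gcongr
        · norm_num
        · linarith
        · linarith
      _ = _ := by rw [Real.rpow_one]
  have hx1 : x ^ (1 / 2 + ε + 2 * ε) ≤ x ^ (1 / 2 + δ) :=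
    Real.rpow_le_rpow_of_exponent_le hx (by linarith)
  have hτε : (1 + |τ|) ^ ε ≤ (1 + |τ|) ^ δ := Real.rpow_le_rpow_of_exponent_le hτ1 (by linarith)
  have hτδ : 1 ≤ (1 + |τ|) ^ δ := Real.one_le_rpow hτ1 hδ.le
  calc ‖S x‖ = ‖(S x - ∫ u in Set.Ioi (0 : ℝ), S u * (tent x u : ℂ)) +
        ∫ u in Set.Ioi (0 : ℝ), S u * (tent x u : ℂ)‖ := by rw [sub_add_cancel]
    _ ≤ 2 * (2 * C₂ * (x + 2) ^ ε) + K * B * x ^ (1 / 2 + ε + 2 * ε) :=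
      (norm_add_le _ _).trans (add_le_add hsmooth hint)
    _ ≤ 2 * (2 * C₂ * (3 * x ^ (1 / 2 + δ))) * (1 + |τ|) ^ δ +
        K * (3 * Z ^ k * (1 + |τ|) ^ δ) * x ^ (1 / 2 + δ) := by
      refine add_le_add ?_ (by rw [hB]; gcongr)
      calc 2 * (2 * C₂ * (x + 2) ^ ε) ≤ 2 * (2 * C₂ * (3 * x ^ (1 / 2 + δ))) := by gcongr
        _ ≤ _ := le_mul_of_one_le_right (by positivity) hτδ
    _ = _ := by ring

/-- Tails of the Dirichlet series of `1 / ζ ^ k` under the Riemann Hypothesis, uniformly in the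
upper end of the range. -/
theorem exists_norm_sum_Ioc_muPow_le (hRH : RiemannHypothesis) (k : ℕ) {δ σ : ℝ} (hδ : 0 < δ)
    (hδ1 : δ ≤ 1) (hσ : 1 / 2 + δ < σ) :
    ∃ C : ℝ, 0 < C ∧ ∀ (y τ : ℝ) (N : ℕ), 1 ≤ y →
      ‖∑ m ∈ Finset.Ioc ⌊y⌋₊ N, (muPow k m : ℂ) * (m : ℂ) ^ (-(σ + τ * Complex.I))‖ ≤
        C * y ^ (1 / 2 + δ - σ) * (1 + |τ|) ^ δ := by
  obtain ⟨C, hC, h⟩ := exists_norm_sum_muTwist_le hRH k hδ hδ1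
  have hσκ : 0 < σ - (1 / 2 + δ) := by linarith
  have hσ0 : 0 < σ := by linarith
  refine ⟨C * (2 + σ / (σ - (1 / 2 + δ))), by positivity, fun y τ N hy => ?_⟩
  have hy0 : 0 < y := by linarith
  rcases lt_or_ge (N : ℝ) y with hN | hN
  · have hfl : N ≤ ⌊y⌋₊ := Nat.le_floor hN.le
    rw [Finset.Ioc_eq_empty (not_lt.2 hfl), Finset.sum_empty, norm_zero]
    positivity
  set W : ℝ := (1 + |τ|) ^ δ with hW
  have hW0 : 0 ≤ W := by positivity
  set f : ℝ → ℂ := fun t => ((t ^ (-σ) : ℝ) : ℂ) with hf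
  have hfd : ∀ t : ℝ, 0 < t → HasDerivAt f ((-σ * t ^ (-σ - 1) : ℝ) : ℂ) t := fun t ht =>
    (Real.hasDerivAt_rpow_const (Or.inl ht.ne')).ofReal_comp
  have hcont : ContinuousOn (deriv f) (Set.Icc y N) := by
    have : ContinuousOn (fun t : ℝ => ((-σ * t ^ (-σ - 1) : ℝ) : ℂ)) (Set.Icc y N) := by
      refine Complex.continuous_ofReal.comp_continuousOn (continuousOn_const.mul ?_)
      exact continuousOn_id.rpow_const fun t ht => Or.inl (by linarith [ht.1] : (0 : ℝ) < t).ne'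
    exact this.congr fun t ht => (hfd t (by linarith [ht.1])).deriv
  -- Partial summation against `t^(-σ)`. As `σ > 1/2 + δ`, both end terms and the integral are
  -- governed by the lower end `y`, which gives uniformity in `N`.
  have habel := sum_mul_eq_sub_sub_integral_mul (𝕜 := ℂ) (muTwist k τ) (f := f) hy0.le hN
    (fun t ht => (hfd t (by linarith [ht.1])).differentiableAt)
    (hcont.integrableOn_compact isCompact_Icc)
  rw [Nat.floor_natCast] at habel
  have hIcc : ∀ n : ℕ, ∑ m ∈ Finset.Icc 0 n, muTwist k τ m = ∑ m ∈ Finset.Icc 1 n, muTwist k τ m := by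
    intro n
    rw [Finset.Icc_eq_cons_Ioc (Nat.zero_le _), Finset.sum_cons]
    simp [muTwist]
    rfl
  have hsum : ∑ m ∈ Finset.Ioc ⌊y⌋₊ N, (muPow k m : ℂ) * (m : ℂ) ^ (-(σ + τ * Complex.I)) =
      ∑ m ∈ Finset.Ioc ⌊y⌋₊ N, f m * muTwist k τ m := by
    refine Finset.sum_congr rfl fun m hm => ?_
    have hm0 : (m : ℂ) ≠ 0 := by
      have := (Finset.mem_Ioc.1 hm).1
      exact_mod_cast (by omega : m ≠ 0)
    rw [hf, muTwist, neg_add, Complex.cpow_add _ _ hm0]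
    simp only
    rw [Complex.ofReal_cpow (by positivity)]
    push_cast
    ring
  have hA : ∀ t : ℝ, y ≤ t → ‖∑ m ∈ Finset.Icc 0 ⌊t⌋₊, muTwist k τ m‖ ≤ C * t ^ (1 / 2 + δ) * W :=
    fun t ht => by rw [hIcc]; exact h t τ (hy.trans ht)
  have hend : ∀ t : ℝ, y ≤ t → ‖f t * ∑ m ∈ Finset.Icc 0 ⌊t⌋₊, muTwist k τ m‖ ≤
      C * W * y ^ (1 / 2 + δ - σ) := by
    intro t ht
    have ht0 : 0 < t := by linarith
    rw [norm_mul, hf]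
    simp only [Complex.norm_real, Real.norm_eq_abs]
    rw [abs_of_nonneg (by positivity)]
    calc t ^ (-σ) * _ ≤ t ^ (-σ) * (C * t ^ (1 / 2 + δ) * W) := by gcongr; exact hA t ht
      _ = C * W * t ^ (1 / 2 + δ - σ) := by
        rw [show (1 / 2 + δ - σ : ℝ) = -σ + (1 / 2 + δ) by ring,
          Real.rpow_add ht0 (-σ) (1 / 2 + δ)]
        ring
      _ ≤ _ := by
        gcongr C * W * ?_
        exact Real.rpow_le_rpow_of_nonpos hy0 ht (by linarith)
  have hintb : ‖∫ t in Set.Ioc y N, deriv f t * ∑ m ∈ Finset.Icc 0 ⌊t⌋₊, muTwist k τ m‖ ≤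
      C * W * (σ / (σ - (1 / 2 + δ))) * y ^ (1 / 2 + δ - σ) := by
    have hg : IntegrableOn (fun t : ℝ => σ * C * W * t ^ (1 / 2 + δ - σ - 1)) (Set.Ioi y) :=
      (integrableOn_Ioi_rpow_of_lt (by linarith) hy0).const_mul _
    refine (norm_integral_le_of_norm_le (hg.mono_set Set.Ioc_subset_Ioi_self) ?_).trans ?_
    · filter_upwards [self_mem_ae_restrict measurableSet_Ioc] with t ht
      have ht0 : 0 < t := by linarith [ht.1]
      rw [norm_mul, (hfd t ht0).deriv, Complex.norm_real, Real.norm_eq_abs, abs_mul, abs_neg,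
        abs_of_pos hσ0, abs_of_nonneg (by positivity)]
      calc _ ≤ σ * t ^ (-σ - 1) * (C * t ^ (1 / 2 + δ) * W) := by gcongr; exact hA t ht.1.le
        _ = _ := by
          rw [show (1 / 2 + δ - σ - 1 : ℝ) = (-σ - 1) + (1 / 2 + δ) by ring,
            Real.rpow_add ht0 (-σ - 1) (1 / 2 + δ)]
          ring
    · refine (setIntegral_mono_set hg ?_ (Set.Ioc_subset_Ioi_self).eventuallyLE).trans ?_
      · filter_upwards [self_mem_ae_restrict measurableSet_Ioi] with t ht
        have ht0 : 0 < t := hy0.trans ht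
        simp only [Pi.zero_apply]
        positivity
      · rw [integral_const_mul, integral_Ioi_rpow_of_lt (by linarith) hy0, sub_add_cancel]
        refine le_of_eq ?_
        rw [show (1 / 2 + δ - σ) = -(σ - (1 / 2 + δ)) by ring]
        field_simp
  rw [hsum, habel]
  have e1 := hend N hN
  have e2 := hend y le_rfl
  rw [Nat.floor_natCast] at e1
  calc _ ≤ C * W * y ^ (1 / 2 + δ - σ) + C * W * y ^ (1 / 2 + δ - σ) +
        C * W * (σ / (σ - (1 / 2 + δ))) * y ^ (1 / 2 + δ - σ) :=
        (norm_sub_le _ _).trans (add_le_add ((norm_sub_le _ _).trans (add_le_add e1 e2)) hintb)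
    _ = _ := by ring

/-! ### Measurable functions bounded near the origin -/

/-- Measurable functions that are bounded on every interval `(0, V]`. -/
structure IsTame (h : ℝ → ℂ) : Prop where
  measurable : Measurable h
  bounded : ∀ V : ℝ, ∃ C : ℝ, ∀ v : ℝ, 0 < v → v ≤ V → ‖h v‖ ≤ C

namespace IsTame

theorem add {f g : ℝ → ℂ} (hf : IsTame f) (hg : IsTame g) : IsTame fun u => f u + g u := by
  refine ⟨hf.measurable.add hg.measurable, fun V => ?_⟩
  obtain ⟨A, hA⟩ := hf.bounded V
  obtain ⟨B, hB⟩ := hg.bounded V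
  exact ⟨A + B, fun v h0 hV => (norm_add_le _ _).trans (add_le_add (hA v h0 hV) (hB v h0 hV))⟩

theorem const_mul {f : ℝ → ℂ} (hf : IsTame f) (z : ℂ) : IsTame fun u => z * f u := by
  refine ⟨hf.measurable.const_mul z, fun V => ?_⟩
  obtain ⟨A, hA⟩ := hf.bounded V
  exact ⟨‖z‖ * A, fun v h0 hV => by rw [norm_mul]; gcongr; exact hA v h0 hV⟩

theorem sub {f g : ℝ → ℂ} (hf : IsTame f) (hg : IsTame g) : IsTame fun u => f u - g u := by
  simpa [sub_eq_add_neg] using hf.add (hg.const_mul (-1))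

theorem comp_div {f : ℝ → ℂ} (hf : IsTame f) {n : ℝ} (hn : 0 < n) : IsTame fun u => f (u / n) := by
  refine ⟨hf.measurable.comp (measurable_id.div_const n), fun V => ?_⟩
  obtain ⟨A, hA⟩ := hf.bounded (V / n)
  exact ⟨A, fun v h0 hV => hA _ (by positivity) (by gcongr)⟩

theorem locallyIntegrableOn {f : ℝ → ℂ} (hf : IsTame f) : LocallyIntegrableOn f (Set.Ioi 0) := by
  intro x hx
  have hx0 : (0 : ℝ) < x := hx
  obtain ⟨A, hA⟩ := hf.bounded (x + 1)
  refine ⟨Set.Ioc 0 (x + 1), ?_, ?_⟩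
  · refine mem_nhdsWithin.2 ⟨Set.Iio (x + 1), isOpen_Iio, by simp, fun u hu => ⟨hu.2, hu.1.le⟩⟩
  · refine Measure.integrableOn_of_bounded (M := A) (by simp) hf.measurable.aestronglyMeasurable ?_
    filter_upwards [self_mem_ae_restrict measurableSet_Ioc] with u hu
    exact hA u hu.1 hu.2

end IsTame

theorem isTame_sum_Icc (f : ℕ → ℂ) : IsTame fun u => ∑ n ∈ Finset.Icc 1 ⌊u⌋₊, f n := by
  refine ⟨(measurable_from_nat (f := fun N => ∑ n ∈ Finset.Icc 1 N, f n)).comp Nat.measurable_floor,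
    fun V => ⟨∑ n ∈ Finset.Icc 1 ⌊V⌋₊, ‖f n‖, fun v _ hV => ?_⟩⟩
  refine (norm_sum_le _ _).trans (Finset.sum_le_sum_of_subset_of_nonneg ?_ fun _ _ _ => norm_nonneg _)
  exact Finset.Icc_subset_Icc_right (Nat.floor_le_floor hV)

/-! ### Main terms -/

/-- Linear combinations of `u ^ γ₁`, `u ^ γ₂` and `u ^ γ₁ log u`. -/
def mainTerm (p q r : ℂ) (γ₁ γ₂ u : ℝ) : ℂ :=
  p * ((u ^ γ₁ : ℝ) : ℂ) + q * ((u ^ γ₂ : ℝ) : ℂ) + r * ((Real.log u * u ^ γ₁ : ℝ) : ℂ)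

theorem exists_divisorMain_eq (a b : ℕ) :
    ∃ p q r : ℂ, (a ≠ b → r = 0) ∧
      ∀ u, divisorMain a b u = mainTerm p q r (1 / (a : ℝ)) (1 / (b : ℝ)) u := by
  by_cases hab : a = b
  · refine ⟨((2 * Real.eulerMascheroniConstant - 1 : ℝ) : ℂ), 0, 1 / (a : ℂ), fun h => absurd hab h,
      fun u => ?_⟩
    rw [divisorMain, if_pos hab, mainTerm]
    push_cast
    ring
  · refine ⟨riemannZeta (((b : ℝ) / a : ℝ) : ℂ), riemannZeta (((a : ℝ) / b : ℝ) : ℂ), 0,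
      fun _ => rfl, fun u => ?_⟩
    rw [divisorMain, if_neg hab, mainTerm, divisorMainGeneric]
    ring

theorem exists_fMain_eq (k a b c : ℕ) :
    ∃ p q r : ℂ, ∀ u, fMain k a b c u = mainTerm p q r (1 / (a : ℝ)) (1 / (b : ℝ)) u := by
  by_cases hab : a = b
  · refine ⟨(((2 * Real.eulerMascheroniConstant - 1 : ℝ) : ℂ) -
        (k : ℂ) * (((c : ℝ) / a : ℝ) : ℂ) * (deriv riemannZeta (((c : ℝ) / a : ℝ) : ℂ) /
          riemannZeta (((c : ℝ) / a : ℝ) : ℂ))) / riemannZeta (((c : ℝ) / a : ℝ) : ℂ) ^ k, 0,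
      1 / (a : ℂ) / riemannZeta (((c : ℝ) / a : ℝ) : ℂ) ^ k, fun u => ?_⟩
    rw [fMain, if_pos hab, mainTerm]
    push_cast
    ring
  · refine ⟨riemannZeta (((b : ℝ) / a : ℝ) : ℂ) / riemannZeta (((c : ℝ) / a : ℝ) : ℂ) ^ k,
      riemannZeta (((a : ℝ) / b : ℝ) : ℂ) / riemannZeta (((c : ℝ) / b : ℝ) : ℂ) ^ k, 0, fun u => ?_⟩
    rw [fMain, if_neg hab, mainTerm, fMainGeneric]
    ring

theorem isTame_rpow {γ : ℝ} (hγ : 0 ≤ γ) : IsTame fun u => ((u ^ γ : ℝ) : ℂ) := by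
  refine ⟨by fun_prop, fun V => ⟨V ^ γ, fun v h0 hV => ?_⟩⟩
  rw [Complex.norm_real, Real.norm_eq_abs, abs_of_nonneg (by positivity)]
  gcongr

theorem isTame_log_mul_rpow {γ : ℝ} (hγ : 0 < γ) :
    IsTame fun u => ((Real.log u * u ^ γ : ℝ) : ℂ) := by
  refine ⟨by fun_prop, fun V => ⟨1 / γ + |Real.log V| * V ^ γ, fun v h0 hV => ?_⟩⟩
  have hV0 : 0 < V := h0.trans_le hV
  rw [Complex.norm_real, Real.norm_eq_abs]
  rcases le_or_gt v 1 with h1 | h1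
  · have := Real.abs_log_mul_self_rpow_lt v γ h0 h1 hγ
    have : 0 ≤ |Real.log V| * V ^ γ := by positivity
    linarith
  · have hl : |Real.log v| ≤ |Real.log V| := by
      rw [abs_of_nonneg (Real.log_nonneg h1.le), abs_of_nonneg (Real.log_nonneg (h1.le.trans hV))]
      exact Real.log_le_log h0 hV
    rw [abs_mul, abs_of_nonneg (by positivity : 0 ≤ v ^ γ)]
    have : 0 ≤ 1 / γ := by positivity
    have : |Real.log v| * v ^ γ ≤ |Real.log V| * V ^ γ := by gcongr
    linarith

theorem isTame_mainTerm (p q r : ℂ) {γ₁ γ₂ : ℝ} (h₁ : 0 < γ₁) (h₂ : 0 < γ₂) :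
    IsTame (mainTerm p q r γ₁ γ₂) :=
  (((isTame_rpow h₁.le).const_mul p).add ((isTame_rpow h₂.le).const_mul q)).add
    ((isTame_log_mul_rpow h₁).const_mul r)

theorem exists_norm_mainTerm_le_of_le_one (p q r : ℂ) {γ₁ γ₂ β : ℝ} (h₁ : β < γ₁) (h₂ : β < γ₂) :
    ∃ C : ℝ, ∀ v : ℝ, 0 < v → v ≤ 1 → ‖mainTerm p q r γ₁ γ₂ v‖ ≤ C * v ^ β := by
  refine ⟨‖p‖ + ‖q‖ + ‖r‖ * (1 / (γ₁ - β)), fun v h0 h1 => ?_⟩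
  have e1 : v ^ γ₁ ≤ v ^ β := Real.rpow_le_rpow_of_exponent_ge h0 h1 h₁.le
  have e2 : v ^ γ₂ ≤ v ^ β := Real.rpow_le_rpow_of_exponent_ge h0 h1 h₂.le
  have e3 : |Real.log v * v ^ γ₁| ≤ 1 / (γ₁ - β) * v ^ β := by
    have := (Real.abs_log_mul_self_rpow_lt v (γ₁ - β) h0 h1 (sub_pos.2 h₁)).le
    have hv : v ^ γ₁ = v ^ (γ₁ - β) * v ^ β := by rw [← Real.rpow_add h0]; ring_nf
    rw [hv, ← mul_assoc, abs_mul, abs_of_nonneg (by positivity : 0 ≤ v ^ β)]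
    gcongr
  rw [mainTerm]
  refine (norm_add_le _ _).trans ?_
  refine (add_le_add_left (norm_add_le _ _) _).trans ?_
  rw [norm_mul, norm_mul, norm_mul, Complex.norm_real, Complex.norm_real, Complex.norm_real,
    Real.norm_eq_abs, Real.norm_eq_abs, Real.norm_eq_abs, abs_of_nonneg (by positivity : 0 ≤ v ^ γ₁),
    abs_of_nonneg (by positivity : 0 ≤ v ^ γ₂)]
  calc _ ≤ ‖p‖ * v ^ β + ‖q‖ * v ^ β + ‖r‖ * (1 / (γ₁ - β) * v ^ β) := by gcongr
    _ = _ := by ring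

theorem rpow_sub_rpow_le {γ x u : ℝ} (h1 : γ ≤ 1) (hx : 1 ≤ x) (hxu : x ≤ u)
    (hux : u ≤ x + 2) : u ^ γ - x ^ γ ≤ 2 := by
  have hx0 : 0 < x := by linarith
  have hr : 1 ≤ u / x := (one_le_div hx0).2 hxu
  have e1 : u ^ γ ≤ x ^ γ * (u / x) := by
    calc u ^ γ = x ^ γ * (u / x) ^ γ := by
          rw [← Real.mul_rpow hx0.le (by positivity), mul_div_cancel₀ _ hx0.ne']
      _ ≤ x ^ γ * (u / x) ^ (1 : ℝ) := by gcongr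
      _ = _ := by rw [Real.rpow_one]
  have e2 : x ^ γ ≤ x := by simpa using Real.rpow_le_rpow_of_exponent_le hx h1
  calc u ^ γ - x ^ γ ≤ x ^ γ * (u / x) - x ^ γ := by linarith
    _ = x ^ γ * ((u - x) / x) := by field_simp
    _ ≤ x * ((u - x) / x) := by
      gcongr
    _ = u - x := by field_simp
    _ ≤ 2 := by linarith

/-- Powers with exponent at most `1` move by `O(1)` over `[x, x+2]`; only the logarithm of the case
`a = b` requires the factor `x^ε`. -/
theorem exists_norm_mainTerm_sub_le (p q r : ℂ) {γ₁ γ₂ ε : ℝ} (h₁ : 0 ≤ γ₁) (h₁' : γ₁ ≤ 1)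
    (h₂ : 0 ≤ γ₂) (h₂' : γ₂ ≤ 1) (hε : 0 < ε) :
    ∃ C : ℝ, 0 ≤ C ∧ ∀ x u : ℝ, 1 ≤ x → x ≤ u → u ≤ x + 2 →
      ‖mainTerm p q r γ₁ γ₂ u - mainTerm p q r γ₁ γ₂ x‖ ≤ C * x ^ ε := by
  refine ⟨2 * ‖p‖ + 2 * ‖q‖ + ‖r‖ * (2 * (3 ^ ε / ε) + 2), by positivity, fun x u hx hxu hux => ?_⟩
  have hx0 : 0 < x := by linarith
  have hu0 : 0 < u := by linarith
  have hxε : 1 ≤ x ^ ε := Real.one_le_rpow hx hε.le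
  have habs : ∀ γ : ℝ, 0 ≤ γ → γ ≤ 1 → |u ^ γ - x ^ γ| ≤ 2 := fun γ h h' => by
    rw [abs_of_nonneg (sub_nonneg.2 (Real.rpow_le_rpow hx0.le hxu h))]
    exact rpow_sub_rpow_le h' hx hxu hux
  have hlog : |Real.log u * u ^ γ₁ - Real.log x * x ^ γ₁| ≤ (2 * (3 ^ ε / ε) + 2) * x ^ ε := by
    have e1 : Real.log u * u ^ γ₁ - Real.log x * x ^ γ₁ =
        Real.log u * (u ^ γ₁ - x ^ γ₁) + x ^ γ₁ * Real.log (u / x) := by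
      rw [Real.log_div hu0.ne' hx0.ne']; ring
    have hlu : 0 ≤ Real.log u := Real.log_nonneg (by linarith)
    have e2 : Real.log u ≤ 3 ^ ε / ε * x ^ ε := by
      calc Real.log u ≤ u ^ ε / ε := Real.log_le_rpow_div hu0.le hε
        _ ≤ (3 * x) ^ ε / ε := by gcongr; linarith
        _ = _ := by rw [Real.mul_rpow (by norm_num) hx0.le]; ring
    have hr : 1 ≤ u / x := (one_le_div hx0).2 hxu
    have e3 : |x ^ γ₁ * Real.log (u / x)| ≤ 2 := by
      rw [abs_of_nonneg (mul_nonneg (by positivity) (Real.log_nonneg hr))]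
      have h4 : Real.log (u / x) ≤ u / x - 1 := Real.log_le_sub_one_of_pos (by positivity)
      have h5 : x ^ γ₁ ≤ x := by simpa using Real.rpow_le_rpow_of_exponent_le hx h₁'
      calc x ^ γ₁ * Real.log (u / x) ≤ x * (u / x - 1) := by
            gcongr
            exact Real.log_nonneg hr
        _ = u - x := by field_simp
        _ ≤ 2 := by linarith
    rw [e1]
    refine (abs_add_le _ _).trans ?_
    rw [abs_mul, abs_of_nonneg hlu]
    calc _ ≤ 3 ^ ε / ε * x ^ ε * 2 + 2 * x ^ ε := by
          gcongr
          · exact habs γ₁ h₁ h₁'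
          · linarith
      _ = _ := by ring
  have hd : mainTerm p q r γ₁ γ₂ u - mainTerm p q r γ₁ γ₂ x =
      p * ((u ^ γ₁ - x ^ γ₁ : ℝ) : ℂ) + q * ((u ^ γ₂ - x ^ γ₂ : ℝ) : ℂ) +
        r * ((Real.log u * u ^ γ₁ - Real.log x * x ^ γ₁ : ℝ) : ℂ) := by
    simp only [mainTerm]
    push_cast
    ring
  rw [hd]
  refine (norm_add_le _ _).trans ?_
  refine (add_le_add_left (norm_add_le _ _) _).trans ?_
  rw [norm_mul, norm_mul, norm_mul, Complex.norm_real, Complex.norm_real, Complex.norm_real,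
    Real.norm_eq_abs, Real.norm_eq_abs, Real.norm_eq_abs]
  have f1 := habs γ₁ h₁ h₁'
  have f2 := habs γ₂ h₂ h₂'
  calc _ ≤ ‖p‖ * (2 * x ^ ε) + ‖q‖ * (2 * x ^ ε) + ‖r‖ * ((2 * (3 ^ ε / ε) + 2) * x ^ ε) := by
        gcongr <;> linarith
    _ = _ := by ring

/-! ### The convolution identity for the error terms -/

theorem hasSum_muPow_rpow (k : ℕ) {σ : ℝ} (hσ : 1 < σ) :
    HasSum (fun m : ℕ => (muPow k m : ℂ) * (((m : ℝ) ^ (-σ) : ℝ) : ℂ))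
      (1 / riemannZeta (σ : ℂ) ^ k) := by
  have h := muPow_LSeriesHasSum k (s := σ) (by simpa using hσ)
  rw [LSeriesHasSum] at h
  convert h using 2 with m
  rcases eq_or_ne m 0 with rfl | hm
  · simp
  · rw [LSeries.term_of_ne_zero hm, Complex.ofReal_cpow (by positivity), div_eq_mul_inv,
      ← Complex.cpow_neg]
    push_cast
    rfl

/-- Termwise differentiation of the Dirichlet series of `ζ(s)^(-k)`; this yields the `ζ'/ζ` term of
the main term for `a = b`. -/
theorem hasSum_muPow_log_mul_rpow (k : ℕ) {σ : ℝ} (hσ : 1 < σ) :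
    HasSum (fun m : ℕ => (muPow k m : ℂ) * ((Real.log m * (m : ℝ) ^ (-σ) : ℝ) : ℂ))
      (k * (deriv riemannZeta (σ : ℂ) / riemannZeta (σ : ℂ)) / riemannZeta (σ : ℂ) ^ k) := by
  set f : ℕ → ℂ := fun n => (muPow k n : ℂ) with hf
  have habs : LSeries.abscissaOfAbsConv f < (σ : ℂ).re := by
    refine (LSeries.abscissaOfAbsConv_le_of_forall_lt_LSeriesSummable (x := 1) fun y hy =>
      muPow_LSeriesSummable k (by simpa using hy)).trans_lt ?_
    rw [Complex.ofReal_re]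
    exact_mod_cast hσ
  have hσ1 : (σ : ℂ) ≠ 1 := by exact_mod_cast hσ.ne'
  have hz : riemannZeta (σ : ℂ) ≠ 0 := riemannZeta_ne_zero_of_one_lt_re (by simpa using hσ)
  have hd1 := LSeries_hasDerivAt habs
  have hd2 := (((differentiableAt_riemannZeta hσ1).hasDerivAt).fun_pow k).fun_inv (pow_ne_zero k hz)
  have heq : LSeries f =ᶠ[𝓝 (σ : ℂ)] fun s => (riemannZeta s ^ k)⁻¹ := by
    have : {s : ℂ | 1 < s.re} ∈ 𝓝 (σ : ℂ) :=
      (isOpen_lt continuous_const Complex.continuous_re).mem_nhds (by simpa using hσ)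
    filter_upwards [this] with s hs
    rw [(muPow_LSeriesHasSum k hs).LSeries_eq, one_div]
  have huniq := hd1.unique (hd2.congr_of_eventuallyEq heq)
  have hsum := (LSeriesSummable_logMul_of_lt_re habs).LSeriesHasSum
  rw [LSeriesHasSum] at hsum
  have hval : LSeries (LSeries.logMul f) (σ : ℂ) =
      k * (deriv riemannZeta (σ : ℂ) / riemannZeta (σ : ℂ)) / riemannZeta (σ : ℂ) ^ k := by
    rw [← neg_neg (LSeries (LSeries.logMul f) (σ : ℂ)), huniq]
    rcases k with _ | k
    · simp
    · simp only [Nat.add_sub_cancel]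
      field_simp
      ring
  rw [hval] at hsum
  convert hsum using 2 with m
  rcases eq_or_ne m 0 with rfl | hm
  · simp
  · rw [LSeries.term_of_ne_zero hm, LSeries.logMul, Complex.ofReal_mul,
      Complex.ofReal_cpow (by positivity), div_eq_mul_inv, ← Complex.cpow_neg]
    push_cast
    simp only [hf]
    ring

/-- Each power `(x/m^c)^(1/e)` splits off `m^(-c/e)`, summable against `μ_k` because `c > b ≥ a`.
For `a = b`, `log(x/m^c) = log x - c log m` brings in the logarithmic series as well. -/
theorem hasSum_muPow_mul_divisorMain (k : ℕ) {a b c : ℕ} (ha : 1 ≤ a) (hab : a ≤ b) (hbc : b < c)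
    {x : ℝ} (hx : 0 < x) :
    HasSum (fun m : ℕ => (muPow k m : ℂ) * divisorMain a b (x / (m : ℝ) ^ c)) (fMain k a b c x) := by
  have ha0 : (0 : ℝ) < a := by exact_mod_cast ha
  have hb0 : (0 : ℝ) < b := by exact_mod_cast (ha.trans hab)
  have hca : 1 < (c : ℝ) / a := by
    rw [one_lt_div ha0]; exact_mod_cast hab.trans_lt hbc
  have hcb : 1 < (c : ℝ) / b := by
    rw [one_lt_div hb0]; exact_mod_cast hbc
  have hpow : ∀ e : ℝ, 0 < e → ∀ m : ℕ, m ≠ 0 →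
      (x / (m : ℝ) ^ c) ^ (1 / e) = x ^ (1 / e) * (m : ℝ) ^ (-(c / e)) := by
    intro e he m hm
    rw [Real.div_rpow hx.le (by positivity), ← Real.rpow_natCast, ← Real.rpow_mul (by positivity),
      div_eq_mul_inv, ← Real.rpow_neg (by positivity), mul_one_div]
  by_cases heq : a = b
  · have h1 := hasSum_muPow_rpow k hca
    have h2 := hasSum_muPow_log_mul_rpow k hca
    have h := (h1.mul_left (((x ^ (1 / (a : ℝ)) : ℝ) : ℂ) *
      ((Real.log x / a + 2 * Real.eulerMascheroniConstant - 1 : ℝ) : ℂ))).sub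
      (h2.mul_left (((x ^ (1 / (a : ℝ)) : ℝ) : ℂ) * (((c : ℝ) / a : ℝ) : ℂ)))
    convert! h using 1
    · funext m
      rcases eq_or_ne m 0 with rfl | hm
      · simp
      have hm0 : (0 : ℝ) < m := by exact_mod_cast Nat.pos_of_ne_zero hm
      rw [divisorMain, if_pos heq, hpow a ha0 m hm, Real.log_div hx.ne' (by positivity),
        Real.log_pow]
      push_cast
      ring
    · rw [fMain, if_pos heq]
      ring
  · have h1 := hasSum_muPow_rpow k hca
    have h2 := hasSum_muPow_rpow k hcb
    have h := (h1.mul_left (riemannZeta (((b : ℝ) / a : ℝ) : ℂ) * ((x ^ (1 / (a : ℝ)) : ℝ) : ℂ))).add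
      (h2.mul_left (riemannZeta (((a : ℝ) / b : ℝ) : ℂ) * ((x ^ (1 / (b : ℝ)) : ℝ) : ℂ)))
    convert! h using 1
    · funext m
      rcases eq_or_ne m 0 with rfl | hm
      · simp
      rw [divisorMain, if_neg heq, divisorMainGeneric, hpow a ha0 m hm, hpow b hb0 m hm]
      push_cast
      ring
    · rw [fMain, if_neg heq, fMainGeneric]
      ring

/-- `Δ_k(a,b;c;x) = ∑ μ_k(m) Δ(a,b;x/m^c)`, the sum extending over all `m`. -/
theorem hasSum_muPow_mul_divisorError (k : ℕ) {a b c : ℕ} (ha : 1 ≤ a) (hab : a ≤ b) (hbc : b < c)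
    {x : ℝ} (hx : 0 < x) :
    HasSum (fun m : ℕ => (muPow k m : ℂ) * divisorError a b (x / (m : ℝ) ^ c))
      (fError k a b c x) := by
  have h1 : HasSum (fun m : ℕ => (muPow k m : ℂ) * (divisorSum a b (x / (m : ℝ) ^ c) : ℂ))
      (fSum k a b c x : ℂ) := by
    rw [fSum_eq_sum ha (ha.trans hab) (by omega) (le_refl ⌊x⌋₊)]
    push_cast
    refine hasSum_sum_of_ne_finset_zero fun m hm => ?_
    rcases eq_or_ne m 0 with rfl | hm0
    · simp
    have hlt : x < m := by
      by_contra hcon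
      exact hm (Finset.mem_Ioc.2 ⟨Nat.pos_of_ne_zero hm0, Nat.le_floor (not_lt.1 hcon)⟩)
    have hm1 : (1 : ℝ) ≤ m := by exact_mod_cast Nat.one_le_iff_ne_zero.2 hm0
    have : x / (m : ℝ) ^ c < 1 := by
      rw [div_lt_one (by positivity)]
      exact hlt.trans_le (le_self_pow₀ hm1 (by omega))
    rw [divisorSum_eq_zero this]
    simp
  have h := h1.sub (hasSum_muPow_mul_divisorMain k ha hab hbc hx)
  simpa only [divisorError, fError, mul_sub] using! h

/-! ### Mellin transforms of the error terms -/

theorem hasMellin_congr_ae {f g : ℝ → ℂ} {s v : ℂ} (hfg : ∀ u, 0 < u → u ≠ 1 → f u = g u)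
    (hf : HasMellin f s v) : HasMellin g s v := by
  have h : (fun u : ℝ => (u : ℂ) ^ (s - 1) • f u) =ᵐ[volume.restrict (Set.Ioi 0)]
      fun u : ℝ => (u : ℂ) ^ (s - 1) • g u := by
    have h1 : ∀ᵐ u : ℝ ∂(volume.restrict (Set.Ioi 0)), u ≠ 1 :=
      ae_restrict_of_ae (compl_mem_ae_iff.2 (measure_singleton (1 : ℝ)))
    filter_upwards [self_mem_ae_restrict measurableSet_Ioi, h1] with u hu hu1
    rw [hfg u hu hu1]
  exact ⟨hf.1.congr h, by rw [← hf.2]; exact (integral_congr_ae h).symm⟩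

theorem _root_.HasMellin.const_mul {f : ℝ → ℂ} {s v : ℂ} (hf : HasMellin f s v) (z : ℂ) :
    HasMellin (fun u => z * f u) s (z * v) := by
  have h := hasMellin_const_smul hf.1 z
  rw [hf.2] at h
  exact h

theorem _root_.HasMellin.add {f g : ℝ → ℂ} {s v w : ℂ} (hf : HasMellin f s v) (hg : HasMellin g s w) :
    HasMellin (fun u => f u + g u) s (v + w) := by
  have h := hasMellin_add hf.1 hg.1
  rwa [hf.2, hg.2] at h

theorem hasMellin_rpow_indicator_Ioi {γ : ℝ} {s : ℂ} (hγ : 0 ≤ γ) (hs : γ < s.re) :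
    HasMellin ((Set.Ioi 1).indicator fun u : ℝ => ((u ^ γ : ℝ) : ℂ)) (-s) (1 / (s - γ)) := by
  refine ⟨mellinConvergent_indicator_Ioi_one (isTame_rpow hγ).locallyIntegrableOn (β := γ)
    (IsBigO.of_bound 1 (by simp)) hs, ?_⟩
  rw [mellin_indicator_Ioi_one, integral_Ioi_one_rpow_mul_cpow hs]

/-- Differentiating the transform of the truncated power in the Mellin variable inserts the factor
`log u`. -/
theorem hasMellin_log_mul_rpow_indicator_Ioi {γ : ℝ} {s : ℂ} (hγ : 0 ≤ γ) (hs : γ < s.re) :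
    HasMellin ((Set.Ioi 1).indicator fun u : ℝ => ((Real.log u * u ^ γ : ℝ) : ℂ)) (-s)
      (1 / (s - γ) ^ 2) := by
  set f : ℝ → ℂ := (Set.Ioi 1).indicator fun u : ℝ => ((u ^ γ : ℝ) : ℂ) with hf
  have h := mellin_hasDerivAt_of_isBigO_rpow (f := f) (s := -s)
    (locallyIntegrableOn_indicator_Ioi (isTame_rpow hγ).locallyIntegrableOn)
    (isBigO_indicator_Ioi_one (β := γ) (IsBigO.of_bound 1 (by simp))) (by simpa using hs)
    (indicator_Ioi_one_isBigO_zero _ (-(-s.re - 1))) (by simp)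
  have hne : s - γ ≠ 0 := by
    intro h0
    have := congrArg Complex.re h0
    simp at this
    linarith
  have hne' : -s + γ ≠ 0 := by
    intro h0
    exact hne (by rw [← neg_eq_zero, ← h0]; ring)
  have heq : mellin f =ᶠ[𝓝 (-s)] fun z => -(z + γ)⁻¹ := by
    have : {z : ℂ | z.re < -γ} ∈ 𝓝 (-s) :=
      (isOpen_lt Complex.continuous_re continuous_const).mem_nhds (by simpa using hs)
    filter_upwards [this] with z hz
    have hz' : z.re < -γ := hz
    have := (hasMellin_rpow_indicator_Ioi hγ (s := -z) (by simp; linarith)).2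
    rw [neg_neg] at this
    rw [hf, this, one_div, ← neg_add', inv_neg]
  have hd : HasDerivAt (fun z : ℂ => -(z + γ)⁻¹) (1 / (s - γ) ^ 2) (-s) := by
    have := (((hasDerivAt_id (-s)).add_const (γ : ℂ)).fun_inv hne').fun_neg
    convert! this using 1
    simp only [id]
    rw [neg_div, neg_neg, show (-s + (γ : ℂ)) ^ 2 = (s - γ) ^ 2 by ring]
  have hv := h.2.unique (hd.congr_of_eventuallyEq heq)
  refine hasMellin_congr (fun u _ => ?_) ⟨h.1, hv⟩
  by_cases hu : u ∈ Set.Ioi (1 : ℝ)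
  · simp [hf, Set.indicator_of_mem hu]
  · simp [hf, Set.indicator_of_notMem hu]

theorem hasMellin_rpow_indicator_Ioc {γ : ℝ} {s : ℂ} (hs : s.re < γ) :
    HasMellin ((Set.Ioc 0 1).indicator fun u : ℝ => ((u ^ γ : ℝ) : ℂ)) (-s) (-(1 / (s - γ))) := by
  have h := hasMellin_cpow_Ioc (γ : ℂ) (s := -s) (by simpa using hs)
  have hv : 1 / (-s + (γ : ℂ)) = -(1 / (s - γ)) := by
    rw [← neg_sub (γ : ℂ) s, one_div_neg_eq_neg_one_div, neg_neg]
    ring_nf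
  rw [hv] at h
  refine hasMellin_congr (fun u hu => ?_) h
  by_cases hu1 : u ∈ Set.Ioc (0 : ℝ) 1
  · rw [Set.indicator_of_mem hu1, Set.indicator_of_mem hu1, Complex.ofReal_cpow hu.le]
  · rw [Set.indicator_of_notMem hu1, Set.indicator_of_notMem hu1]

theorem hasMellin_log_mul_rpow_indicator_Ioc {γ : ℝ} {s : ℂ} (hγ : 0 ≤ γ) (hs : s.re < γ) :
    HasMellin ((Set.Ioc 0 1).indicator fun u : ℝ => ((Real.log u * u ^ γ : ℝ) : ℂ)) (-s)
      (-(1 / (s - γ) ^ 2)) := by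
  set f : ℝ → ℂ := (Set.Ioc 0 1).indicator fun u : ℝ => ((u ^ γ : ℝ) : ℂ) with hf
  have hloc : LocallyIntegrableOn f (Set.Ioi 0) := by
    intro x hx
    obtain ⟨t, ht, hint⟩ := (isTame_rpow hγ).locallyIntegrableOn x hx
    exact ⟨t, ht, hint.indicator measurableSet_Ioc⟩
  have htop : f =O[atTop] fun u : ℝ => u ^ (-(-s.re + 1)) := by
    have : f =ᶠ[atTop] 0 := by
      filter_upwards [eventually_gt_atTop 1] with u hu
      exact Set.indicator_of_notMem (fun h => not_le.2 hu h.2) _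
    exact this.trans_isBigO (isBigO_zero _ _)
  have hbot : f =O[𝓝[>] 0] fun u : ℝ => u ^ (-(-γ)) := by
    rw [neg_neg]
    refine IsBigO.of_bound 1 ?_
    filter_upwards [self_mem_nhdsWithin] with u hu
    rw [one_mul]
    refine (norm_indicator_le_norm_self _ _).trans ?_
    rw [Complex.norm_real]
  have h := mellin_hasDerivAt_of_isBigO_rpow (f := f) (s := -s) hloc htop (by simp) hbot
    (by simpa using hs)
  have hne : s - γ ≠ 0 := by
    intro h0
    have := congrArg Complex.re h0
    simp at this
    linarith
  have hne' : -s + γ ≠ 0 := by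
    intro h0
    exact hne (by rw [← neg_eq_zero, ← h0]; ring)
  have heq : mellin f =ᶠ[𝓝 (-s)] fun z => (z + γ)⁻¹ := by
    have : {z : ℂ | -γ < z.re} ∈ 𝓝 (-s) :=
      (isOpen_lt continuous_const Complex.continuous_re).mem_nhds (by simpa using hs)
    filter_upwards [this] with z hz
    have hz' : -γ < z.re := hz
    have := (hasMellin_rpow_indicator_Ioc (γ := γ) (s := -z) (by simp; linarith)).2
    rw [neg_neg] at this
    rw [hf, this, one_div, ← neg_add', inv_neg, neg_neg]
  have hd : HasDerivAt (fun z : ℂ => (z + γ)⁻¹) (-(1 / (s - γ) ^ 2)) (-s) := by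
    have := ((hasDerivAt_id (-s)).add_const (γ : ℂ)).fun_inv hne'
    convert! this using 1
    simp only [id]
    rw [neg_div, show (-s + (γ : ℂ)) ^ 2 = (s - γ) ^ 2 by ring]
  have hv := h.2.unique (hd.congr_of_eventuallyEq heq)
  refine hasMellin_congr (fun u _ => ?_) ⟨h.1, hv⟩
  by_cases hu : u ∈ Set.Ioc (0 : ℝ) 1
  · simp [hf, Set.indicator_of_mem hu]
  · simp [hf, Set.indicator_of_notMem hu]

/-- The Mellin transform of the truncation of a main term to `(1, ∞)`. -/
def mainMellin (p q r : ℂ) (γ₁ γ₂ : ℝ) (s : ℂ) : ℂ :=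
  p * (1 / (s - γ₁)) + q * (1 / (s - γ₂)) + r * (1 / (s - γ₁) ^ 2)

theorem hasMellin_mainTerm_Ioi (p q r : ℂ) {γ₁ γ₂ : ℝ} (h₁ : 0 ≤ γ₁) (h₂ : 0 ≤ γ₂) {s : ℂ}
    (hs₁ : γ₁ < s.re) (hs₂ : γ₂ < s.re) :
    HasMellin ((Set.Ioi 1).indicator (mainTerm p q r γ₁ γ₂)) (-s) (mainMellin p q r γ₁ γ₂ s) := by
  refine hasMellin_congr (fun u _ => ?_)
    ((((hasMellin_rpow_indicator_Ioi h₁ hs₁).const_mul p).add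
      ((hasMellin_rpow_indicator_Ioi h₂ hs₂).const_mul q)).add
      ((hasMellin_log_mul_rpow_indicator_Ioi h₁ hs₁).const_mul r))
  by_cases hu : u ∈ Set.Ioi (1 : ℝ)
  · simp only [Set.indicator_of_mem hu, mainTerm]
  · simp only [Set.indicator_of_notMem hu, mul_zero, add_zero]

/-- The pieces of a power on `(0, 1]` and `(1, ∞)` have opposite transforms, valid on complementary
half-planes. The alternative `q = 0` permits lines to the right of `γ₂` once that power has been
removed. -/
theorem hasMellin_mainTerm_Ioc (p q r : ℂ) {γ₁ γ₂ : ℝ} (h₁ : 0 ≤ γ₁) {s : ℂ}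
    (hs₁ : s.re < γ₁) (hs₂ : q = 0 ∨ s.re < γ₂) :
    HasMellin ((Set.Ioc 0 1).indicator (mainTerm p q r γ₁ γ₂)) (-s)
      (-mainMellin p q r γ₁ γ₂ s) := by
  have hq : HasMellin (fun u => q * (Set.Ioc 0 1).indicator (fun u : ℝ => ((u ^ γ₂ : ℝ) : ℂ)) u) (-s)
      (q * (-(1 / (s - γ₂)))) := by
    rcases hs₂ with rfl | hs₂
    · refine ⟨?_, ?_⟩
      · simp [MellinConvergent]
      · simp [mellin]
    · exact (hasMellin_rpow_indicator_Ioc hs₂).const_mul q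
  have h := (((hasMellin_rpow_indicator_Ioc hs₁).const_mul p).add hq).add
      ((hasMellin_log_mul_rpow_indicator_Ioc h₁ hs₁).const_mul r)
  have hv : p * -(1 / (s - γ₁)) + q * (-(1 / (s - γ₂))) + r * -(1 / (s - γ₁) ^ 2) =
      -mainMellin p q r γ₁ γ₂ s := by rw [mainMellin]; ring
  rw [hv] at h
  refine hasMellin_congr (fun u _ => ?_) h
  by_cases hu : u ∈ Set.Ioc (0 : ℝ) 1
  · simp only [Set.indicator_of_mem hu, mainTerm]
  · simp only [Set.indicator_of_notMem hu, mul_zero, add_zero]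

theorem exists_divisorCount_le (a b : ℕ) (ha : 1 ≤ a) (hb : 1 ≤ b) :
    ∃ C : ℝ, 0 < C ∧ ∀ n : ℕ, n ≠ 0 → ‖(divisorCount a b n : ℂ)‖ ≤ C * (n : ℝ) ^ (1 : ℝ) := by
  obtain ⟨C, hC, h⟩ :=
    ((zeta_isSubpolynomial.powDilate ha).mul (zeta_isSubpolynomial.powDilate hb)) 1 one_pos
  refine ⟨C, hC, fun n hn => ?_⟩
  have := h n hn
  rw [powDilate_zeta_mul_apply ha hb] at this
  simpa using this

theorem divisorCount_LSeriesHasSum {a b : ℕ} (ha : 1 ≤ a) (hb : 1 ≤ b) {s : ℂ} (hs : 1 < s.re) :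
    LSeriesHasSum (fun n => (divisorCount a b n : ℂ)) s
      (riemannZeta (a * s) * riemannZeta (b * s)) := by
  have hA := powDilate_zeta_LSeriesHasSum ha hs
  have hB := powDilate_zeta_LSeriesHasSum hb hs
  simp only [← ArithmeticFunction.intCoe_apply] at hA hB
  have h := ArithmeticFunction.LSeriesHasSum_mul hA hB
  rw [← ArithmeticFunction.intCoe_mul] at h
  convert! h using 2 with n
  rw [ArithmeticFunction.intCoe_apply, powDilate_zeta_mul_apply ha hb]
  simp

theorem divisorSum_eq_sum (a b : ℕ) (u : ℝ) :
    (divisorSum a b u : ℂ) = ∑ n ∈ Finset.Icc 1 ⌊u⌋₊, (divisorCount a b n : ℂ) := by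
  rw [divisorSum]; push_cast; rfl

theorem isTame_divisorSum (a b : ℕ) : IsTame fun u => (divisorSum a b u : ℂ) := by
  simp only [divisorSum_eq_sum]
  exact isTame_sum_Icc _

/-- The Mellin transform of `D(a,b;u)` minus a main term. -/
theorem hasMellin_divisorSum_sub_mainTerm {a b : ℕ} (ha : 1 ≤ a) (hb : 1 ≤ b) {p q r : ℂ}
    {γ₁ γ₂ β : ℝ} (h₁ : 0 < γ₁) (h₂ : 0 < γ₂)
    (hO : (fun u => (divisorSum a b u : ℂ) - mainTerm p q r γ₁ γ₂ u) =O[atTop] fun u : ℝ => u ^ β)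
    {s : ℂ} (hsβ : β < s.re) (hs₁ : s.re < γ₁) (hs₂ : q = 0 ∨ s.re < γ₂) :
    MellinConvergent (fun u => (divisorSum a b u : ℂ) - mainTerm p q r γ₁ γ₂ u) (-s) ∧
      (s.im ≠ 0 → mellin (fun u => (divisorSum a b u : ℂ) - mainTerm p q r γ₁ γ₂ u) (-s) =
        riemannZeta (a * s) * riemannZeta (b * s) / s) := by
  set h : ℝ → ℂ := fun u => (divisorSum a b u : ℂ) - mainTerm p q r γ₁ γ₂ u with hh
  have hD := isTame_divisorSum a b
  have hM := isTame_mainTerm p q r h₁ h₂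
  have hloc : LocallyIntegrableOn h (Set.Ioi 0) := (hD.sub hM).locallyIntegrableOn
  have hconv := mellinConvergent_indicator_Ioi_one hloc hO hsβ
  have hIoc := (hasMellin_mainTerm_Ioc p q r h₁.le hs₁ hs₂).const_mul (-1)
  -- Below `1` the summatory function vanishes and only minus the main term remains. At `u = 1` the
  -- decomposition fails, since `D(a,b;1) = 1`.
  have hdec : ∀ u : ℝ, 0 < u → u ≠ 1 → (Set.Ioi 1).indicator h u +
      -1 * (Set.Ioc 0 1).indicator (mainTerm p q r γ₁ γ₂) u = h u := by
    intro u hu hu1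
    rcases lt_or_gt_of_ne hu1 with hlt | hgt
    · have hm : u ∉ Set.Ioi (1 : ℝ) := not_lt.2 hlt.le
      have hm' : u ∈ Set.Ioc (0 : ℝ) 1 := ⟨hu, hlt.le⟩
      rw [Set.indicator_of_notMem hm, Set.indicator_of_mem hm', hh]
      simp only
      rw [divisorSum_eq_zero hlt]
      simp
    · have hm : u ∉ Set.Ioc (0 : ℝ) 1 := fun hx => not_le.2 hgt hx.2
      rw [Set.indicator_of_mem (show u ∈ Set.Ioi (1 : ℝ) from hgt), Set.indicator_of_notMem hm]
      ring
  have hfull := hasMellin_congr_ae hdec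
    (HasMellin.add (v := mellin ((Set.Ioi 1).indicator h) (-s)) ⟨hconv, rfl⟩ hIoc)
  refine ⟨hfull.1, fun him => ?_⟩
  rw [hfull.2, mellin_indicator_Ioi_one]
  obtain ⟨C, hC, hCd⟩ := exists_divisorCount_le a b ha hb
  -- Computed far to the right and continued to `Re s > β`. The term `mainMellin` is then cancelled
  -- by the contribution of `(0, 1]`.
  have hcont : ∫ u in Set.Ioi (1 : ℝ), h u * (u : ℂ) ^ (-(s + 1)) =
      riemannZeta (a * s) * riemannZeta (b * s) / s - mainMellin p q r γ₁ γ₂ s := by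
    refine integral_Ioi_one_eq_of_forall_re_gt (σ₀ := max 2 (max γ₁ γ₂)) hloc hO
      (F := fun s => riemannZeta (a * s) * riemannZeta (b * s) / s - mainMellin p q r γ₁ γ₂ s)
      ?_ ?_ hsβ him
    · intro z hz
      have hne : ∀ x : ℝ, z ≠ x := by
        rintro x rfl
        simp at hz
      have hz0 : z ≠ 0 := by simpa using hne 0
      have hζ : ∀ e : ℕ, 1 ≤ e → DifferentiableAt ℂ (fun s : ℂ => riemannZeta (e * s)) z := by
        intro e he
        have : (e : ℂ) * z ≠ 1 := by
          intro h1
          have him := congrArg Complex.im h1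
          simp at him
          rcases him with him | him
          · omega
          · exact hz him
        exact (differentiableAt_riemannZeta this).comp z (differentiableAt_id.const_mul _)
      have hdiv : ∀ x : ℝ, DifferentiableAt ℂ (fun s : ℂ => 1 / (s - x)) z := fun x =>
        (differentiableAt_const _).div (differentiableAt_id.sub_const _) (sub_ne_zero.2 (hne x))
      have hdiv2 : DifferentiableAt ℂ (fun s : ℂ => 1 / (s - γ₁) ^ 2) z :=
        (differentiableAt_const _).div ((differentiableAt_id.sub_const _).pow 2)
          (pow_ne_zero 2 (sub_ne_zero.2 (hne γ₁)))
      exact (((hζ a ha).mul (hζ b hb)).div differentiableAt_id hz0).sub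
        ((((hdiv γ₁).const_mul p).add ((hdiv γ₂).const_mul q)).add (hdiv2.const_mul r))
    · intro z hz
      obtain ⟨hz2, hz'⟩ := max_lt_iff.1 hz
      obtain ⟨hz₁, hz₂⟩ := max_lt_iff.1 hz'
      have e1 := integral_Ioi_one_sum_Icc hC.le hCd hz2
        (divisorCount_LSeriesHasSum ha hb (by linarith))
      have e2 := (hasMellin_mainTerm_Ioi p q r h₁.le h₂.le hz₁ hz₂).2
      rw [mellin_indicator_Ioi_one] at e2
      have i1 := integrableOn_Ioi_one_mul_cpow (isTame_sum_Icc _).locallyIntegrableOn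
        (sum_Icc_isBigO hC.le hCd) hz2
      have i2 : IntegrableOn (fun u : ℝ => mainTerm p q r γ₁ γ₂ u * (u : ℂ) ^ (-(z + 1)))
          (Set.Ioi 1) := by
        have := (hasMellin_mainTerm_Ioi p q r h₁.le h₂.le hz₁ hz₂).1
        refine (this.mono_set (Set.Ioi_subset_Ioi zero_le_one)).congr_fun (fun u hu => ?_)
          measurableSet_Ioi
        simp only [Set.indicator_of_mem hu, smul_eq_mul]
        rw [mul_comm]
        ring_nf
      have e3 := integral_sub i1 i2
      rw [e1, e2] at e3
      rw [← e3]
      refine setIntegral_congr_fun measurableSet_Ioi fun u _ => ?_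
      simp only [hh, divisorSum_eq_sum, sub_mul]
  rw [hcont]
  ring

/-! ### Dilated functions paired with the tent function -/

/-- The pairing of `u ↦ h (u / n)` with the tent function. -/
def tentMean (h : ℝ → ℂ) (x n : ℝ) : ℂ := ∫ u in Set.Ioi (0 : ℝ), h (u / n) * (tent x u : ℂ)

theorem tentMean_add {f g : ℝ → ℂ} (hf : IsTame f) (hg : IsTame g) {x n : ℝ} (hx : 1 ≤ x)
    (hn : 0 < n) : tentMean (fun u => f u + g u) x n = tentMean f x n + tentMean g x n := by
  simp only [tentMean, add_mul]
  exact integral_add (integrableOn_mul_tent hx (hf.comp_div hn).locallyIntegrableOn)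
    (integrableOn_mul_tent hx (hg.comp_div hn).locallyIntegrableOn)

theorem hasMellin_sum {ι : Type*} (S : Finset ι) {f : ι → ℝ → ℂ} {v : ι → ℂ} {s : ℂ}
    (hf : ∀ i ∈ S, HasMellin (f i) s (v i)) :
    HasMellin (fun u => ∑ i ∈ S, f i u) s (∑ i ∈ S, v i) := by
  classical
  induction S using Finset.induction_on with
  | empty => exact ⟨by simp [MellinConvergent], by simp [mellin]⟩
  | insert i S hi ih =>
    simp only [Finset.sum_insert hi]
    exact HasMellin.add (hf i (by simp)) (ih fun j hj => hf j (by simp [hj]))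

theorem hasMellin_comp_div_natCast_pow {h : ℝ → ℂ} {s v : ℂ} (hh : HasMellin h (-s) v) {m : ℕ}
    (hm : m ≠ 0) (c : ℕ) :
    HasMellin (fun u => h (u / (m : ℝ) ^ c)) (-s) ((m : ℂ) ^ (-(c * s)) * v) := by
  have hm0 : (0 : ℝ) < m := by exact_mod_cast Nat.pos_of_ne_zero hm
  have hp : 0 < ((m : ℝ) ^ c)⁻¹ := by positivity
  have heq : (fun u => h (u / (m : ℝ) ^ c)) = fun u => h (((m : ℝ) ^ c)⁻¹ * u) := by
    funext u
    rw [div_eq_inv_mul]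
  rw [heq]
  refine ⟨(MellinConvergent.comp_mul_left hp).2 hh.1, ?_⟩
  rw [mellin_comp_mul_left _ _ hp, hh.2, neg_neg, smul_eq_mul]
  congr 1
  have harg : ((m : ℂ) ^ c).arg ≠ Real.pi := by
    rw [← Nat.cast_pow, Complex.natCast_arg]
    exact Real.pi_ne_zero.symm
  push_cast
  rw [Complex.inv_cpow _ _ harg, Complex.cpow_neg, Complex.natCast_cpow_natCast_mul]

theorem one_add_abs_natCast_mul_rpow_le {n : ℕ} (hn : 1 ≤ n) {δ : ℝ} (hδ : 0 ≤ δ) (hδ1 : δ ≤ 1)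
    (t : ℝ) : (1 + |(n : ℝ) * t|) ^ δ ≤ n * (1 + |t|) ^ δ := by
  have hn1 : (1 : ℝ) ≤ n := by exact_mod_cast hn
  rw [abs_mul, abs_of_nonneg (by positivity : (0 : ℝ) ≤ n)]
  calc (1 + n * |t|) ^ δ ≤ (n * (1 + |t|)) ^ δ := by
        gcongr
        rw [mul_add]
        linarith
    _ = (n : ℝ) ^ δ * (1 + |t|) ^ δ := Real.mul_rpow (by positivity) (by positivity)
    _ ≤ n * (1 + |t|) ^ δ := by
        gcongr
        simpa using Real.rpow_le_rpow_of_exponent_le hn1 hδ1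

theorem one_div_norm_vertical_le {σ : ℝ} (hσ : 0 < σ) (t : ℝ) :
    1 / ‖(σ + t * Complex.I : ℂ)‖ ≤ (1 / σ + 1) * (1 + |t|) ^ (-1 : ℝ) := by
  have h1 : σ ≤ ‖(σ + t * Complex.I : ℂ)‖ := by
    simpa [abs_of_pos hσ] using Complex.abs_re_le_norm (σ + t * Complex.I : ℂ)
  have h2 : |t| ≤ ‖(σ + t * Complex.I : ℂ)‖ := by
    simpa using Complex.abs_im_le_norm (σ + t * Complex.I : ℂ)
  set z := ‖(σ + t * Complex.I : ℂ)‖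
  have hz : 0 < z := hσ.trans_le h1
  rw [Real.rpow_neg_one, ← div_eq_mul_inv, div_le_div_iff₀ hz (by positivity), one_mul, add_mul,
    one_mul]
  have : 1 ≤ 1 / σ * z := by
    rw [one_div, inv_mul_eq_div, one_le_div hσ]
    exact h1
  linarith

/-- The contribution of large `m`, for a function whose Mellin transform is
`ζ(as) ζ(bs) / s`. -/
theorem exists_norm_sum_Ioc_muPow_mul_tentMean_le (hRH : RiemannHypothesis) (k : ℕ) {a b c : ℕ}
    (ha : 1 ≤ a) (hb : 1 ≤ b) (hc : 1 ≤ c) {h : ℝ → ℂ} (hh : IsTame h) {σ ε : ℝ} (hε : 0 < ε)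
    (hε1 : ε ≤ 1) (hσ : 0 < σ) (hσ3 : σ ≤ 3) (haσ : 1 / 2 < a * σ) (haσ1 : a * σ ≠ 1)
    (hbσ : 1 / 2 < b * σ) (hbσ1 : b * σ ≠ 1) (hcσ : 1 / 2 + ε < c * σ)
    (hmel : ∀ t : ℝ, MellinConvergent h (-(σ + t * Complex.I)) ∧
      (t ≠ 0 → mellin h (-(σ + t * Complex.I)) = riemannZeta (a * (σ + t * Complex.I)) *
        riemannZeta (b * (σ + t * Complex.I)) / (σ + t * Complex.I))) :
    ∃ C : ℝ, 0 < C ∧ ∀ (x y : ℝ) (N : ℕ), 1 ≤ x → 1 ≤ y →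
      ‖∑ m ∈ Finset.Ioc ⌊y⌋₊ N, (muPow k m : ℂ) * tentMean h x ((m : ℝ) ^ c)‖ ≤
        C * (y ^ (1 / 2 + ε - c * σ) * x ^ (σ + 2 * ε)) := by
  -- `ζ(as)`, `ζ(bs)` and the tail of `ζ(cs)^(-k)` cost `(1+|t|)^(ε/3)` each; with `1/s` this makes
  -- the admissible `(1+|t|)^(ε-1)`.
  have hδ : 0 < ε / 3 := by linarith
  have hδ1 : ε / 3 ≤ 1 := by linarith
  obtain ⟨A, hA, hζa⟩ := exists_norm_riemannZeta_vertical_le hRH haσ haσ1 hδ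
  obtain ⟨B, hB, hζb⟩ := exists_norm_riemannZeta_vertical_le hRH hbσ hbσ1 hδ
  obtain ⟨D, hD, hg⟩ := exists_norm_sum_Ioc_muPow_le hRH k hδ hδ1 (σ := c * σ) (by linarith)
  obtain ⟨K, hK, hpair⟩ := exists_norm_integral_tentMellin_mul_le hε hε1
  have ha0 : (0 : ℝ) < a := by exact_mod_cast ha
  have hb0 : (0 : ℝ) < b := by exact_mod_cast hb
  have hc0 : (0 : ℝ) < c := by exact_mod_cast hc
  refine ⟨K * (A * a * (B * b) * (1 / σ + 1) * (D * c)), by positivity, fun x y N hx hy => ?_⟩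
  have hpos : ∀ m ∈ Finset.Ioc ⌊y⌋₊ N, m ≠ 0 := fun m hm => by
    have := (Finset.mem_Ioc.1 hm).1
    omega
  set G : ℝ → ℂ := fun u => ∑ m ∈ Finset.Ioc ⌊y⌋₊ N, (muPow k m : ℂ) * h (u / (m : ℝ) ^ c) with hG
  have hmean : ∑ m ∈ Finset.Ioc ⌊y⌋₊ N, (muPow k m : ℂ) * tentMean h x ((m : ℝ) ^ c) =
      ∫ u in Set.Ioi (0 : ℝ), G u * (tent x u : ℂ) := by
    simp only [hG, Finset.sum_mul]
    rw [integral_finsetSum]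
    · refine Finset.sum_congr rfl fun m _ => ?_
      simp only [mul_assoc]
      rw [integral_const_mul, tentMean]
    · intro m hm
      have hm0 : (0 : ℝ) < m := by exact_mod_cast Nat.pos_of_ne_zero (hpos m hm)
      exact integrableOn_mul_tent hx
        (((hh.comp_div (pow_pos hm0 c)).const_mul _).locallyIntegrableOn)
  -- Each dilation by `m^c` multiplies the transform by `m^(-cs)`, so the finite sum over `m`
  -- factors out as a Dirichlet polynomial.
  have hGm : ∀ t : ℝ, HasMellin G (-(σ + t * Complex.I))
      (∑ m ∈ Finset.Ioc ⌊y⌋₊ N, (muPow k m : ℂ) * ((m : ℂ) ^ (-(c * (σ + t * Complex.I))) *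
        mellin h (-(σ + t * Complex.I)))) := fun t =>
    hasMellin_sum _ fun m hm =>
      (hasMellin_comp_div_natCast_pow ⟨(hmel t).1, rfl⟩ (hpos m hm) c).const_mul _
  rw [hmean, integral_mul_tent hx hσ hσ3 (by simpa using (hGm 0).1)]
  refine (norm_one_div_two_pi_mul_le _).trans ?_
  refine (hpair x σ (A * a * (B * b) * (1 / σ + 1) * (D * c * y ^ (1 / 2 + ε - c * σ))) _ hx hσ hσ3
    (by positivity) fun t ht => ?_).trans (le_of_eq (by ring))
  have e1 : mellin G (-(σ + t * Complex.I)) =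
      riemannZeta (((a * σ : ℝ) : ℂ) + ((a * t : ℝ) : ℂ) * Complex.I) *
        riemannZeta (((b * σ : ℝ) : ℂ) + ((b * t : ℝ) : ℂ) * Complex.I) *
          (1 / (σ + t * Complex.I)) *
        ∑ m ∈ Finset.Ioc ⌊y⌋₊ N, (muPow k m : ℂ) *
          (m : ℂ) ^ (-(((c * σ : ℝ) : ℂ) + ((c * t : ℝ) : ℂ) * Complex.I)) := by
    rw [(hGm t).2, (hmel t).2 ht, Finset.mul_sum]
    refine Finset.sum_congr rfl fun m _ => ?_
    push_cast
    simp only [mul_add, mul_assoc]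
    ring
  have f1 := (hζa (a * t)).trans
    (mul_le_mul_of_nonneg_left (one_add_abs_natCast_mul_rpow_le ha hδ.le hδ1 t) hA.le)
  have f2 := (hζb (b * t)).trans
    (mul_le_mul_of_nonneg_left (one_add_abs_natCast_mul_rpow_le hb hδ.le hδ1 t) hB.le)
  have f3 := one_div_norm_vertical_le hσ t
  have f4 := hg y (c * t) N hy
  have f5 : D * y ^ (1 / 2 + ε / 3 - c * σ) * (1 + |c * t|) ^ (ε / 3) ≤
      D * y ^ (1 / 2 + ε - c * σ) * (c * (1 + |t|) ^ (ε / 3)) := by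
    gcongr
    · linarith
    · exact one_add_abs_natCast_mul_rpow_le hc hδ.le hδ1 t
  have hexp : (1 + |t|) ^ (ε - 1) = (1 + |t|) ^ (ε / 3) * (1 + |t|) ^ (ε / 3) *
      (1 + |t|) ^ (-1 : ℝ) * (1 + |t|) ^ (ε / 3) := by
    rw [← Real.rpow_add (by positivity), ← Real.rpow_add (by positivity),
      ← Real.rpow_add (by positivity)]
    congr 1
    ring
  rw [e1, norm_mul, norm_mul, norm_mul, norm_div, norm_one, hexp]
  calc _ ≤ A * (a * (1 + |t|) ^ (ε / 3)) * (B * (b * (1 + |t|) ^ (ε / 3))) *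
        ((1 / σ + 1) * (1 + |t|) ^ (-1 : ℝ)) *
          (D * y ^ (1 / 2 + ε - c * σ) * (c * (1 + |t|) ^ (ε / 3))) := by
        gcongr
        exact f4.trans f5
    _ = _ := by ring

/-- The contribution of small `m`. -/
theorem exists_norm_sum_Ioc_zero_muPow_mul_tentMean_le (k c : ℕ) {h : ℝ → ℂ} {A β η : ℝ}
    (hA : 0 ≤ A) (hβ : 0 ≤ β) (hη : 0 < η) (hcβ : c * β ≤ 1 + η)
    (hh : ∀ v : ℝ, 1 ≤ v → ‖h v‖ ≤ A * v ^ β) :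
    ∃ C : ℝ, 0 ≤ C ∧ ∀ x y : ℝ, 1 ≤ x → 1 ≤ y → y ^ c ≤ x →
      ‖∑ m ∈ Finset.Ioc 0 ⌊y⌋₊, (muPow k m : ℂ) * tentMean h x ((m : ℝ) ^ c)‖ ≤
        C * (x ^ β * y ^ (1 + η - c * β)) := by
  have hsum := muPow_summable_rpow k (σ := 1 + η) (by linarith)
  set S := ∑' m : ℕ, |(muPow k m : ℝ)| * (m : ℝ) ^ (-(1 + η)) with hS
  have hS0 : 0 ≤ S := tsum_nonneg fun m => by positivity
  refine ⟨2 * A * 3 ^ β * S, by positivity, fun x y hx hy hyx => ?_⟩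
  have hterm : ∀ m ∈ Finset.Ioc 0 ⌊y⌋₊, ‖(muPow k m : ℂ) * tentMean h x ((m : ℝ) ^ c)‖ ≤
      2 * A * 3 ^ β * (x ^ β * y ^ (1 + η - c * β)) *
        (|(muPow k m : ℝ)| * (m : ℝ) ^ (-(1 + η))) := by
    intro m hm
    obtain ⟨hm0, hmy⟩ := Finset.mem_Ioc.1 hm
    have hm0' : (0 : ℝ) < m := by exact_mod_cast hm0
    have hmy' : (m : ℝ) ≤ y := (Nat.cast_le.2 hmy).trans (Nat.floor_le (by linarith))
    have hmc : (m : ℝ) ^ c ≤ x := (pow_le_pow_left₀ hm0'.le hmy' c).trans hyx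
    have hb : ‖tentMean h x ((m : ℝ) ^ c)‖ ≤ 2 * (A * ((3 * x) ^ β * (m : ℝ) ^ (-(c * β)))) := by
      refine norm_integral_mul_tent_le hx fun u hu => ?_
      have hu0 : 0 ≤ u := by linarith [hu.1]
      -- `m^c ≤ y^c ≤ x ≤ u` keeps the argument `u/m^c` at least `1`, where the power bound on `h`
      -- holds.
      refine (hh _ ((one_le_div (by positivity)).2 (hmc.trans hu.1))).trans ?_
      rw [Real.div_rpow hu0 (by positivity), ← Real.rpow_natCast, ← Real.rpow_mul hm0'.le,
        div_eq_mul_inv, ← Real.rpow_neg hm0'.le]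
      gcongr
      linarith [hu.2]
    -- Rankin's trick: the excess power of `m`, nonnegative by `hcβ`, is replaced by the same power
    -- of `y`, leaving an absolutely convergent series.
    have hpow : (m : ℝ) ^ (-(c * β)) ≤ y ^ (1 + η - c * β) * (m : ℝ) ^ (-(1 + η)) := by
      calc (m : ℝ) ^ (-(c * β)) = (m : ℝ) ^ (1 + η - c * β) * (m : ℝ) ^ (-(1 + η)) := by
            rw [← Real.rpow_add hm0']
            congr 1
            ring
        _ ≤ _ := by gcongr
    rw [norm_mul, Complex.norm_intCast]
    calc _ ≤ |(muPow k m : ℝ)| * (2 * (A * ((3 * x) ^ β *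
          (y ^ (1 + η - c * β) * (m : ℝ) ^ (-(1 + η)))))) := by
          gcongr
          exact hb.trans (by gcongr)
      _ = _ := by
          rw [Real.mul_rpow (by norm_num) (by linarith)]
          ring
  refine (norm_sum_le_of_le _ hterm).trans ?_
  rw [← Finset.mul_sum]
  calc _ ≤ 2 * A * 3 ^ β * (x ^ β * y ^ (1 + η - c * β)) * S := by
        have : 0 ≤ x ^ β * y ^ (1 + η - c * β) :=
          mul_nonneg (Real.rpow_nonneg (by linarith) _) (Real.rpow_nonneg (by linarith) _)
        gcongr
        exact hsum.sum_le_tsum _ fun m _ => by positivity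
    _ = _ := by ring

/-- The contribution of a power function from large `m`. -/
theorem exists_norm_sum_Ioc_muPow_mul_tentMean_rpow_le (hRH : RiemannHypothesis) (k : ℕ) {c : ℕ}
    {γ ε : ℝ} (hγ : 0 ≤ γ) (hε : 0 < ε) (hε1 : ε ≤ 1) (hcγ : 1 / 2 + ε < c * γ) :
    ∃ C : ℝ, 0 < C ∧ ∀ (x y : ℝ) (N : ℕ), 1 ≤ x → 1 ≤ y →
      ‖∑ m ∈ Finset.Ioc ⌊y⌋₊ N, (muPow k m : ℂ) *
        tentMean (fun u => ((u ^ γ : ℝ) : ℂ)) x ((m : ℝ) ^ c)‖ ≤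
          C * (y ^ (1 / 2 + ε - c * γ) * x ^ γ) := by
  obtain ⟨C, hC, hg⟩ := exists_norm_sum_Ioc_muPow_le hRH k hε hε1 hcγ
  refine ⟨2 * 3 ^ γ * C, by positivity, fun x y N hx hy => ?_⟩
  set P : ℂ := ∫ u in Set.Ioi (0 : ℝ), ((u ^ γ : ℝ) : ℂ) * (tent x u : ℂ) with hP
  have hPb : ‖P‖ ≤ 2 * (3 * x) ^ γ := by
    refine norm_integral_mul_tent_le hx fun u hu => ?_
    have hu0 : 0 ≤ u := by linarith [hu.1]
    rw [Complex.norm_real, Real.norm_eq_abs, abs_of_nonneg (by positivity)]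
    gcongr
    linarith [hu.2]
  have hsum : ∑ m ∈ Finset.Ioc ⌊y⌋₊ N, (muPow k m : ℂ) *
        tentMean (fun u => ((u ^ γ : ℝ) : ℂ)) x ((m : ℝ) ^ c) =
      (∑ m ∈ Finset.Ioc ⌊y⌋₊ N, (muPow k m : ℂ) *
        (m : ℂ) ^ (-(((c * γ : ℝ) : ℂ) + ((0 : ℝ) : ℂ) * Complex.I))) * P := by
    rw [Finset.sum_mul]
    refine Finset.sum_congr rfl fun m _ => ?_
    rw [mul_assoc]
    congr 1
    rw [hP, tentMean, ← integral_const_mul]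
    refine setIntegral_congr_fun measurableSet_Ioi fun u hu => ?_
    have hu0 : (0 : ℝ) ≤ u := le_of_lt hu
    have : ((u / (m : ℝ) ^ c) ^ γ : ℝ) = (m : ℝ) ^ (-(c * γ)) * u ^ γ := by
      rw [Real.div_rpow hu0 (by positivity), ← Real.rpow_natCast, ← Real.rpow_mul (by positivity),
        div_eq_inv_mul, ← Real.rpow_neg (by positivity)]
    simp only [this]
    rw [Complex.ofReal_mul, Complex.ofReal_cpow (by positivity)]
    push_cast
    simp only [zero_mul, add_zero]
    ring
  rw [hsum, norm_mul]
  calc _ ≤ C * y ^ (1 / 2 + ε - c * γ) * (1 + |(0 : ℝ)|) ^ ε * (2 * (3 * x) ^ γ) := by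
        gcongr
        exact hg y 0 N hy
    _ = _ := by
        rw [Real.mul_rpow (by norm_num) (by linarith)]
        simp
        ring

/-- Termwise pairing of `∑ μ_k(m) h(u / m^c)` with the tent function. -/
theorem hasSum_muPow_mul_tentMean (k c : ℕ) {h : ℝ → ℂ} {F : ℝ → ℂ} {β : ℝ} (hh : IsTame h)
    (hβ : 0 ≤ β) (hcβ : 1 < c * β)
    (hbd : ∀ V : ℝ, ∃ C : ℝ, ∀ v : ℝ, 0 < v → v ≤ V → ‖h v‖ ≤ C * v ^ β)
    (hF : ∀ u : ℝ, 0 < u → HasSum (fun m : ℕ => (muPow k m : ℂ) * h (u / (m : ℝ) ^ c)) (F u))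
    {x : ℝ} (hx : 1 ≤ x) :
    HasSum (fun m : ℕ => (muPow k m : ℂ) * tentMean h x ((m : ℝ) ^ c))
      (∫ u in Set.Ioi (0 : ℝ), F u * (tent x u : ℂ)) := by
  obtain ⟨C, hC⟩ := hbd (x + 2)
  set Φ : ℕ → ℝ → ℂ := fun m u => (muPow k m : ℂ) * h (u / (m : ℝ) ^ c) * (tent x u : ℂ) with hΦ
  have hint : ∀ m, IntegrableOn (Φ m) (Set.Ioi 0) := by
    intro m
    rcases eq_or_ne m 0 with rfl | hm
    · simp [hΦ]
    · have hm0 : (0 : ℝ) < m := by exact_mod_cast Nat.pos_of_ne_zero hm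
      exact integrableOn_mul_tent hx
        (((hh.comp_div (pow_pos hm0 c)).const_mul _).locallyIntegrableOn)
  -- The majorant `m^(-cβ)` is summable against `|μ_k|` since `cβ > 1`, which justifies
  -- interchanging sum and integral.
  have hnorm : ∀ m, ∫ u in Set.Ioi (0 : ℝ), ‖Φ m u‖ ≤
      2 * |C| * (x + 2) ^ β * (|(muPow k m : ℝ)| * (m : ℝ) ^ (-(c * β))) := by
    intro m
    rcases eq_or_ne m 0 with rfl | hm
    · simp [hΦ]
    have hm0 : (0 : ℝ) < m := by exact_mod_cast Nat.pos_of_ne_zero hm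
    have hm1 : (1 : ℝ) ≤ (m : ℝ) ^ c := one_le_pow₀ (by exact_mod_cast Nat.pos_of_ne_zero hm)
    have h1 : ((∫ u in Set.Ioi (0 : ℝ), ‖Φ m u‖ : ℝ) : ℂ) = ∫ u in Set.Ioi (0 : ℝ),
        (‖(muPow k m : ℂ) * h (u / (m : ℝ) ^ c)‖ : ℂ) * (tent x u : ℂ) := by
      rw [← integral_complex_ofReal]
      refine integral_congr_ae ?_
      filter_upwards with u
      simp only [hΦ]
      rw [norm_mul _ (tent x u : ℂ), Complex.norm_real, Real.norm_eq_abs,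
        abs_of_nonneg (tent_nonneg _ _), Complex.ofReal_mul]
    have h2 : ‖((∫ u in Set.Ioi (0 : ℝ), ‖Φ m u‖ : ℝ) : ℂ)‖ ≤
        2 * (|(muPow k m : ℝ)| * (|C| * ((x + 2) ^ β * (m : ℝ) ^ (-(c * β))))) := by
      rw [h1]
      refine norm_integral_mul_tent_le hx fun u hu => ?_
      have hu0 : 0 < u := by linarith [hu.1]
      rw [Complex.norm_real, norm_norm, norm_mul, Complex.norm_intCast]
      gcongr
      have hle : u / (m : ℝ) ^ c ≤ x + 2 := (div_le_self hu0.le hm1).trans hu.2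
      refine (hC _ (by positivity) hle).trans ?_
      rw [Real.div_rpow hu0.le (by positivity), ← Real.rpow_natCast, ← Real.rpow_mul hm0.le,
        div_eq_mul_inv, ← Real.rpow_neg hm0.le]
      gcongr
      · exact le_abs_self C
      · exact hu.2
    rw [Complex.norm_real] at h2
    refine (le_abs_self _).trans (h2.trans (le_of_eq (by ring)))
  have hsum : Summable fun m => ∫ u in Set.Ioi (0 : ℝ), ‖Φ m u‖ :=
    Summable.of_nonneg_of_le (fun m => integral_nonneg fun u => norm_nonneg _) hnorm
      ((muPow_summable_rpow k hcβ).mul_left _)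
  have hI := hasSum_integral_of_summable_integral_norm hint hsum
  have e1 : ∀ m, ∫ u in Set.Ioi (0 : ℝ), Φ m u =
      (muPow k m : ℂ) * tentMean h x ((m : ℝ) ^ c) := by
    intro m
    simp only [hΦ, mul_assoc]
    rw [integral_const_mul, tentMean]
  have e2 : ∫ u in Set.Ioi (0 : ℝ), ∑' m, Φ m u =
      ∫ u in Set.Ioi (0 : ℝ), F u * (tent x u : ℂ) :=
    setIntegral_congr_fun measurableSet_Ioi fun u hu => ((hF u hu).mul_right _).tsum_eq
  simpa only [e1, e2] using hI

/-! ### The error terms -/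

theorem isTame_divisorError {a b : ℕ} (ha : 1 ≤ a) (hb : 1 ≤ b) : IsTame (divisorError a b) := by
  obtain ⟨p, q, r, -, h⟩ := exists_divisorMain_eq a b
  have ha0 : (0 : ℝ) < a := by exact_mod_cast ha
  have hb0 : (0 : ℝ) < b := by exact_mod_cast hb
  have := (isTame_divisorSum a b).sub
    (isTame_mainTerm p q r (one_div_pos.2 ha0) (one_div_pos.2 hb0))
  simpa only [← h] using! this

/-- For `v < 1` the error is minus the main term, which decays faster than `v^β` at the origin. This
controls the terms with `m^c > x`. -/
theorem exists_norm_divisorError_le_of_le {a b : ℕ} (ha : 1 ≤ a) (hab : a ≤ b) {β : ℝ}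
    (hβ : 0 ≤ β) (hβb : β < 1 / (b : ℝ)) (V : ℝ) :
    ∃ C : ℝ, ∀ v : ℝ, 0 < v → v ≤ V → ‖divisorError a b v‖ ≤ C * v ^ β := by
  obtain ⟨p, q, r, -, h⟩ := exists_divisorMain_eq a b
  have ha0 : (0 : ℝ) < a := by exact_mod_cast ha
  have hβa : β < 1 / (a : ℝ) := hβb.trans_le
    (one_div_le_one_div_of_le ha0 (by exact_mod_cast hab))
  obtain ⟨A, hA⟩ := exists_norm_mainTerm_le_of_le_one p q r hβa hβb
  obtain ⟨B, hB⟩ := (isTame_divisorError ha (ha.trans hab)).bounded V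
  refine ⟨max A |B|, fun v h0 hV => ?_⟩
  rcases lt_or_ge v 1 with h1 | h1
  · rw [divisorError, divisorSum_eq_zero h1, h]
    simp only [Nat.cast_zero, zero_sub, norm_neg]
    refine (hA v h0 h1.le).trans ?_
    gcongr
    exact le_max_left _ _
  · calc ‖divisorError a b v‖ ≤ B := hB v h0 hV
      _ ≤ max A |B| * 1 := by
          rw [mul_one]
          exact (le_abs_self B).trans (le_max_right _ _)
      _ ≤ _ := by
          gcongr
          exact Real.one_le_rpow h1 hβ

theorem IsTame.exists_norm_le_rpow {h : ℝ → ℂ} (hh : IsTame h) {β : ℝ} (hβ : 0 ≤ β)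
    (hO : h =O[atTop] fun u : ℝ => u ^ β) :
    ∃ A : ℝ, 0 ≤ A ∧ ∀ v : ℝ, 1 ≤ v → ‖h v‖ ≤ A * v ^ β := by
  obtain ⟨C, hC⟩ := hO.bound
  obtain ⟨X, hX⟩ := eventually_atTop.1 hC
  obtain ⟨B, hB⟩ := hh.bounded X
  refine ⟨max |C| |B|, (abs_nonneg _).trans (le_max_left _ _), fun v hv => ?_⟩
  have hv0 : 0 < v := by linarith
  rcases le_total X v with h1 | h1
  · refine (hX v h1).trans ?_
    rw [Real.norm_eq_abs, abs_of_nonneg (by positivity)]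
    gcongr
    exact (le_abs_self C).trans (le_max_left _ _)
  · calc ‖h v‖ ≤ B := hB v hv0 h1
      _ ≤ max |C| |B| * 1 := by
          rw [mul_one]
          exact (le_abs_self B).trans (le_max_right _ _)
      _ ≤ _ := by
          gcongr
          exact Real.one_le_rpow hv hβ

/-- Smoothing is nearly free: `[x, x+2]` contains at most two new integers, whose coefficients are
`≪ x^ε`, and the main term varies as little. -/
theorem exists_norm_fError_sub_integral_le (k : ℕ) {a b c : ℕ} (ha : 1 ≤ a) (hb : 1 ≤ b)
    (hc : 1 ≤ c) {ε : ℝ} (hε : 0 < ε) :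
    ∃ C : ℝ, 0 ≤ C ∧ ∀ x : ℝ, 1 ≤ x →
      ‖fError k a b c x - ∫ u in Set.Ioi (0 : ℝ), fError k a b c u * (tent x u : ℂ)‖ ≤
        C * x ^ ε := by
  obtain ⟨A, hA, hf⟩ := fCoeff_isSubpolynomial k ha hb hc ε hε
  obtain ⟨p, q, r, h⟩ := exists_fMain_eq k a b c
  have ha1 : (1 : ℝ) ≤ a := by exact_mod_cast ha
  have hb1 : (1 : ℝ) ≤ b := by exact_mod_cast hb
  have hinv : ∀ z : ℝ, 1 ≤ z → 0 < 1 / z ∧ 1 / z ≤ 1 := fun z hz =>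
    ⟨one_div_pos.2 (by linarith), (div_le_one (by linarith)).2 hz⟩
  obtain ⟨B, hB, hm⟩ := exists_norm_mainTerm_sub_le p q r (hinv a ha1).1.le (hinv a ha1).2
    (hinv b hb1).1.le (hinv b hb1).2 hε
  have heq : ∀ u, fError k a b c u = ∑ n ∈ Finset.Icc 1 ⌊u⌋₊, (fCoeff k a b c n : ℂ) -
      mainTerm p q r (1 / (a : ℝ)) (1 / (b : ℝ)) u := by
    intro u
    rw [fError, h, fSum]
    push_cast
    rfl
  have htame : IsTame (fError k a b c) := by
    have := (isTame_sum_Icc fun n => (fCoeff k a b c n : ℂ)).sub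
      (isTame_mainTerm p q r (hinv a ha1).1 (hinv b hb1).1)
    simpa only [← heq] using! this
  refine ⟨2 * (2 * A * 3 ^ ε + B), by positivity, fun x hx => ?_⟩
  refine (norm_sub_integral_mul_tent_le (B := (2 * A * 3 ^ ε + B) * x ^ ε) hx
    htame.locallyIntegrableOn fun u hu => ?_).trans (le_of_eq (by ring))
  have e1 := norm_sum_Icc_sub_le (f := fun n => (fCoeff k a b c n : ℂ)) hε.le hA.le
    (fun n hn => by simpa [Complex.norm_intCast] using hf n hn) (by linarith : 0 ≤ x) hu.1 hu.2
  have e2 := hm x u hx hu.1 hu.2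
  have e3 : (x + 2) ^ ε ≤ 3 ^ ε * x ^ ε := by
    rw [← Real.mul_rpow (by norm_num) (by linarith)]
    gcongr
    linarith
  rw [heq, heq, sub_sub_sub_comm]
  calc _ ≤ 2 * A * (x + 2) ^ ε + B * x ^ ε := (norm_sub_le _ _).trans (add_le_add e1 e2)
    _ ≤ 2 * A * (3 ^ ε * x ^ ε) + B * x ^ ε := by gcongr
    _ = _ := by ring

theorem hasSum_muPow_mul_tentMean_divisorError (k : ℕ) {a b c : ℕ} (ha : 1 ≤ a) (hab : a ≤ b)
    (hbc : b < c) {x : ℝ} (hx : 1 ≤ x) :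
    HasSum (fun m : ℕ => (muPow k m : ℂ) * tentMean (divisorError a b) x ((m : ℝ) ^ c))
      (∫ u in Set.Ioi (0 : ℝ), fError k a b c u * (tent x u : ℂ)) := by
  have hb0 : (0 : ℝ) < b := by exact_mod_cast (ha.trans hab)
  have hbc' : (b : ℝ) < c := by exact_mod_cast hbc
  have hc0 : (0 : ℝ) < c := hb0.trans hbc'
  -- `β > 1/c` makes the sum over `m` converge, and `β < 1/b` is what the decay of `Δ` at the origin
  -- allows.
  obtain ⟨β, h1, h2⟩ := exists_between (one_div_lt_one_div_of_lt hb0 hbc')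
  have hβ : 0 ≤ β := (one_div_pos.2 hc0).le.trans h1.le
  refine hasSum_muPow_mul_tentMean k c (isTame_divisorError ha (ha.trans hab)) hβ ?_
    (exists_norm_divisorError_le_of_le ha hab hβ h2)
    (fun u hu => hasSum_muPow_mul_divisorError k ha hab hbc hu) hx
  rwa [div_lt_iff₀' hc0] at h1

/-- Splitting the sum over `m` at `y`. -/
theorem norm_integral_fError_mul_tent_le (k : ℕ) {a b c : ℕ} (ha : 1 ≤ a) (hab : a ≤ b)
    (hbc : b < c) {x y P Q : ℝ} (hx : 1 ≤ x)
    (hP : ‖∑ m ∈ Finset.Ioc 0 ⌊y⌋₊, (muPow k m : ℂ) *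
      tentMean (divisorError a b) x ((m : ℝ) ^ c)‖ ≤ P)
    (hQ : ∀ N : ℕ, ‖∑ m ∈ Finset.Ioc ⌊y⌋₊ N, (muPow k m : ℂ) *
      tentMean (divisorError a b) x ((m : ℝ) ^ c)‖ ≤ Q) :
    ‖∫ u in Set.Ioi (0 : ℝ), fError k a b c u * (tent x u : ℂ)‖ ≤ P + Q := by
  have h := (hasSum_muPow_mul_tentMean_divisorError k ha hab hbc hx).tendsto_sum_nat
  have h' := ((tendsto_add_atTop_iff_nat 1).2 h).norm
  -- The tail bound is uniform in `N`, so it survives the limit even though the estimate is for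
  -- conditionally cancelling partial sums.
  refine le_of_tendsto h' ?_
  filter_upwards [eventually_ge_atTop ⌊y⌋₊] with N hN
  have e1 : ∀ f : ℕ → ℂ, f 0 = 0 → ∑ m ∈ Finset.range (N + 1), f m =
      ∑ m ∈ Finset.Ioc 0 ⌊y⌋₊, f m + ∑ m ∈ Finset.Ioc ⌊y⌋₊ N, f m := by
    intro f hf
    rw [Finset.sum_Ioc_consecutive _ (Nat.zero_le _) hN, Finset.sum_range_succ', hf, add_zero,
      Finset.range_eq_Ico, Finset.sum_Ico_add' f 0 N 1]
    rfl
  rw [e1 _ (by simp)]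
  exact (norm_add_le _ _).trans (add_le_add hP (hQ N))

/-- Both ranges of `b` are treated at once: `h` is the part of `Δ` whose Mellin transform converges
on `Re s = 1/(2a) + ε`, and `q` is the coefficient of the split-off power `u^(1/b)`, nonzero only if
`b ≥ 2a`. -/
theorem fError_isBigO (hRH : RiemannHypothesis) (k : ℕ) {a b c : ℕ} (ha : 1 ≤ a)
    (hab : a ≤ b) (hbc : b < c) {α ε : ℝ} (hα0 : 0 < α) (haα : 2 * a * α < 1)
    (hα : HasErrorExponent (divisorError a b) α) (hε : 0 < ε) (hε2 : ε ≤ 1 / 2)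
    (hεc : c * ε ≤ 1 - c * α) (hεa : ε < 1 / (2 * a)) {h : ℝ → ℂ} {q : ℂ}
    (hdec : ∀ u, divisorError a b u = h u + q * ((u ^ (1 / (b : ℝ)) : ℝ) : ℂ)) (hh : IsTame h)
    (hmel : ∀ t : ℝ, MellinConvergent h (-((1 / (2 * a) + ε : ℝ) + t * Complex.I)) ∧
      (t ≠ 0 → mellin h (-((1 / (2 * a) + ε : ℝ) + t * Complex.I)) =
        riemannZeta (a * ((1 / (2 * a) + ε : ℝ) + t * Complex.I)) *
        riemannZeta (b * ((1 / (2 * a) + ε : ℝ) + t * Complex.I)) /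
          ((1 / (2 * a) + ε : ℝ) + t * Complex.I)))
    (hbσ : b * (1 / (2 * a) + ε) ≠ 1) (hq : q = 0 ∨ 2 * a ≤ b) :
    fError k a b c =O[atTop]
      fun x : ℝ => x ^ ((1 - a * α) / (a + c - 2 * a * c * α) + 3 * ε) := by
  have hb := ha.trans hab
  have hc : 1 ≤ c := hb.trans hbc.le
  have ha1 : (1 : ℝ) ≤ a := by exact_mod_cast ha
  have hab' : (a : ℝ) ≤ b := by exact_mod_cast hab
  have hbc' : (b : ℝ) < c := by exact_mod_cast hbc
  have ha0 : (0 : ℝ) < a := by linarith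
  have hb0 : (0 : ℝ) < b := by linarith
  have hc0 : (0 : ℝ) < c := by linarith
  set D : ℝ := a + c - 2 * a * c * α with hD
  have hD0 : 0 < D := by
    have : 0 < c * (1 - 2 * a * α) := mul_pos hc0 (by linarith)
    rw [hD]
    linarith
  -- The solution of `α + ρ(1 - cα) = 1/(2a) + ρ(1/2 - c/(2a))`, where small and large `m` balance.
  -- The common value is `θ`, as `hhead` and `htail` record.
  set ρ : ℝ := (1 - 2 * a * α) / D with hρ
  set θ : ℝ := (1 - a * α) / D with hθ
  set σ : ℝ := 1 / (2 * a) + ε with hσ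
  have hρ0 : 0 ≤ ρ := div_nonneg (by linarith) hD0.le
  -- Hence `cρ < 1`, so that `y^c ≤ x`, as the estimate for small `m` requires.
  have hcρ : c * ρ = 1 - a / D := by
    rw [hρ, eq_sub_iff_add_eq]
    field_simp
    rw [hD]
    ring
  have haD : 0 < a / D := div_pos ha0 hD0
  have hρ1 : ρ ≤ 1 := by nlinarith
  have hθ0 : 0 ≤ θ := div_nonneg (by nlinarith) hD0.le
  have hhead : α + ρ * (1 - c * α) = θ := by
    rw [hρ, hθ]
    field_simp
    rw [hD]
    ring
  have htail : 1 / (2 * a) + ρ * (1 / 2 - c * (1 / (2 * a))) = θ := by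
    rw [hρ, hθ]
    field_simp
    rw [hD]
    ring
  have hhalf : 1 / (2 * (a : ℝ)) ≤ 1 / 2 := by
    rw [div_le_div_iff₀ (by positivity) (by norm_num)]
    linarith
  have hhalf0 : 0 < 1 / (2 * (a : ℝ)) := by positivity
  have haσ : a * σ = 1 / 2 + a * ε := by
    rw [hσ]
    field_simp
  have haε : a * ε < 1 / 2 := by
    rw [lt_div_iff₀ (by positivity)] at hεa
    linarith
  have haε0 : 0 < a * ε := mul_pos ha0 hε
  have hσ0 : 0 < σ := by rw [hσ]; linarith
  have hbσ2 : 1 / 2 < b * σ := by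
    have : a * σ ≤ b * σ := by gcongr
    linarith
  have hcσ : 1 / 2 + ε < c * σ := by
    have h1 : (a + 1) * σ ≤ c * σ := by
      gcongr
      exact_mod_cast (hab.trans_lt hbc : a < c)
    have h2 : ε < σ := by rw [hσ]; linarith
    linarith
  have hcε : ρ * ((c - 1) * ε) ≥ 0 := mul_nonneg hρ0 (mul_nonneg (by linarith) hε.le)
  have hA := (isTame_divisorError ha hb).exists_norm_le_rpow (by linarith : 0 ≤ α + ε) (hα ε hε)
  obtain ⟨A, hA0, hA⟩ := hA
  obtain ⟨C₁, hC₁, h₁⟩ := exists_norm_fError_sub_integral_le k ha hb hc hε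
  obtain ⟨C₂, hC₂, h₂⟩ := exists_norm_sum_Ioc_zero_muPow_mul_tentMean_le k c hA0
    (by linarith : 0 ≤ α + ε) hε (by linarith) hA
  obtain ⟨C₃, hC₃, h₃⟩ := exists_norm_sum_Ioc_muPow_mul_tentMean_le hRH k ha hb hc hh hε
    (by linarith) hσ0 (by rw [hσ]; linarith) (by linarith) (by linarith) hbσ2 hbσ hcσ hmel
  obtain ⟨C₄, hC₄, h₄⟩ := exists_norm_sum_Ioc_muPow_mul_tentMean_rpow_le hRH k (c := c)
    (γ := 1 / b) (by positivity) hε (by linarith) (by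
      have : 1 < c * (1 / (b : ℝ)) := by
        rw [mul_one_div, one_lt_div hb0]
        exact hbc'
      linarith)
  refine IsBigO.of_bound (C₁ + (C₂ + (C₃ + ‖q‖ * C₄))) ?_
  filter_upwards [eventually_ge_atTop 1] with x hx
  have hx0 : 0 < x := by linarith
  set y := x ^ ρ with hy
  have hy1 : 1 ≤ y := Real.one_le_rpow hx hρ0
  have hyc : y ^ c ≤ x := by
    rw [hy, ← Real.rpow_natCast, ← Real.rpow_mul hx0.le]
    calc x ^ (ρ * c) ≤ x ^ (1 : ℝ) := Real.rpow_le_rpow_of_exponent_le hx (by linarith)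
      _ = x := Real.rpow_one x
  have hyx : ∀ u v : ℝ, v + ρ * u ≤ θ + 3 * ε → y ^ u * x ^ v ≤ x ^ (θ + 3 * ε) := by
    intro u v huv
    rw [hy, ← Real.rpow_mul hx0.le, ← Real.rpow_add hx0]
    exact Real.rpow_le_rpow_of_exponent_le hx (by linarith)
  have hP : ‖∑ m ∈ Finset.Ioc 0 ⌊y⌋₊, (muPow k m : ℂ) *
      tentMean (divisorError a b) x ((m : ℝ) ^ c)‖ ≤ C₂ * x ^ (θ + 3 * ε) := by
    refine (h₂ x y hx hy1 hyc).trans ?_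
    gcongr
    rw [mul_comm]
    refine hyx _ _ ?_
    have : α + ε + ρ * (1 + ε - c * (α + ε)) =
        (α + ρ * (1 - c * α)) + ε - ρ * ((c - 1) * ε) := by ring
    rw [this, hhead]
    linarith
  have hQ : ∀ N : ℕ, ‖∑ m ∈ Finset.Ioc ⌊y⌋₊ N, (muPow k m : ℂ) *
      tentMean (divisorError a b) x ((m : ℝ) ^ c)‖ ≤ (C₃ + ‖q‖ * C₄) * x ^ (θ + 3 * ε) := by
    intro N
    have hsplit : ∑ m ∈ Finset.Ioc ⌊y⌋₊ N, (muPow k m : ℂ) *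
        tentMean (divisorError a b) x ((m : ℝ) ^ c) =
        ∑ m ∈ Finset.Ioc ⌊y⌋₊ N, (muPow k m : ℂ) * tentMean h x ((m : ℝ) ^ c) +
        q * ∑ m ∈ Finset.Ioc ⌊y⌋₊ N, (muPow k m : ℂ) *
          tentMean (fun u => ((u ^ (1 / (b : ℝ)) : ℝ) : ℂ)) x ((m : ℝ) ^ c) := by
      rw [Finset.mul_sum, ← Finset.sum_add_distrib]
      refine Finset.sum_congr rfl fun m hm => ?_
      have hm0 : (0 : ℝ) < m := by
        have := (Finset.mem_Ioc.1 hm).1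
        exact_mod_cast (Nat.zero_le _).trans_lt this
      have hγ := isTame_rpow (γ := 1 / (b : ℝ)) (by positivity)
      have e1 : divisorError a b = fun u => h u + q * ((u ^ (1 / (b : ℝ)) : ℝ) : ℂ) :=
        funext hdec
      have e2 : tentMean (fun u => q * ((u ^ (1 / (b : ℝ)) : ℝ) : ℂ)) x ((m : ℝ) ^ c) =
          q * tentMean (fun u => ((u ^ (1 / (b : ℝ)) : ℝ) : ℂ)) x ((m : ℝ) ^ c) := by
        simp only [tentMean, mul_assoc]
        rw [integral_const_mul]
      rw [e1, tentMean_add hh (hγ.const_mul q) hx (pow_pos hm0 c), e2]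
      ring
    have hT : ‖∑ m ∈ Finset.Ioc ⌊y⌋₊ N, (muPow k m : ℂ) * tentMean h x ((m : ℝ) ^ c)‖ ≤
        C₃ * x ^ (θ + 3 * ε) := by
      refine (h₃ x y N hx hy1).trans ?_
      gcongr
      refine hyx _ _ ?_
      have : σ + 2 * ε + ρ * (1 / 2 + ε - c * σ) =
          (1 / (2 * a) + ρ * (1 / 2 - c * (1 / (2 * a)))) + 3 * ε - ρ * ((c - 1) * ε) := by
        rw [hσ]
        ring
      rw [this, htail]
      linarith
    have hE : ‖q‖ * ‖∑ m ∈ Finset.Ioc ⌊y⌋₊ N, (muPow k m : ℂ) *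
          tentMean (fun u => ((u ^ (1 / (b : ℝ)) : ℝ) : ℂ)) x ((m : ℝ) ^ c)‖ ≤
        ‖q‖ * C₄ * x ^ (θ + 3 * ε) := by
      rcases hq with rfl | hq
      · simp
      rw [mul_assoc]
      gcongr
      refine (h₄ x y N hx hy1).trans ?_
      gcongr
      refine hyx _ _ ?_
      have hle : 1 / (b : ℝ) ≤ 1 / (2 * a) :=
        one_div_le_one_div_of_le (by positivity) (by exact_mod_cast hq)
      -- The exponent `γ + ρ(1/2 - cγ) = (a/D)γ + ρ/2` increases with `γ` and equals `θ` at `γ =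
      -- 1/(2a)`, so the power `γ = 1/b ≤ 1/(2a)` does no harm.
      have e1 : 1 / b + ρ * (1 / 2 + ε - c * (1 / (b : ℝ))) =
          a / D * (1 / b) + ρ / 2 + ρ * ε := by
        have : a / D = 1 - c * ρ := by linarith
        rw [this]
        ring
      have e2 : θ = a / D * (1 / (2 * a)) + ρ / 2 := by
        have : a / D = 1 - c * ρ := by linarith
        rw [this, ← htail]
        ring
      have e3 : a / D * (1 / (b : ℝ)) ≤ a / D * (1 / (2 * a)) := by gcongr
      have e4 : ρ * ε ≤ 1 * ε := by gcongr
      linarith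
    rw [hsplit]
    refine (norm_add_le _ _).trans ?_
    rw [norm_mul, add_mul]
    exact add_le_add hT hE
  have hI := norm_integral_fError_mul_tent_le k ha hab hbc hx hP hQ
  have hS : C₁ * x ^ ε ≤ C₁ * x ^ (θ + 3 * ε) := by
    gcongr
    linarith
  rw [Real.norm_eq_abs, abs_of_nonneg (by positivity : 0 ≤ x ^ (θ + 3 * ε))]
  calc ‖fError k a b c x‖ ≤
        ‖fError k a b c x - ∫ u in Set.Ioi (0 : ℝ), fError k a b c u * (tent x u : ℂ)‖ +
          ‖∫ u in Set.Ioi (0 : ℝ), fError k a b c u * (tent x u : ℂ)‖ := by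
        rw [add_comm]
        exact norm_le_insert' _ _
    _ ≤ C₁ * x ^ (θ + 3 * ε) + (C₂ * x ^ (θ + 3 * ε) + (C₃ + ‖q‖ * C₄) * x ^ (θ + 3 * ε)) :=
        add_le_add ((h₁ x hx).trans hS) hI
    _ = _ := by ring

theorem hasErrorExponent_fError (hRH : RiemannHypothesis) (k : ℕ) {a b c : ℕ} (ha : 1 ≤ a)
    (hab : a ≤ b) (hbc : b < c) {α : ℝ} (hα0 : 0 < α) (haα : 2 * a * α < 1) (hcα : c * α < 1)
    (hα : HasErrorExponent (divisorError a b) α) :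
    HasErrorExponent (fError k a b c) ((1 - a * α) / (a + c - 2 * a * c * α)) := by
  intro ε₀ hε₀
  have hb := ha.trans hab
  have ha0 : (0 : ℝ) < a := by exact_mod_cast ha
  have hb0 : (0 : ℝ) < b := by exact_mod_cast hb
  have hc0 : (0 : ℝ) < c := by exact_mod_cast hb.trans hbc.le
  have hab' : (a : ℝ) ≤ b := by exact_mod_cast hab
  obtain ⟨p, q, r, -, hmain⟩ := exists_divisorMain_eq a b
  have hα2 : α < 1 / (2 * a) := by
    rw [lt_div_iff₀ (by positivity)]
    linarith
  have hD : ∀ u, divisorError a b u =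
      (divisorSum a b u : ℂ) - mainTerm p q r (1 / (a : ℝ)) (1 / (b : ℝ)) u := fun u => by
    rw [divisorError, hmain]
  have ha2 : 1 / (2 * (a : ℝ)) + 1 / (2 * a) = 1 / a := by
    field_simp
    norm_num
  have hre : ∀ ε t : ℝ, (((1 / (2 * a) + ε : ℝ) : ℂ) + t * Complex.I).re = 1 / (2 * a) + ε := by
    simp
  have him : ∀ ε t : ℝ, (((1 / (2 * a) + ε : ℝ) : ℂ) + t * Complex.I).im = t := by
    simp
  have key : ∀ ε' : ℝ, 0 < ε' → ∃ ε : ℝ, 0 < ε ∧ 3 * ε ≤ ε₀ ∧ ε ≤ 1 / 2 ∧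
      c * ε ≤ 1 - c * α ∧ ε < 1 / (2 * a) ∧ ε < ε' := by
    intro ε' hε'
    have h1 : 0 < (1 - c * α) / c := div_pos (by linarith) hc0
    have h2 : 0 < 1 / (2 * (a : ℝ)) := by positivity
    obtain ⟨ε, h0, hlt⟩ := exists_between (lt_min (lt_min (by linarith : 0 < ε₀ / 3) one_half_pos)
      (lt_min h1 (lt_min h2 hε')))
    simp only [lt_min_iff] at hlt
    obtain ⟨⟨h3, h4⟩, h5, h6, h7⟩ := hlt
    rw [lt_div_iff₀' hc0] at h5
    exact ⟨ε, h0, by linarith, h4.le, h5.le, h6, h7⟩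
  have weaken : ∀ {θ ε : ℝ}, 3 * ε ≤ ε₀ →
      fError k a b c =O[atTop] (fun x : ℝ => x ^ (θ + 3 * ε)) →
      fError k a b c =O[atTop] fun x : ℝ => x ^ (θ + ε₀) := by
    intro θ ε hle hO
    refine hO.trans (IsBigO.of_bound 1 ?_)
    filter_upwards [eventually_ge_atTop 1] with x hx
    rw [one_mul, Real.norm_eq_abs, Real.norm_eq_abs, abs_of_nonneg (by positivity),
      abs_of_nonneg (by positivity)]
    exact Real.rpow_le_rpow_of_exponent_le hx (by linarith)
  -- If `b < 2a`, a small `ε` keeps the line `1/(2a) + ε` to the left of `1/b` and `Δ` itself can be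
  -- transformed. Otherwise the line is to the right of `1/b`, and the `u^(1/b)` term has to be put
  -- back into `h` before transforming.
  rcases lt_or_ge b (2 * a) with hlt | hge
  · have hlt' : (b : ℝ) < 2 * a := by exact_mod_cast hlt
    have hgap := one_div_lt_one_div_of_lt hb0 hlt'
    obtain ⟨ε, hε, h3, h2, hεc, hεa, hεb⟩ := key _ (sub_pos.2 hgap)
    refine weaken h3 (fError_isBigO hRH k ha hab hbc hα0 haα hα hε h2 hεc hεa
      (h := divisorError a b) (q := 0) (by simp) (isTame_divisorError ha hb) (fun t => ?_) ?_
      (Or.inl rfl))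
    · have hO := hα ε hε
      rw [funext hD] at hO ⊢
      have := hasMellin_divisorSum_sub_mainTerm ha hb (one_div_pos.2 ha0) (one_div_pos.2 hb0) hO
        (s := ((1 / (2 * a) + ε : ℝ) : ℂ) + t * Complex.I) (by rw [hre]; linarith)
        (by rw [hre]; linarith) (Or.inr (by rw [hre]; linarith))
      rwa [him] at this
    · have : 1 / (2 * a) + ε < 1 / (b : ℝ) := by linarith
      rw [lt_div_iff₀' hb0] at this
      exact this.ne
  · have hge' : 2 * (a : ℝ) ≤ b := by exact_mod_cast hge
    obtain ⟨ε, hε, h3, h2, hεc, hεa, -⟩ := key 1 one_pos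
    have hle : 1 / (b : ℝ) ≤ 1 / (2 * a) := one_div_le_one_div_of_le (by positivity) hge'
    have hM : ∀ u, (divisorSum a b u : ℂ) - mainTerm p 0 r (1 / (a : ℝ)) (1 / (b : ℝ)) u =
        divisorError a b u + q * ((u ^ (1 / (b : ℝ)) : ℝ) : ℂ) := by
      intro u
      rw [hD]
      simp only [mainTerm]
      ring
    refine weaken h3 (fError_isBigO hRH k ha hab hbc hα0 haα hα hε h2 hεc hεa
      (h := fun u => (divisorSum a b u : ℂ) - mainTerm p 0 r (1 / (a : ℝ)) (1 / (b : ℝ)) u)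
      (q := -q) (fun u => ?_)
      ((isTame_divisorSum a b).sub
        (isTame_mainTerm p 0 r (one_div_pos.2 ha0) (one_div_pos.2 hb0))) (fun t => ?_) ?_
      (Or.inr hge))
    · rw [hM]
      ring
    -- With the `u^(1/b)` term restored, the growth exponent is `max (α + ε) (1/b)`, still below
    -- `1/(2a) + ε`.
    · have hO : (fun u => (divisorSum a b u : ℂ) -
          mainTerm p 0 r (1 / (a : ℝ)) (1 / (b : ℝ)) u) =O[atTop]
            fun u : ℝ => u ^ max (α + ε) (1 / (b : ℝ)) := by
        have hpow : ∀ β : ℝ, β ≤ max (α + ε) (1 / (b : ℝ)) →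
            (fun u : ℝ => u ^ β) =O[atTop] fun u : ℝ => u ^ max (α + ε) (1 / (b : ℝ)) := by
          intro β hβ
          refine IsBigO.of_bound 1 ?_
          filter_upwards [eventually_ge_atTop 1] with u hu
          rw [one_mul, Real.norm_eq_abs, Real.norm_eq_abs, abs_of_nonneg (by positivity),
            abs_of_nonneg (by positivity)]
          exact Real.rpow_le_rpow_of_exponent_le hu hβ
        rw [funext hM]
        refine ((hα ε hε).trans (hpow _ (le_max_left _ _))).add ?_
        refine IsBigO.trans (IsBigO.of_bound ‖q‖ ?_) (hpow _ (le_max_right _ _))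
        filter_upwards with u
        rw [norm_mul, Complex.norm_real]
      have := hasMellin_divisorSum_sub_mainTerm ha hb (one_div_pos.2 ha0) (one_div_pos.2 hb0) hO
        (s := ((1 / (2 * a) + ε : ℝ) : ℂ) + t * Complex.I)
        (by rw [hre]; exact max_lt (by linarith) (by linarith))
        (by rw [hre]; linarith) (Or.inl rfl)
      rwa [him] at this
    · have : 1 / (b : ℝ) < 1 / (2 * a) + ε := by linarith
      rw [div_lt_iff₀' hb0] at this
      exact this.ne'

end AsymDivisor

end

theorem corollary1 (hRH : RiemannHypothesis) (k a b c : ℕ) (hk : 1 ≤ k) (ha : 1 ≤ a)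
    (hab : a ≤ b) (hbc : b < c) (hc : c < 2 * (a + b)) (α : ℝ) (hα0 : 0 < α)
    (hα1 : α < 1 / ((a : ℝ) + b)) (hαc : α < 1 / (c : ℝ))
    (hα : AsymDivisor.HasErrorExponent (AsymDivisor.divisorError a b) α) :
    AsymDivisor.theta k a b c ≤
      (((1 - a * α) / (a + c - 2 * a * c * α) : ℝ) : EReal) := by
  have ha0 : (0 : ℝ) < a := by exact_mod_cast ha
  have hab' : (a : ℝ) ≤ b := by exact_mod_cast hab
  have hc0 : (0 : ℝ) < c := by exact_mod_cast (ha.trans hab).trans hbc.le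
  -- From `α < 1/(a+b)` and `a ≤ b`. It puts the line `1/(2a)` to the right of `α` and makes the
  -- denominator `a + c - 2acα` positive.
  have haα : 2 * a * α < 1 := by
    rw [lt_div_iff₀ (by linarith)] at hα1
    nlinarith
  have hcα : c * α < 1 := by rwa [lt_div_iff₀' hc0] at hαc
  exact sInf_le ⟨_, AsymDivisor.hasErrorExponent_fError hRH k ha hab hbc hα0 haα hcα hα, rfl⟩
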